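/- Let $k\in\{0,1,2,\dots\}$, $x>0$, let $\lambda:[0,\infty)\to[0,\infty)$ be Borel, and let $\Psi$ be a probability law on $(0,\infty)\times(0,\infty]$. Consider the following single-server queue with waiting room of size $k$ (not counting the customer in service) under the preemptive-resume last-come, first-served discipline. At time $0$ there is exactly one customer, with remaining service time $x$. Further customers arrive according to an inhomogeneous Poisson process with rate function $\lambda(\cdot)$. Independently of the arrival process, the $i$-th arriving customer has a pair $(S_i,Y_i)$ (service time, patience time), these pairs being i.i.d. with law $\Psi$. The $i$-th arriving customer joins if and only if, at his arrival epoch, the left limit of the number of customers present (including the one in service) is less than $k+1$ and the left limit of the workload (the total remaining service time of all customers present) is at most $Y_i$; if he joins, he immediately takes over the server and requires service time $S_i$. Let $W^{(k)}_\lambda(t)$ be the workload at time $t$, let $\tau^{(k)}_\lambda=\inf\{t\ge 0: W^{(k)}_\lambda(t)=0\}$ and, for a Borel function $g:[0,\infty)\to[0,\infty)$, let $$A^{(k)}_\lambda(g;x,\Psi)=\int_0^{\tau^{(k)}_\lambda} g\big(W^{(k)}_\lambda(t)\big)\,dt\in[0,\infty].$$ For a constant $\lambda_h\ge 0$ write $A^{(k)}_{\lambda_h}(g;x,\Psi)$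 for the same functional when the arrival rate is constantly equal to $\lambda_h$. Proposition. Assume that $\lambda(t)\le\lambda_h$ for every $t\ge 0$. Then for every Borel function $g:[0,\infty)\to[0,\infty)$, every $x>0$, every such $\Psi$ and every finite $k\ge 0$: 1. $A^{(k)}_\lambda(g;x,\Psi)\le_{\rm st}A^{(k)}_{\lambda_h}(g;x,\Psi)$, i.e. both are ($[0,\infty]$-valued) random variables and $P\big(A^{(k)}_\lambda(g;x,\Psi)>s\big)\le P\big(A^{(k)}_{\lambda_h}(g;x,\Psi)>s\big)$ for every $s\in[0,\infty]$; 2. if moreover $\int_0^M g(w)\,dw<\infty$ for every $M<\infty$, then $A^{(k)}_{\lambda_h}(g;x,\Psi)<\infty$ almost surely. -/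

import Mathlib

open MeasureTheory ProbabilityTheory Filter Topology
open scoped NNReal ENNReal

noncomputable section

namespace LCFSQueue

/-! ### Random input of the queue -/

/-- The number of arrival epochs in `[0, t]`; an epoch `T i = ∞` means that there are at most
`i` arrivals altogether. -/
def arrivalCount (T : ℕ → ℝ≥0∞) (t : ℝ≥0) : ℕ := {i : ℕ | T i ≤ t}.ncard

/-- `∫_s^t rate(u) du`. -/
def cumulativeRate (rate : ℝ≥0 → ℝ≥0) (s t : ℝ≥0) : ℝ≥0 :=
  (∫⁻ u in Set.Ioc (s : ℝ) t, (rate u.toNNReal : ℝ≥0∞)).toNNReal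

/-- `T 0 ≤ T 1 ≤ …` are the successive epochs of an inhomogeneous Poisson process on `[0, ∞)`
with (bounded Borel) rate function `rate`: the epochs are locally finite, the counting process
`t ↦ arrivalCount (T · ω) t` has independent increments, and its increment over `(s, t]` is
Poisson with mean `∫_s^t rate(u) du`.  The counting process vanishes almost surely at time `0`.
(The counting process is nondecreasing, so truncated subtraction in `ℕ` is the true increment.) -/
structure IsPoissonArrivals {Ω : Type*} [MeasurableSpace Ω] (rate : ℝ≥0 → ℝ≥0)
    (T : ℕ → Ω → ℝ≥0∞) (P : Measure Ω) : Prop where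
  measurable_epoch : ∀ i, Measurable (T i)
  mono : ∀ ω, Monotone fun i => T i ω
  locallyFinite : ∀ ω, Tendsto (fun i => T i ω) atTop (𝓝 ⊤)
  zero : ∀ᵐ ω ∂P, arrivalCount (fun i => T i ω) 0 = 0
  indep_increments :
    HasIndepIncrements (fun (t : ℝ≥0) ω => arrivalCount (fun i => T i ω) t) P
  law_increments : ∀ s t : ℝ≥0, s ≤ t →
    HasLaw (fun ω => arrivalCount (fun i => T i ω) t - arrivalCount (fun i => T i ω) s)
      (poissonMeasure (cumulativeRate rate s t)) P

/-- A joint law of (service time, patience time) on `(0, ∞) × (0, ∞]`. -/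
structure IsServicePatienceLaw (Ψ : Measure (ℝ≥0 × ℝ≥0∞)) : Prop where
  isProbabilityMeasure : IsProbabilityMeasure Ψ
  pos : ∀ᵐ p ∂Ψ, 0 < p.1 ∧ 0 < p.2

/-- The input of the queue: Poisson arrival epochs with rate function `rate` and, independent of
them, an i.i.d. sequence `mark i = (service time, patience time)` with law `Ψ`. -/
structure IsQueueInput {Ω : Type*} [MeasurableSpace Ω] (rate : ℝ≥0 → ℝ≥0)
    (Ψ : Measure (ℝ≥0 × ℝ≥0∞)) (T : ℕ → Ω → ℝ≥0∞) (mark : ℕ → Ω → ℝ≥0 × ℝ≥0∞)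
    (P : Measure Ω) : Prop where
  arrivals : IsPoissonArrivals rate T P
  measurable_mark : ∀ i, Measurable (mark i)
  law_mark : ∀ i, HasLaw (mark i) Ψ P
  indep_mark : iIndepFun mark P
  indep_arrivals_mark : IndepFun (fun ω i => T i ω) (fun ω i => mark i ω) P

/-! ### Pathwise dynamics

The state of the system is the list of the remaining service times of the customers present.  The
head of the list is the customer in service, and the others are waiting, the most recently
preempted one first. -/

/-- The state after `d` units of time without arrivals. -/
def serve : ℝ≥0 → List ℝ≥0 → List ℝ≥0
  | _, [] => []
  | d, r :: q => if r ≤ d then serve (d - r) q else (r - d) :: q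

/-- The left limit at `d` of `u ↦ serve u q`: a customer whose service ends exactly at time `d`
is still present (with remaining service time `0`). -/
def serveLeft : ℝ≥0 → List ℝ≥0 → List ℝ≥0
  | _, [] => []
  | d, r :: q => if r < d then serveLeft (d - r) q else (r - d) :: q

/-- The state immediately after an arrival that occurs `d` units of time after the system was in
state `q`, in a system with `k` waiting places.  The arriving customer has service time `m.1` and
patience time `m.2`.  He joins if and only if the left limit of the queue length is less than
`k + 1` and the left limit of the workload is at most `m.2`; in that case he preempts the customer
in service. -/
def arrive (k : ℕ) (d : ℝ≥0) (m : ℝ≥0 × ℝ≥0∞) (q : List ℝ≥0) : List ℝ≥0 :=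
  if (serveLeft d q).length < k + 1 ∧ (((serveLeft d q).sum : ℝ≥0) : ℝ≥0∞) ≤ m.2 then
    m.1 :: serve d q
  else serve d q

/-- Time `0` for `n = 0`, and the epoch of the `n`-th arrival for `n ≥ 1`. -/
def lastEpoch (T : ℕ → ℝ≥0∞) : ℕ → ℝ≥0
  | 0 => 0
  | n + 1 => (T n).toNNReal

/-- The state immediately after the `n`-th arrival (at time `0` if `n = 0`); only used when that
arrival takes place at a finite time. -/
def stateAfter (k : ℕ) (x : ℝ≥0) (T : ℕ → ℝ≥0∞) (mark : ℕ → ℝ≥0 × ℝ≥0∞) : ℕ → List ℝ≥0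
  | 0 => [x]
  | n + 1 => arrive k (lastEpoch T (n + 1) - lastEpoch T n) (mark n) (stateAfter k x T mark n)

/-- The state at time `t`. -/
def state (k : ℕ) (x : ℝ≥0) (T : ℕ → ℝ≥0∞) (mark : ℕ → ℝ≥0 × ℝ≥0∞) (t : ℝ≥0) : List ℝ≥0 :=
  serve (t - lastEpoch T (arrivalCount T t)) (stateAfter k x T mark (arrivalCount T t))

/-- The workload at time `t`: the sum of the remaining service times of all customers present. -/
def workload (k : ℕ) (x : ℝ≥0) (T : ℕ → ℝ≥0∞) (mark : ℕ → ℝ≥0 × ℝ≥0∞) (t : ℝ≥0) : ℝ≥0 :=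
  (state k x T mark t).sum

/-- The first time at which the queue is empty (`∞` if there is no such time). -/
def emptyTime (k : ℕ) (x : ℝ≥0) (T : ℕ → ℝ≥0∞) (mark : ℕ → ℝ≥0 × ℝ≥0∞) : ℝ≥0∞ :=
  ⨅ (t : ℝ≥0) (_ : workload k x T mark t = 0), (t : ℝ≥0∞)

/-- The holding cost `∫_0^τ g(W(t)) dt`, with values in `[0, ∞]`. -/
def holdingCost (k : ℕ) (g : ℝ≥0 → ℝ≥0) (x : ℝ≥0) (T : ℕ → ℝ≥0∞) (mark : ℕ → ℝ≥0 × ℝ≥0∞) :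
    ℝ≥0∞ :=
  ∫⁻ t in {t : ℝ | 0 ≤ t ∧ ENNReal.ofReal t < emptyTime k x T mark},
    (g (workload k x T mark t.toNNReal) : ℝ≥0∞)

/-! ### Stochastic order -/

/-- First-order stochastic dominance `X ≤_st Y` of `[0, ∞]`-valued random variables, possibly
defined on different probability spaces. -/
def StochLE {Ω Ω' : Type*} [MeasurableSpace Ω] [MeasurableSpace Ω'] (P : Measure Ω)
    (P' : Measure Ω') (X : Ω → ℝ≥0∞) (Y : Ω' → ℝ≥0∞) : Prop :=
  AEMeasurable X P ∧ AEMeasurable Y P' ∧ ∀ s : ℝ≥0∞, P {ω | s < X ω} ≤ P' {ω | s < Y ω}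

end LCFSQueue

end

/-!
The stochastic comparison and the finiteness of the holding cost rest on the following ideas.

*Reduction to a recursion.*  `costUpTo k g c n` follows the cost up to the `n`-th arrival by
recursion on the arrivals and charges `c` if the system has not been emptied by then.  With `c = 0`
it increases to the holding cost for every path (`holdingCost_eq_iSup`); with `c = ∞` it
overestimates the cost.  Both statements of the theorem only concern the law of the input.  This law
is determined by the rate function (`IsPoissonArrivals.map_epoch_eq`, `IsQueueInput.map_eq`), so the
arrival epochs may be taken to be the partial sums of independent exponential variables, mapped by
the inverse of the cumulative rate (`isPoissonArrivals_epochOf_clock`).  That this is a Poisson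
process follows from the joint characteristic function of the increments, which solves a renewal
equation (`integral_renewal`, `integral_exp_increments`).  In this model, conditioning on the first
arrival turns the expectation of a function `φ` of `costUpTo` into iterates of an explicit one-step
operator `hazardStep` (`value_succ`), in which the arrival rate enters as the hazard rate of the
first arrival.

*Comparison.*  For the constant rate `β`, let `homLimit` be the decreasing limit of the iterates
started from the overestimate `φ ∞`.  It is a fixed point of the homogeneous one-step operator, and
it is monotone in the state: under the preemptive discipline, additional customers on top of a state
`b` have to leave before the service of `b` is resumed, and they only add to the cost
(`homLimit_le_append`).  Hence an arrival never decreases the value.  Therefore a lower hazard rate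
yields a lower value, that is, `hazardStep` with a rate bounded by `β` maps `homLimit` below itself
(`hazardStep_homLimit_le`; along the service of the present customers, the difference of the two
sides satisfies a linear differential inequality).  By induction, the expectation of `φ` of the
underestimate in the inhomogeneous system is at most `homLimit` (`value_zero_le_homLimit`).  Taking
`φ` to be the indicator function of `(s, ∞]` gives the stochastic order, provided that the over- and
the underestimate agree in the limit, that is, provided that the homogeneous system is emptied
almost surely.

*Termination.*  The probability `neverEmpty` that the homogeneous system is never emptied is the
value for `g = 0` and `φ` the indicator function of `∞`.  It vanishes on the empty state, and a
downward induction on the number of waiting customers shows that a further customer on top of a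
state does not increase it (`neverEmpty_cons_le`).  When the waiting room is full, nobody can
preempt him; otherwise, by the induction hypothesis, a preempting customer on top of him does not
increase the probability either.  So each time he holds the server he has another chance of at
least `exp (-β R)` to leave without interruption, where `R` bounds his service time.
-/

noncomputable section

namespace LCFSQueue

/-! ### The flow of the state between arrivals -/

lemma sum_serve (d : ℝ≥0) (q : List ℝ≥0) : (serve d q).sum = q.sum - d := by
  induction q generalizing d with
  | nil => simp [serve]
  | cons r q ih =>
    rw [serve]
    split_ifs with h
    · rw [ih, List.sum_cons]
      conv_rhs => rw [← add_tsub_cancel_of_le h]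
      rw [add_tsub_add_eq_tsub_left]
    · rw [List.sum_cons, List.sum_cons, tsub_add_eq_add_tsub (not_le.1 h).le]

lemma serve_serve (a b : ℝ≥0) (q : List ℝ≥0) : serve b (serve a q) = serve (a + b) q := by
  induction q generalizing a b with
  | nil => simp [serve]
  | cons r q ih =>
    rw [serve, serve]
    by_cases h : r ≤ a
    · rw [if_pos h, if_pos (h.trans le_self_add), ih, tsub_add_eq_add_tsub h]
    · rw [if_neg h, serve]
      have h' := (not_le.1 h).le
      by_cases hb : r - a ≤ b
      · have hb' : r ≤ a + b := tsub_le_iff_left.1 hb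
        rw [if_pos hb, if_pos hb']
        congr 1
        rw [← NNReal.coe_inj, NNReal.coe_sub hb, NNReal.coe_sub h', NNReal.coe_sub hb',
          NNReal.coe_add]
        ring
      · rw [if_neg hb, if_neg fun hc => hb (tsub_le_iff_left.2 hc), tsub_tsub]

lemma serve_append {d : ℝ≥0} {p : List ℝ≥0} (b : List ℝ≥0) (h : d < p.sum) :
    serve d (p ++ b) = serve d p ++ b := by
  induction p generalizing d with
  | nil => simp at h
  | cons r p ih =>
    rw [List.cons_append, serve, serve]
    split_ifs with hr
    · exact ih ((tsub_lt_iff_left hr).2 (by simpa using h))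
    · rfl

lemma serve_append_of_sum_le {d : ℝ≥0} {p : List ℝ≥0} (b : List ℝ≥0) (h : p.sum ≤ d) :
    serve d (p ++ b) = serve (d - p.sum) b := by
  induction p generalizing d with
  | nil => simp
  | cons r p ih =>
    rw [List.sum_cons] at h
    have hr : r ≤ d := le_self_add.trans h
    rw [List.cons_append, serve, if_pos hr, ih (le_tsub_of_add_le_left h), List.sum_cons, tsub_tsub]

lemma serveLeft_add (a : ℝ≥0) {b : ℝ≥0} (hb : 0 < b) (q : List ℝ≥0) :
    serveLeft (a + b) q = serveLeft b (serve a q) := by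
  induction q generalizing a with
  | nil => simp [serve, serveLeft]
  | cons r q ih =>
    rw [serve, serveLeft]
    by_cases h : r ≤ a
    · rw [if_pos h, if_pos (h.trans_lt (lt_add_of_pos_right a hb)), ← ih, tsub_add_eq_add_tsub h]
    · rw [if_neg h, serveLeft]
      have h' := (not_le.1 h).le
      by_cases hr : r < a + b
      · have hr' : r - a < b := (tsub_lt_iff_left h').2 hr
        rw [if_pos hr, if_pos hr']
        congr 1
        rw [← NNReal.coe_inj, NNReal.coe_sub hr'.le, NNReal.coe_sub h', NNReal.coe_sub hr.le,
          NNReal.coe_add]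
        ring
      · rw [if_neg hr, if_neg fun hc => hr ((tsub_lt_iff_left h').1 hc), tsub_tsub]

/-- An arrival `v + u` time units from now acts as an arrival `u` time units after the state has
evolved for time `v`.  For `u = 0` this may fail, since the left limit at `v` still counts a
customer whose service ends at `v`. -/
lemma arrive_add (k : ℕ) (v : ℝ≥0) {u : ℝ≥0} (hu : 0 < u) (m : ℝ≥0 × ℝ≥0∞) (q : List ℝ≥0) :
    arrive k (v + u) m q = arrive k u m (serve v q) := by
  rw [arrive, arrive, serveLeft_add v hu, serve_serve]

lemma arrive_eq_or (k : ℕ) (d : ℝ≥0) (m : ℝ≥0 × ℝ≥0∞) (q : List ℝ≥0) :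
    arrive k d m q = serve d q ∨
      (arrive k d m q = m.1 :: serve d q ∧ (serveLeft d q).length < k + 1) := by
  rw [arrive]
  split_ifs with h
  · exact Or.inr ⟨rfl, h.1⟩
  · exact Or.inl rfl

/-! ### The holding cost between and up to arrivals -/

/-- The holding cost incurred while the workload decreases from `w` at unit rate, without
arrivals, during `d` time units or until it vanishes. -/
def segCost (g : ℝ≥0 → ℝ≥0) (w : ℝ≥0) (d : ℝ≥0∞) : ℝ≥0∞ :=
  ∫⁻ u in Set.Ioc (((w : ℝ≥0∞) - d).toReal) w, (g u.toNNReal : ℝ≥0∞)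

lemma segCost_of_le (g : ℝ≥0 → ℝ≥0) {w : ℝ≥0} {d : ℝ≥0∞} (h : (w : ℝ≥0∞) ≤ d) :
    segCost g w d = segCost g w ⊤ := by
  rw [segCost, segCost, tsub_eq_zero_of_le h, tsub_eq_zero_of_le le_top]

lemma segCost_zero_left (g : ℝ≥0 → ℝ≥0) (d : ℝ≥0∞) : segCost g 0 d = 0 := by
  simp [segCost]

lemma segCost_zero_fun (w : ℝ≥0) (d : ℝ≥0∞) : segCost (fun _ => 0) w d = 0 := by
  simp [segCost]

lemma segCost_add (g : ℝ≥0 → ℝ≥0) (w a : ℝ≥0) (b : ℝ≥0∞) :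
    segCost g w (a + b) = segCost g w a + segCost g (w - a) b := by
  have e : ((w : ℝ≥0∞) - (a + b)).toReal = (((w - a : ℝ≥0) : ℝ≥0∞) - b).toReal := by
    rw [ENNReal.coe_sub, tsub_tsub]
  have e' : ((w : ℝ≥0∞) - a).toReal = ((w - a : ℝ≥0) : ℝ) := by
    rw [← ENNReal.coe_sub]; rfl
  have h1 : (((w - a : ℝ≥0) : ℝ≥0∞) - b).toReal ≤ ((w - a : ℝ≥0) : ℝ) := by
    exact ENNReal.toReal_mono (b := ((w - a : ℝ≥0) : ℝ≥0∞)) ENNReal.coe_ne_top tsub_le_self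
  have h2 : ((w - a : ℝ≥0) : ℝ) ≤ w := NNReal.coe_le_coe.2 tsub_le_self
  rw [segCost, segCost, segCost, e, e', ← Set.Ioc_union_Ioc_eq_Ioc h1 h2,
    lintegral_union measurableSet_Ioc, add_comm]
  rw [Set.disjoint_left]
  intro u hu hu'
  exact absurd hu.2 (not_le.2 hu'.1)

lemma segCost_lt_top {g : ℝ≥0 → ℝ≥0}
    (hg : ∀ M : ℝ≥0, ∫⁻ w in Set.Ioc (0 : ℝ) M, (g w.toNNReal : ℝ≥0∞) < ⊤) (w : ℝ≥0) (d : ℝ≥0∞) :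
    segCost g w d < ⊤ :=
  (lintegral_mono_set (Set.Ioc_subset_Ioc_left ENNReal.toReal_nonneg)).trans_lt (hg w)

/-- The cost of the system that is in state `q` at time `t`, when the later arrival epochs are
`T 0 ≤ T 1 ≤ …` and the marks of these arrivals are `m 0, m 1, …`.  The cost is followed up to the
`n`-th arrival; if the system has not been emptied before, the remaining cost is replaced by the
constant `c`.  The choice `c = 0` underestimates the cost, and `c = ∞` overestimates it. -/
def costUpTo (k : ℕ) (g : ℝ≥0 → ℝ≥0) (c : ℝ≥0∞) :
    ℕ → ℝ≥0 → List ℝ≥0 → (ℕ → ℝ≥0∞) → (ℕ → ℝ≥0 × ℝ≥0∞) → ℝ≥0∞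
  | 0, _, _, _, _ => c
  | n + 1, t, q, T, m =>
    if (q.sum : ℝ≥0∞) < T 0 - t then segCost g q.sum ⊤
    else segCost g q.sum (T 0 - t) + costUpTo k g c n (T 0).toNNReal
      (arrive k ((T 0).toNNReal - t) (m 0) q) (fun i => T (i + 1)) (fun i => m (i + 1))

lemma costUpTo_zero_le_top (k : ℕ) (g : ℝ≥0 → ℝ≥0) (i j : ℕ) (t : ℝ≥0) (q : List ℝ≥0)
    (T : ℕ → ℝ≥0∞) (m : ℕ → ℝ≥0 × ℝ≥0∞) :
    costUpTo k g 0 i t q T m ≤ costUpTo k g ⊤ j t q T m := by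
  induction i generalizing j t q T m with
  | zero => simp [costUpTo]
  | succ i ih =>
    cases j with
    | zero => simp [costUpTo]
    | succ j =>
      rw [costUpTo, costUpTo]
      split_ifs
      · exact le_rfl
      · gcongr
        exact ih _ _ _ _ _

lemma costUpTo_zero_le_succ (k : ℕ) (g : ℝ≥0 → ℝ≥0) (n : ℕ) (t : ℝ≥0) (q : List ℝ≥0)
    (T : ℕ → ℝ≥0∞) (m : ℕ → ℝ≥0 × ℝ≥0∞) :
    costUpTo k g 0 n t q T m ≤ costUpTo k g 0 (n + 1) t q T m := by
  induction n generalizing t q T m with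
  | zero => exact zero_le
  | succ n ih =>
    rw [costUpTo, costUpTo]
    split_ifs
    · exact le_rfl
    · gcongr
      exact ih _ _ _ _

/-- For `g = 0` the overestimate `costUpTo k 0 ∞ n` is `∞` or `0` according as the system survives
`n` arrivals or not.  In the second case the under- and the overestimate of the cost coincide. -/
lemma costUpTo_top_eq_zero (k : ℕ) (g : ℝ≥0 → ℝ≥0) (n : ℕ) (t : ℝ≥0) (q : List ℝ≥0)
    (T : ℕ → ℝ≥0∞) (m : ℕ → ℝ≥0 × ℝ≥0∞) (h : costUpTo k (fun _ => 0) ⊤ n t q T m ≠ ⊤) :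
    costUpTo k g ⊤ n t q T m = costUpTo k g 0 n t q T m := by
  induction n generalizing t q T m with
  | zero => exact absurd rfl h
  | succ n ih =>
    rw [costUpTo] at h ⊢
    rw [costUpTo]
    split_ifs with h0
    · rfl
    · rw [if_neg h0, segCost_zero_fun, zero_add] at h
      rw [ih _ _ _ _ h]

lemma costUpTo_top_lt_top {g : ℝ≥0 → ℝ≥0}
    (hg : ∀ M : ℝ≥0, ∫⁻ w in Set.Ioc (0 : ℝ) M, (g w.toNNReal : ℝ≥0∞) < ⊤)
    (k : ℕ) (n : ℕ) (t : ℝ≥0) (q : List ℝ≥0) (T : ℕ → ℝ≥0∞) (m : ℕ → ℝ≥0 × ℝ≥0∞)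
    (h : costUpTo k (fun _ => 0) ⊤ n t q T m ≠ ⊤) : costUpTo k g ⊤ n t q T m < ⊤ := by
  induction n generalizing t q T m with
  | zero => simp [costUpTo] at h
  | succ n ih =>
    rw [costUpTo] at h ⊢
    split_ifs with h0
    · exact segCost_lt_top hg _ _
    · rw [if_neg h0, segCost_zero_fun, zero_add] at h
      exact ENNReal.add_lt_top.2 ⟨segCost_lt_top hg _ _, ih _ _ _ _ h⟩

/-! ### The holding cost of a path as a limit over the number of arrivals -/

section Path

variable {T : ℕ → ℝ≥0∞}

/-- Monotone and locally finite epochs are determined by their counting function. -/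
lemma epoch_le_iff (hmono : Monotone T) (hfin : Tendsto T atTop (𝓝 ⊤)) (t : ℝ≥0) (i : ℕ) :
    T i ≤ t ↔ i < arrivalCount T t := by
  classical
  have hex : ∃ j, (t : ℝ≥0∞) < T j :=
    ((tendsto_order.1 hfin).1 _ ENNReal.coe_lt_top).exists
  have hset : {i : ℕ | T i ≤ t} = Set.Iio (Nat.find hex) := by
    ext i
    simp only [Set.mem_ofPred_eq, Set.mem_Iio]
    constructor
    · intro h
      by_contra hc
      exact absurd (h.trans_lt (Nat.find_spec hex)) (not_lt.2 (hmono (not_lt.1 hc)))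
    · intro h
      exact not_lt.1 (Nat.find_min hex h)
  have hcount : arrivalCount T t = Nat.find hex := by
    rw [arrivalCount, hset, ← Finset.coe_Iio, Set.ncard_coe_finset, Nat.card_Iio]
  rw [hcount, ← Set.mem_Iio, ← hset]
  rfl

lemma arrivalCount_mono (hmono : Monotone T) (hfin : Tendsto T atTop (𝓝 ⊤)) :
    Monotone fun t : ℝ≥0 => arrivalCount T t := by
  intro s t hst
  by_contra hc
  have h1 := (epoch_le_iff hmono hfin s (arrivalCount T t)).2 (not_le.1 hc)
  exact lt_irrefl _ ((epoch_le_iff hmono hfin t _).1 (h1.trans (ENNReal.coe_le_coe.2 hst)))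

lemma lt_epoch_arrivalCount (hmono : Monotone T) (hfin : Tendsto T atTop (𝓝 ⊤)) (t : ℝ≥0) :
    (t : ℝ≥0∞) < T (arrivalCount T t) :=
  not_le.1 fun h => lt_irrefl _ ((epoch_le_iff hmono hfin t _).1 h)

lemma lastEpoch_le_of_le_arrivalCount (hmono : Monotone T) (hfin : Tendsto T atTop (𝓝 ⊤))
    {t : ℝ≥0} {j : ℕ} (hj : j ≤ arrivalCount T t) : lastEpoch T j ≤ t := by
  cases j with
  | zero => exact zero_le
  | succ j =>
    have h := ENNReal.toNNReal_mono ENNReal.coe_ne_top ((epoch_le_iff hmono hfin t j).2 hj)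
    rwa [ENNReal.toNNReal_coe] at h

lemma lastEpoch_le_epoch (hmono : Monotone T) {j : ℕ} : (lastEpoch T j : ℝ≥0∞) ≤ T j := by
  cases j with
  | zero => exact zero_le
  | succ j => exact ENNReal.coe_toNNReal_le_self.trans (hmono j.le_succ)

lemma arrivalCount_eq (hmono : Monotone T) (hfin : Tendsto T atTop (𝓝 ⊤)) {t s : ℝ≥0} {j : ℕ}
    (hj : j ≤ arrivalCount T t) (h1 : lastEpoch T j ≤ s) (h2 : (s : ℝ≥0∞) < T j) :
    arrivalCount T s = j := by
  apply le_antisymm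
  · by_contra hc
    exact absurd ((epoch_le_iff hmono hfin s j).2 (not_le.1 hc)) (not_le.2 h2)
  · cases j with
    | zero => exact Nat.zero_le _
    | succ j =>
      rw [Nat.succ_le_iff, ← epoch_le_iff hmono hfin]
      have hne : T j ≠ ⊤ :=
        (((epoch_le_iff hmono hfin t j).2 hj).trans_lt ENNReal.coe_lt_top).ne
      rw [lastEpoch] at h1
      rw [← ENNReal.coe_toNNReal hne]
      exact ENNReal.coe_le_coe.2 h1

lemma workload_eq (k : ℕ) (x : ℝ≥0) (m : ℕ → ℝ≥0 × ℝ≥0∞) (t : ℝ≥0) :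
    workload k x T m t = (stateAfter k x T m (arrivalCount T t)).sum -
      (t - lastEpoch T (arrivalCount T t)) := by
  rw [workload, state, sum_serve]

/-- The system is not emptied strictly between the `l`-th and the `(l + 1)`-st arrival. -/
def Survives (k : ℕ) (x : ℝ≥0) (T : ℕ → ℝ≥0∞) (m : ℕ → ℝ≥0 × ℝ≥0∞) (l : ℕ) : Prop :=
  T l - lastEpoch T l ≤ ((stateAfter k x T m l).sum : ℝ≥0∞)

/-- At time `t` the system has never been empty if and only if it survives up to each of the
arrivals before `t` and the workload left by the last of them is not yet cleared. -/
lemma lt_emptyTime_iff (k : ℕ) (x : ℝ≥0) (m : ℕ → ℝ≥0 × ℝ≥0∞) (hmono : Monotone T)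
    (hfin : Tendsto T atTop (𝓝 ⊤)) (t : ℝ≥0) :
    (t : ℝ≥0∞) < emptyTime k x T m ↔ (∀ l < arrivalCount T t, Survives k x T m l) ∧
      t < lastEpoch T (arrivalCount T t) + (stateAfter k x T m (arrivalCount T t)).sum := by
  constructor
  · intro h
    have hW : ∀ s ≤ t, workload k x T m s ≠ 0 := by
      intro s hs h0
      have : emptyTime k x T m ≤ s := iInf₂_le s h0
      exact absurd (h.trans_le this) (not_lt.2 (ENNReal.coe_le_coe.2 hs))
    constructor
    · intro l hl
      by_contra hc
      rw [Survives, not_le] at hc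
      -- the instant at which the workload left by the `l`-th arrival is cleared
      set s := lastEpoch T l + (stateAfter k x T m l).sum with hs
      have hsT : (s : ℝ≥0∞) < T l := by
        rw [hs, ENNReal.coe_add, add_comm]
        exact lt_tsub_iff_right.1 hc
      have hst : s ≤ t := ENNReal.coe_le_coe.1 (hsT.le.trans ((epoch_le_iff hmono hfin t l).2 hl))
      apply hW s hst
      rw [workload_eq, arrivalCount_eq hmono hfin hl.le le_self_add hsT, hs, add_tsub_cancel_left,
        tsub_self]
    · by_contra hc
      apply hW t le_rfl
      rw [workload_eq, tsub_eq_zero_iff_le]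
      exact le_tsub_of_add_le_left (not_lt.1 hc)
  · rintro ⟨h1, h2⟩
    have hlt : (t : ℝ≥0∞) < min (T (arrivalCount T t))
        ((lastEpoch T (arrivalCount T t) + (stateAfter k x T m (arrivalCount T t)).sum : ℝ≥0)) :=
      lt_min (lt_epoch_arrivalCount hmono hfin t) (ENNReal.coe_lt_coe.2 h2)
    refine hlt.trans_le (le_iInf₂ fun s hs => ?_)
    by_contra hc
    obtain ⟨hc1, hc2⟩ := lt_min_iff.1 (not_le.1 hc)
    have hle : arrivalCount T s ≤ arrivalCount T t := by
      by_contra hn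
      exact absurd ((epoch_le_iff hmono hfin s _).2 (not_le.1 hn)) (not_le.2 hc1)
    rw [workload_eq, tsub_eq_zero_iff_le] at hs
    rcases hle.lt_or_eq with hlt' | heq
    · have h3 := h1 _ hlt'
      rw [Survives] at h3
      have h4 : (s : ℝ≥0∞) - lastEpoch T (arrivalCount T s) <
          T (arrivalCount T s) - lastEpoch T (arrivalCount T s) :=
        (ENNReal.cancel_of_ne ENNReal.coe_ne_top).tsub_lt_tsub_right_of_le
          (ENNReal.coe_le_coe.2 (lastEpoch_le_of_le_arrivalCount hmono hfin le_rfl))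
          (lt_epoch_arrivalCount hmono hfin s)
      have h5 := h4.trans_le (h3.trans (ENNReal.coe_le_coe.2 hs))
      rw [ENNReal.coe_sub] at h5
      exact lt_irrefl _ h5
    · rw [heq] at hs
      rw [ENNReal.coe_lt_coe] at hc2
      have h6 := add_le_of_le_tsub_left_of_le
        (lastEpoch_le_of_le_arrivalCount hmono hfin heq.ge) hs
      exact absurd hc2 (not_lt.2 h6)

open Classical in
lemma costUpTo_zero_eq_sum (k : ℕ) (g : ℝ≥0 → ℝ≥0) (x : ℝ≥0) (m : ℕ → ℝ≥0 × ℝ≥0∞) (n i : ℕ) :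
    costUpTo k g 0 n (lastEpoch T i) (stateAfter k x T m i) (fun l => T (l + i))
        (fun l => m (l + i)) =
      ∑ j ∈ Finset.range n, if ∀ l < j, Survives k x T m (l + i) then
        segCost g (stateAfter k x T m (j + i)).sum (T (j + i) - lastEpoch T (j + i)) else 0 := by
  induction n generalizing i with
  | zero => simp [costUpTo]
  | succ n ih =>
    rw [costUpTo, Finset.sum_range_succ']
    simp only [Nat.not_lt_zero, IsEmpty.forall_iff, implies_true, if_true, zero_add]
    have hshift : ∀ j, (∀ l < j + 1, Survives k x T m (l + i)) ↔
        Survives k x T m i ∧ ∀ l < j, Survives k x T m (l + (i + 1)) := by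
      intro j
      constructor
      · intro h
        refine ⟨by simpa using h 0 j.succ_pos, fun l hl => ?_⟩
        have := h (l + 1) (by omega)
        rwa [show l + 1 + i = l + (i + 1) by ring] at this
      · rintro ⟨h1, h2⟩ l hl
        cases l with
        | zero => simpa using h1
        | succ l =>
          have := h2 l (by omega)
          rwa [show l + (i + 1) = l + 1 + i by ring] at this
    split_ifs with h
    · rw [Finset.sum_eq_zero, zero_add, segCost_of_le g h.le]
      intro j _
      rw [if_neg]
      rw [hshift]
      rintro ⟨h1, -⟩
      exact absurd h (not_lt.2 h1)
    · have h1 : Survives k x T m i := not_lt.1 h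
      rw [add_comm]
      congr 1
      have := ih (i + 1)
      simp only [← add_assoc] at this
      simp only [hshift, h1, true_and]
      simp only [show ∀ l, l + 1 + i = l + i + 1 by intro l; ring, ← add_assoc]
      rw [← this]
      rfl

/-- The time reversal `t ↦ w - (t - a)` maps an interval between two arrivals to an interval of
workloads. -/
lemma lintegral_Ico_workload (g : ℝ≥0 → ℝ≥0) (a w : ℝ≥0) (d : ℝ≥0∞) :
    ∫⁻ t in {t : ℝ | (a : ℝ) ≤ t ∧ ENNReal.ofReal t < a + min d w},
      (g (w - (t.toNNReal - a)) : ℝ≥0∞) = segCost g w d := by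
  rw [segCost]
  have hset : {t : ℝ | (a : ℝ) ≤ t ∧ ENNReal.ofReal t < a + min d w} =
      (fun t => ((a : ℝ) + w) - t) ⁻¹' Set.Ioc (((w : ℝ≥0∞) - d).toReal) w := by
    ext t
    simp only [Set.mem_ofPred_eq, Set.mem_preimage, Set.mem_Ioc]
    rw [and_comm]
    have hx : ((a : ℝ) ≤ t ↔ (a : ℝ) + w - t ≤ w) := by constructor <;> intro <;> linarith
    rw [hx]
    refine and_congr_left fun ht => ?_
    have hat : (a : ℝ) ≤ t := hx.2 ht
    have ht0 : 0 ≤ t := a.2.trans hat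
    have hmin : (min d w) ≠ ⊤ := (lt_of_le_of_lt (min_le_right _ _) ENNReal.coe_lt_top).ne
    lift min d w to ℝ≥0 using hmin with e he
    have hsub : (w : ℝ≥0∞) - d = ((w - e : ℝ≥0) : ℝ≥0∞) := by
      rw [ENNReal.coe_sub, he]
      rcases le_total d w with hd | hd
      · rw [min_eq_left hd]
      · rw [min_eq_right hd, tsub_self, tsub_eq_zero_of_le hd]
    have hew : e ≤ w := ENNReal.coe_le_coe.1 (he.le.trans (min_le_right _ _))
    rw [hsub, ← ENNReal.coe_add, ENNReal.coe_toReal, NNReal.coe_sub hew,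
      ← ENNReal.ofReal_coe_nnreal, ENNReal.ofReal_lt_ofReal_iff_of_nonneg ht0, NNReal.coe_add]
    constructor <;> intro <;> linarith
  rw [← lintegral_indicator (by rw [hset]; exact measurableSet_Ioc.preimage (by fun_prop)),
    ← lintegral_indicator measurableSet_Ioc, ← lintegral_sub_left_eq_self
      ((Set.Ioc (((w : ℝ≥0∞) - d).toReal) (w : ℝ)).indicator _) ((a : ℝ) + w)]
  congr 1
  ext t
  rw [hset]
  by_cases h : (a : ℝ) + w - t ∈ Set.Ioc (((w : ℝ≥0∞) - d).toReal) (w : ℝ)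
  · rw [Set.indicator_of_mem h, Set.indicator_of_mem (by exact h)]
    congr 2
    have h1 : (a : ℝ) ≤ t := by linarith [h.2]
    have h2 : 0 ≤ (a : ℝ) + w - t := ENNReal.toReal_nonneg.trans h.1.le
    have ht0 : 0 ≤ t := a.2.trans h1
    have h3 : a ≤ t.toNNReal := NNReal.le_toNNReal_of_coe_le h1
    have h4 : t.toNNReal - a ≤ w := by
      rw [tsub_le_iff_left]
      apply Real.toNNReal_le_iff_le_coe.2
      rw [NNReal.coe_add]; linarith
    rw [← NNReal.coe_inj, NNReal.coe_sub h4, NNReal.coe_sub h3, Real.coe_toNNReal _ ht0,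
      Real.coe_toNNReal _ h2]
    ring
  · rw [Set.indicator_of_notMem h, Set.indicator_of_notMem (by exact h)]

theorem holdingCost_eq_iSup (k : ℕ) (g : ℝ≥0 → ℝ≥0) (x : ℝ≥0) (m : ℕ → ℝ≥0 × ℝ≥0∞)
    (hmono : Monotone T) (hfin : Tendsto T atTop (𝓝 ⊤)) :
    holdingCost k g x T m = ⨆ n, costUpTo k g 0 n 0 [x] T m := by
  classical
  have hsum := fun n => costUpTo_zero_eq_sum (T := T) k g x m n 0
  simp only [add_zero] at hsum
  have hsum' : ∀ n, costUpTo k g 0 n 0 [x] T m = ∑ j ∈ Finset.range n,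
      if ∀ l < j, Survives k x T m l then
        segCost g (stateAfter k x T m j).sum (T j - lastEpoch T j) else 0 := hsum
  simp_rw [hsum']
  rw [← ENNReal.tsum_eq_iSup_nat, holdingCost]
  -- the part of the busy period between the `j`-th and the `(j + 1)`-st arrival
  set D : ℕ → Set ℝ := fun j => if ∀ l < j, Survives k x T m l then
    {t : ℝ | ((lastEpoch T j : ℝ≥0) : ℝ) ≤ t ∧ ENNReal.ofReal t < lastEpoch T j +
      min (T j - lastEpoch T j) ((stateAfter k x T m j).sum : ℝ≥0)} else ∅ with hD
  have hDiff : ∀ (t : ℝ) (j : ℕ), t ∈ D j ↔ (0 ≤ t ∧ ENNReal.ofReal t < emptyTime k x T m) ∧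
      arrivalCount T t.toNNReal = j := by
    intro t j
    have hmin : (lastEpoch T j : ℝ≥0∞) +
        min (T j - lastEpoch T j) ((stateAfter k x T m j).sum : ℝ≥0) =
        min (T j) ((lastEpoch T j + (stateAfter k x T m j).sum : ℝ≥0)) := by
      rw [← min_add_add_left, add_tsub_cancel_of_le (lastEpoch_le_epoch hmono), ENNReal.coe_add]
    have hlt := lt_emptyTime_iff k x m hmono hfin t.toNNReal
    constructor
    · intro h
      simp only [hD] at h
      split_ifs at h with hs
      · obtain ⟨h1, h2⟩ := h
        have ht0 : 0 ≤ t := (NNReal.coe_nonneg _).trans h1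
        rw [hmin, lt_min_iff] at h2
        have h1' : lastEpoch T j ≤ t.toNNReal := NNReal.le_toNNReal_of_coe_le h1
        have hjc : arrivalCount T t.toNNReal = j := by
          cases j with
          | zero => exact arrivalCount_eq (t := 0) hmono hfin (Nat.zero_le _) h1' h2.1
          | succ j =>
            -- a surviving arrival epoch is finite
            have hne : T j ≠ ⊤ := by
              intro hT
              have := hs j j.lt_succ_self
              rw [Survives, hT, ENNReal.top_sub_coe] at this
              exact absurd this (not_le.2 ENNReal.coe_lt_top)
            refine arrivalCount_eq (t := (T j).toNNReal) hmono hfin ?_ h1' h2.1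
            rw [Nat.succ_le_iff, ← epoch_le_iff hmono hfin, ENNReal.coe_toNNReal hne]
        refine ⟨⟨ht0, hlt.2 ?_⟩, hjc⟩
        rw [hjc]
        exact ⟨hs, ENNReal.coe_lt_coe.1 h2.2⟩
      · exact h.elim
    · rintro ⟨⟨ht0, h⟩, rfl⟩
      obtain ⟨h1, h2⟩ := hlt.1 h
      simp only [hD]
      rw [if_pos h1]
      refine ⟨?_, ?_⟩
      · have := lastEpoch_le_of_le_arrivalCount hmono hfin (le_refl (arrivalCount T t.toNNReal))
        have h3 := NNReal.coe_le_coe.2 this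
        rwa [Real.coe_toNNReal _ ht0] at h3
      · rw [hmin]
        exact lt_min (lt_epoch_arrivalCount hmono hfin _) (ENNReal.coe_lt_coe.2 h2)
  have hU : {t : ℝ | 0 ≤ t ∧ ENNReal.ofReal t < emptyTime k x T m} = ⋃ j, D j := by
    ext t
    rw [Set.mem_iUnion]
    constructor
    · intro h
      exact ⟨_, (hDiff t _).2 ⟨h, rfl⟩⟩
    · rintro ⟨j, hj⟩
      exact ((hDiff t j).1 hj).1
  have hmeas : ∀ j, MeasurableSet (D j) := by
    intro j
    simp only [hD]
    split_ifs
    · exact (measurableSet_le measurable_const measurable_id).inter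
        (measurableSet_lt ENNReal.measurable_ofReal measurable_const)
    · exact MeasurableSet.empty
  have hdisj : Pairwise (Function.onFun Disjoint D) := by
    intro i j hij
    rw [Function.onFun, Set.disjoint_left]
    intro t hi hj
    exact hij (((hDiff t i).1 hi).2.symm.trans ((hDiff t j).1 hj).2)
  rw [hU, lintegral_iUnion hmeas hdisj]
  congr 1
  funext j
  have hcongr : ∫⁻ t in D j, (g (workload k x T m t.toNNReal) : ℝ≥0∞) =
      ∫⁻ t in D j, (g ((stateAfter k x T m j).sum - (t.toNNReal - lastEpoch T j)) : ℝ≥0∞) := by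
    refine setLIntegral_congr_fun (hmeas j) fun t ht => ?_
    rw [workload_eq, ((hDiff t j).1 ht).2]
  rw [hcongr]
  simp only [hD]
  split_ifs with hs
  · exact lintegral_Ico_workload g _ _ _
  · simp

end Path

/-! ### Measurability -/

/-- A set of lists is measurable if its trace on the lists of each length `n`, identified with
`Fin n → ℝ≥0`, is measurable. -/
instance listMeasurableSpace : MeasurableSpace (List ℝ≥0) :=
  ⨅ n : ℕ, MeasurableSpace.map (fun v : Fin n → ℝ≥0 => List.ofFn v) inferInstance

lemma measurable_ofFn (n : ℕ) : Measurable fun v : Fin n → ℝ≥0 => List.ofFn v :=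
  Measurable.of_le_map (iInf_le _ n)

lemma measurable_of_ofFn {β : Type*} [MeasurableSpace β] {f : List ℝ≥0 → β}
    (h : ∀ n, Measurable fun v : Fin n → ℝ≥0 => f (List.ofFn v)) : Measurable f := by
  intro s hs
  rw [listMeasurableSpace, MeasurableSpace.measurableSet_iInf]
  exact fun n => h n hs

lemma measurable_list_length : Measurable (List.length : List ℝ≥0 → ℕ) :=
  measurable_of_ofFn fun n => by simp

lemma measurable_list_getD (i : ℕ) : Measurable fun l : List ℝ≥0 => l.getD i 0 := by
  refine measurable_of_ofFn fun n => ?_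
  by_cases h : i < n
  · have : (fun v : Fin n → ℝ≥0 => (List.ofFn v).getD i 0) = fun v => v ⟨i, h⟩ := by
      ext1 v
      rw [List.getD_eq_getElem _ _ (by simpa using h), List.getElem_ofFn]
    rw [this]
    exact measurable_pi_apply _
  · have : (fun v : Fin n → ℝ≥0 => (List.ofFn v).getD i 0) = fun _ => 0 := by
      ext1 v
      rw [List.getD_eq_default _ _ (by simpa using h)]
    rw [this]
    exact measurable_const

lemma measurable_of_prod_ofFn {α β : Type*} [MeasurableSpace α] [MeasurableSpace β]
    {f : α × List ℝ≥0 → β}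
    (h : ∀ n, Measurable fun p : α × (Fin n → ℝ≥0) => f (p.1, List.ofFn p.2)) : Measurable f := by
  intro s hs
  have hset : f ⁻¹' s = ⋃ n : ℕ, {p : α × List ℝ≥0 | p.2.length = n} ∩
      (fun p : α × List ℝ≥0 => (p.1, fun i : Fin n => p.2.getD i 0)) ⁻¹'
        ((fun p : α × (Fin n → ℝ≥0) => f (p.1, List.ofFn p.2)) ⁻¹' s) := by
    ext ⟨a, l⟩
    have hl : List.ofFn (fun i : Fin l.length => l.getD i 0) = l := by
      refine List.ext_getElem (by simp) fun i h1 h2 => ?_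
      rw [List.getElem_ofFn, List.getD_eq_getElem _ _ h2]
    rw [Set.mem_iUnion]
    constructor
    · intro h
      refine ⟨l.length, rfl, ?_⟩
      rwa [Set.mem_preimage, Set.mem_preimage, hl]
    · rintro ⟨n, rfl, h⟩
      rwa [Set.mem_preimage, Set.mem_preimage, hl] at h
  rw [hset]
  refine MeasurableSet.iUnion fun n => MeasurableSet.inter ?_ ?_
  · exact (measurable_list_length.comp measurable_snd) (measurableSet_singleton n)
  · refine measurableSet_preimage ?_ (h n hs)
    exact measurable_fst.prodMk
      (measurable_pi_lambda _ fun i => (measurable_list_getD i).comp measurable_snd)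

lemma measurable_list_cons : Measurable fun p : ℝ≥0 × List ℝ≥0 => p.1 :: p.2 := by
  refine measurable_of_prod_ofFn fun n => ?_
  have : (fun p : ℝ≥0 × (Fin n → ℝ≥0) => p.1 :: List.ofFn p.2) =
      fun p => List.ofFn (Fin.cons p.1 p.2 : Fin (n + 1) → ℝ≥0) := by
    ext1 p
    simp [List.ofFn_succ]
  rw [this]
  refine (measurable_ofFn (n + 1)).comp (measurable_pi_lambda _ fun i => ?_)
  refine Fin.cases ?_ (fun j => ?_) i
  · simpa using measurable_fst
  · exact (measurable_pi_apply j).comp measurable_snd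

lemma measurable_list_sum : Measurable fun l : List ℝ≥0 => l.sum := by
  refine measurable_of_ofFn fun n => ?_
  simp only [List.sum_ofFn]
  exact Finset.measurable_fun_sum _ fun i _ => measurable_pi_apply i

lemma measurable_serve : Measurable fun p : ℝ≥0 × List ℝ≥0 => serve p.1 p.2 := by
  refine measurable_of_prod_ofFn fun n => ?_
  induction n with
  | zero => simp [serve]
  | succ n ih =>
    simp only [List.ofFn_succ, serve]
    have h0 : Measurable fun p : ℝ≥0 × (Fin (n + 1) → ℝ≥0) => p.2 0 :=
      (measurable_pi_apply 0).comp measurable_snd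
    have ht : Measurable fun p : ℝ≥0 × (Fin (n + 1) → ℝ≥0) => fun i : Fin n => p.2 i.succ :=
      measurable_pi_lambda _ fun i => (measurable_pi_apply i.succ).comp measurable_snd
    refine Measurable.ite (measurableSet_le h0 measurable_fst) ?_ ?_
    · exact ih.comp ((measurable_fst.sub h0).prodMk ht)
    · exact measurable_list_cons.comp ((h0.sub measurable_fst).prodMk ((measurable_ofFn n).comp ht))

lemma measurable_serveLeft : Measurable fun p : ℝ≥0 × List ℝ≥0 => serveLeft p.1 p.2 := by
  refine measurable_of_prod_ofFn fun n => ?_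
  induction n with
  | zero => simp [serveLeft]
  | succ n ih =>
    simp only [List.ofFn_succ, serveLeft]
    have h0 : Measurable fun p : ℝ≥0 × (Fin (n + 1) → ℝ≥0) => p.2 0 :=
      (measurable_pi_apply 0).comp measurable_snd
    have ht : Measurable fun p : ℝ≥0 × (Fin (n + 1) → ℝ≥0) => fun i : Fin n => p.2 i.succ :=
      measurable_pi_lambda _ fun i => (measurable_pi_apply i.succ).comp measurable_snd
    refine Measurable.ite (measurableSet_lt h0 measurable_fst) ?_ ?_
    · exact ih.comp ((measurable_fst.sub h0).prodMk ht)
    · exact measurable_list_cons.comp ((h0.sub measurable_fst).prodMk ((measurable_ofFn n).comp ht))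

section Comp

variable {α : Type*} [MeasurableSpace α]

lemma measurable_arrive (k : ℕ) {d : α → ℝ≥0} {m : α → ℝ≥0 × ℝ≥0∞} {q : α → List ℝ≥0}
    (hd : Measurable d) (hm : Measurable m) (hq : Measurable q) :
    Measurable fun a => arrive k (d a) (m a) (q a) := by
  have hL : Measurable fun a => serveLeft (d a) (q a) := measurable_serveLeft.comp (hd.prodMk hq)
  have hs : Measurable fun a => serve (d a) (q a) := measurable_serve.comp (hd.prodMk hq)
  unfold arrive
  refine Measurable.ite (MeasurableSet.inter ?_ ?_) ?_ hs
  · exact measurableSet_lt (measurable_list_length.comp hL) measurable_const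
  · exact measurableSet_le (measurable_list_sum.comp hL).coe_nnreal_ennreal hm.snd
  · exact measurable_list_cons.comp (hm.fst.prodMk hs)

lemma measurable_segCost {g : ℝ≥0 → ℝ≥0} (hg : Measurable g) {w : α → ℝ≥0} {d : α → ℝ≥0∞}
    (hw : Measurable w) (hd : Measurable d) : Measurable fun a => segCost g (w a) (d a) := by
  unfold segCost
  simp_rw [← lintegral_indicator measurableSet_Ioc]
  have hset : MeasurableSet {p : α × ℝ | p.2 ∈ Set.Ioc ((w p.1 : ℝ≥0∞) - d p.1).toReal (w p.1)} :=
    (measurableSet_lt ((hw.comp measurable_fst).coe_nnreal_ennreal.sub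
      (hd.comp measurable_fst)).ennreal_toReal measurable_snd).inter
      (measurableSet_le measurable_snd (hw.comp measurable_fst).coe_nnreal_real)
  exact Measurable.lintegral_prod_right' (f := fun p : α × ℝ =>
    {p : α × ℝ | p.2 ∈ Set.Ioc ((w p.1 : ℝ≥0∞) - d p.1).toReal (w p.1)}.indicator
      (fun p => (g p.2.toNNReal : ℝ≥0∞)) p)
    (Measurable.indicator (by fun_prop) hset)

lemma measurable_costUpTo (k : ℕ) {g : ℝ≥0 → ℝ≥0} (hg : Measurable g) (c : ℝ≥0∞) (n : ℕ)
    {t : α → ℝ≥0} {q : α → List ℝ≥0} {T : α → ℕ → ℝ≥0∞} {m : α → ℕ → ℝ≥0 × ℝ≥0∞}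
    (ht : Measurable t) (hq : Measurable q) (hT : Measurable T) (hm : Measurable m) :
    Measurable fun a => costUpTo k g c n (t a) (q a) (T a) (m a) := by
  induction n generalizing t q T m with
  | zero => simp [costUpTo]
  | succ n ih =>
    have hT' : ∀ i, Measurable fun a => T a i := fun i => (measurable_pi_apply i).comp hT
    have hm' : ∀ i, Measurable fun a => m a i := fun i => (measurable_pi_apply i).comp hm
    have hsum : Measurable fun a => (q a).sum := measurable_list_sum.comp hq
    have hd : Measurable fun a => T a 0 - t a := (hT' 0).sub ht.coe_nnreal_ennreal
    simp only [costUpTo]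
    refine Measurable.ite (measurableSet_lt hsum.coe_nnreal_ennreal hd)
      (measurable_segCost hg hsum measurable_const) ((measurable_segCost hg hsum hd).add ?_)
    exact ih (hT' 0).ennreal_toNNReal
      (measurable_arrive k ((hT' 0).ennreal_toNNReal.sub ht) (hm' 0) hq)
      (measurable_pi_lambda _ fun i => hT' (i + 1)) (measurable_pi_lambda _ fun i => hm' (i + 1))

end Comp

/-! ### Calculus with a bounded measurable hazard rate -/

section Calculus

variable {f : ℝ → ℝ} {C : ℝ}

lemma intervalIntegrable_of_bound (hf : Measurable f) (hC : ∀ u, |f u| ≤ C) (a b : ℝ) :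
    IntervalIntegrable f volume a b := by
  refine (intervalIntegrable_const (c := C)).mono_fun hf.aestronglyMeasurable ?_
  refine Eventually.of_forall fun u => ?_
  simp only [Real.norm_eq_abs]
  exact (hC u).trans (le_abs_self _)

lemma absolutelyContinuousOnInterval_exp_comp {F : ℝ → ℝ} {L : ℝ}
    (hF : AbsolutelyContinuousOnInterval F 0 L) :
    AbsolutelyContinuousOnInterval (fun x => Real.exp (F x)) 0 L := by
  obtain ⟨M, hM⟩ := hF.exists_bound
  have hlip : LipschitzOnWith (Real.exp M).toNNReal Real.exp (Set.Iic M) := by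
    refine (convex_Iic M).lipschitzOnWith_of_nnnorm_deriv_le
      (fun x _ => Real.differentiable_exp.differentiableAt) fun x hx => ?_
    rw [Real.deriv_exp, ← NNReal.coe_le_coe, coe_nnnorm, Real.norm_eq_abs, Real.abs_exp,
      Real.coe_toNNReal _ (Real.exp_pos _).le]
    exact Real.exp_le_exp.2 hx
  have hM' : ∀ x ∈ Set.uIcc 0 L, F x ∈ Set.Iic M := fun x hx =>
    (le_abs_self _).trans (by simpa using hM x hx)
  rw [absolutelyContinuousOnInterval_iff] at hF ⊢
  intro ε hε
  obtain ⟨δ, hδ, h⟩ := hF (ε / Real.exp M) (div_pos hε (Real.exp_pos _))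
  refine ⟨δ, hδ, fun E hE hlt => ?_⟩
  have h1 := h E hE hlt
  rw [lt_div_iff₀ (Real.exp_pos _), mul_comm, Finset.mul_sum] at h1
  refine lt_of_le_of_lt (Finset.sum_le_sum fun i hi => ?_) h1
  have hmem := hE.1 i hi
  have := hlip.dist_le_mul _ (hM' _ hmem.1) _ (hM' _ hmem.2)
  rwa [Real.coe_toNNReal _ (Real.exp_pos _).le] at this

lemma absolutelyContinuousOnInterval_exp_integral (hf : Measurable f) (hC : ∀ u, |f u| ≤ C)
    (L : ℝ) : AbsolutelyContinuousOnInterval (fun v => Real.exp (∫ u in 0..v, f u)) 0 L :=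
  absolutelyContinuousOnInterval_exp_comp
    ((intervalIntegrable_of_bound hf hC 0 L).absolutelyContinuousOnInterval_intervalIntegral
      Set.left_mem_uIcc)

lemma ae_deriv_exp_integral (hf : Measurable f) (hC : ∀ u, |f u| ≤ C) (L : ℝ) :
    ∀ᵐ v, v ∈ Set.uIcc 0 L → deriv (fun v => Real.exp (∫ u in 0..v, f u)) v =
      f v * Real.exp (∫ u in 0..v, f u) := by
  filter_upwards [(intervalIntegrable_of_bound hf hC 0 L).ae_hasDerivAt_integral] with v hv hmem
  rw [((hv hmem 0 Set.left_mem_uIcc).exp).deriv, mul_comm]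

lemma integral_mul_exp_integral (hf : Measurable f) (hC : ∀ u, |f u| ≤ C) (L : ℝ) :
    ∫ v in 0..L, f v * Real.exp (∫ u in 0..v, f u) = Real.exp (∫ u in 0..L, f u) - 1 := by
  have h := (absolutelyContinuousOnInterval_exp_integral hf hC L).integral_deriv_eq_sub
  simp only [intervalIntegral.integral_same, Real.exp_zero] at h
  rw [← h]
  refine intervalIntegral.integral_congr_ae ?_
  filter_upwards [ae_deriv_exp_integral hf hC L] with v hv hmem
  exact (hv (Set.uIoc_subset_uIcc hmem)).symm

lemma continuous_integral_of_bound (hf : Measurable f) (hC : ∀ u, |f u| ≤ C) :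
    Continuous fun v => ∫ u in 0..v, f u :=
  intervalIntegral.continuous_primitive (intervalIntegrable_of_bound hf hC) 0

/-- Let `h⁺ ≥ h`, where `h v` is the value of a reward process at age `v` and `h⁺ v` is its value
if an event occurs at age `v`.  If the value `c` at age `0` is the expected reward under event rate
`β`, then it dominates the expected reward when the event rate is lowered to `ρ ≤ β`.  The
function `v ↦ exp (-∫₀ᵛ ρ) h v` has derivative at most `-ρ v exp (-∫₀ᵛ ρ) h⁺ v`. -/
lemma integral_hazard_le {β : ℝ} {ρ hp h : ℝ → ℝ} {c L : ℝ} (hL : 0 ≤ L)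
    (hρ : Measurable ρ) (hρ0 : ∀ u, 0 ≤ ρ u) (hρβ : ∀ u, ρ u ≤ β)
    (hp_meas : Measurable hp) (hp0 : ∀ u, 0 ≤ hp u) (hp1 : ∀ u, hp u ≤ 1)
    (hle : ∀ u ∈ Set.Ioo 0 L, h u ≤ hp u)
    (hc : ∀ v ∈ Set.Icc 0 L,
      c = (∫ u in 0..v, β * Real.exp (-(β * u)) * hp u) + Real.exp (-(β * v)) * h v) :
    (∫ u in 0..L, ρ u * Real.exp (-∫ s in 0..u, ρ s) * hp u) +
      Real.exp (-∫ s in 0..L, ρ s) * h L ≤ c := by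
  have hβ : 0 ≤ β := (hρ0 0).trans (hρβ 0)
  set y : ℝ → ℝ := fun v => ∫ u in 0..v, β * Real.exp (-(β * u)) * hp u with hy
  set z : ℝ → ℝ := fun v => Real.exp (∫ u in 0..v, (β - ρ u)) with hz
  have hρ' : ∀ u, |ρ u| ≤ β := fun u => by rw [abs_of_nonneg (hρ0 u)]; exact hρβ u
  have hβρ : ∀ u, |β - ρ u| ≤ β := fun u => by
    rw [abs_of_nonneg (sub_nonneg.2 (hρβ u))]; linarith [hρ0 u]
  have hβρm : Measurable fun u => β - ρ u := measurable_const.sub hρ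
  have hz_eq : ∀ v, z v = Real.exp (β * v) * Real.exp (-∫ s in 0..v, ρ s) := by
    intro v
    rw [← Real.exp_add, hz]
    dsimp only
    rw [intervalIntegral.integral_sub intervalIntegrable_const
      (intervalIntegrable_of_bound hρ hρ' 0 v), intervalIntegral.integral_const]
    simp only [sub_zero, smul_eq_mul]
    ring_nf
  have hy_int : IntervalIntegrable (fun u => β * Real.exp (-(β * u)) * hp u) volume 0 L := by
    refine (Continuous.intervalIntegrable (u := fun u => β * Real.exp (-(β * u)))
      (by fun_prop) 0 L).mono_fun (by fun_prop) (Eventually.of_forall fun u => ?_)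
    simp only [norm_mul _ (hp u), Real.norm_of_nonneg (hp0 u)]
    exact mul_le_of_le_one_right (norm_nonneg _) (hp1 u)
  have hyac : AbsolutelyContinuousOnInterval (fun v => c - y v) 0 L := by
    have h1 := hy_int.absolutelyContinuousOnInterval_intervalIntegral
      (c := 0) Set.left_mem_uIcc
    have h2 : AbsolutelyContinuousOnInterval (fun _ : ℝ => c) 0 L :=
      ((LipschitzWith.const c).lipschitzOnWith
        (s := Set.uIcc 0 L)).absolutelyContinuousOnInterval
    exact h2.sub h1
  have hzac : AbsolutelyContinuousOnInterval z 0 L :=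
    absolutelyContinuousOnInterval_exp_integral hβρm hβρ L
  have key := hzac.integral_deriv_mul_eq_sub hyac
  have hz0 : z 0 = 1 := by simp [hz]
  have hy0 : y 0 = 0 := by simp [hy]
  have hzy : ∀ v ∈ Set.Icc 0 L, z v * (c - y v) = Real.exp (-∫ s in 0..v, ρ s) * h v := by
    intro v hv
    have : c - y v = Real.exp (-(β * v)) * h v := by rw [hc v hv]; ring
    rw [this, hz_eq, Real.exp_neg (β * v)]
    field_simp
  rw [hz0, hy0, hzy L ⟨hL, le_rfl⟩] at key
  have hρint : IntervalIntegrable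
      (fun u => ρ u * Real.exp (-∫ s in 0..u, ρ s) * hp u) volume 0 L := by
    have hm : Measurable fun u => Real.exp (-∫ s in 0..u, ρ s) :=
      (Real.continuous_exp.comp (continuous_integral_of_bound hρ hρ').neg).measurable
    refine (intervalIntegrable_const (c := β)).mono_fun
      ((hρ.mul hm).mul hp_meas).aestronglyMeasurable ?_
    rw [Filter.EventuallyLE, ae_restrict_iff' measurableSet_uIoc]
    refine Eventually.of_forall fun u hu => ?_
    rw [Set.uIoc_of_le hL] at hu
    have h1 : Real.exp (-∫ s in 0..u, ρ s) ≤ 1 := by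
      rw [Real.exp_le_one_iff, neg_nonpos]
      exact intervalIntegral.integral_nonneg hu.1.le fun s _ => hρ0 s
    rw [norm_mul, norm_mul, Real.norm_of_nonneg (hρ0 u), Real.norm_of_nonneg (Real.exp_pos _).le,
      Real.norm_of_nonneg (hp0 u), Real.norm_of_nonneg hβ]
    calc ρ u * Real.exp (-∫ s in 0..u, ρ s) * hp u ≤ β * 1 * 1 := by
          gcongr
          · exact hp0 u
          · exact hρβ u
          · exact hp1 u
      _ = β := by ring
  have hmono : (∫ v in 0..L, (deriv z v * (c - y v) + z v * deriv (fun v => c - y v) v)) ≤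
      ∫ u in 0..L, -(ρ u * Real.exp (-∫ s in 0..u, ρ s) * hp u) := by
    refine intervalIntegral.integral_mono_ae_restrict hL ?_ hρint.neg ?_
    · exact (hzac.intervalIntegrable_deriv.mul_continuousOn hyac.continuousOn).add
        (hyac.intervalIntegrable_deriv.continuousOn_mul hzac.continuousOn)
    · rw [Filter.EventuallyLE, ae_restrict_iff' measurableSet_Icc]
      have hne : ∀ᵐ v : ℝ, v ≠ 0 ∧ v ≠ L := by
        have h1 : ∀ᵐ v : ℝ, v ≠ 0 := by simp [ae_iff, measure_singleton]
        have h2 : ∀ᵐ v : ℝ, v ≠ L := by simp [ae_iff, measure_singleton]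
        filter_upwards [h1, h2] with v a b using ⟨a, b⟩
      filter_upwards [ae_deriv_exp_integral hβρm hβρ L, hy_int.ae_hasDerivAt_integral, hne]
        with v hv1 hv2 hv3 hv
      have hvu : v ∈ Set.uIcc 0 L := by rwa [Set.uIcc_of_le hL]
      have hd1 : deriv z v = (β - ρ v) * z v := hv1 hvu
      have hd2 : deriv (fun v => c - y v) v = -(β * Real.exp (-(β * v)) * hp v) :=
        ((hv2 hvu 0 Set.left_mem_uIcc).const_sub c).deriv
      rw [hd1, hd2, mul_assoc, hzy v hv, hz_eq]
      have he : Real.exp (β * v) * Real.exp (-(β * v)) = 1 := by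
        rw [← Real.exp_add]; simp
      have hE : 0 < Real.exp (-∫ s in 0..v, ρ s) := Real.exp_pos _
      have hlev := hle v ⟨lt_of_le_of_ne hv.1 hv3.1.symm, lt_of_le_of_ne hv.2 hv3.2⟩
      have h1 : (β - ρ v) * (Real.exp (-∫ s in 0..v, ρ s) * h v) ≤
          (β - ρ v) * (Real.exp (-∫ s in 0..v, ρ s) * hp v) := by
        gcongr
        exact sub_nonneg.2 (hρβ v)
      have h2 : Real.exp (β * v) * Real.exp (-∫ s in 0..v, ρ s) *
          -(β * Real.exp (-(β * v)) * hp v) =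
          -(β * (Real.exp (-∫ s in 0..v, ρ s) * hp v)) := by
        calc _ = -(β * (Real.exp (-∫ s in 0..v, ρ s) * hp v)) *
              (Real.exp (β * v) * Real.exp (-(β * v))) := by ring
          _ = _ := by rw [he, mul_one]
      rw [h2]
      linarith
  rw [intervalIntegral.integral_neg, key] at hmono
  linarith

end Calculus

lemma setLIntegral_ofReal_mul {w : ℝ → ℝ} {F : ℝ → ℝ≥0∞} {v : ℝ} (hv : 0 ≤ v)
    (hw0 : ∀ u, 0 ≤ u → 0 ≤ w u) (hw : Measurable w) (hwint : IntervalIntegrable w volume 0 v)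
    (hF : Measurable F) (hF1 : ∀ u, F u ≤ 1) :
    ∫⁻ u in Set.Ioo 0 v, ENNReal.ofReal (w u) * F u =
      ENNReal.ofReal (∫ u in 0..v, w u * (F u).toReal) := by
  have hF1' : ∀ u, (F u).toReal ≤ 1 := fun u => by
    simpa using ENNReal.toReal_mono ENNReal.one_ne_top (hF1 u)
  have hint : IntegrableOn (fun u => w u * (F u).toReal) (Set.Ioc 0 v) := by
    refine Integrable.mono ((intervalIntegrable_iff_integrableOn_Ioc_of_le hv).1 hwint)
      (hw.mul hF.ennreal_toReal).aestronglyMeasurable (Eventually.of_forall fun u => ?_)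
    rw [norm_mul, Real.norm_of_nonneg (ENNReal.toReal_nonneg (a := F u))]
    exact mul_le_of_le_one_right (norm_nonneg _) (hF1' u)
  rw [intervalIntegral.integral_of_le hv, ofReal_integral_eq_lintegral_ofReal hint]
  · rw [setLIntegral_congr Ioo_ae_eq_Ioc]
    refine setLIntegral_congr_fun measurableSet_Ioc fun u hu => ?_
    rw [ENNReal.ofReal_mul (hw0 u hu.1.le),
      ENNReal.ofReal_toReal (ne_top_of_le_ne_top ENNReal.one_ne_top (hF1 u))]
  · filter_upwards [ae_restrict_mem measurableSet_Ioc] with u hu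
    exact mul_nonneg (hw0 u hu.1.le) ENNReal.toReal_nonneg

section Hazard

variable {ρ : ℝ → ℝ} {C : ℝ}

lemma measurable_hazard_density (hρ : Measurable ρ) (hC : ∀ u, |ρ u| ≤ C) :
    Measurable fun u => ρ u * Real.exp (-∫ s in 0..u, ρ s) :=
  hρ.mul (Real.continuous_exp.comp (continuous_integral_of_bound hρ hC).neg).measurable

lemma intervalIntegrable_hazard_density (hρ : Measurable ρ) (hC : ∀ u, |ρ u| ≤ C) (v : ℝ) :
    IntervalIntegrable (fun u => ρ u * Real.exp (-∫ s in 0..u, ρ s)) volume 0 v :=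
  (intervalIntegrable_of_bound hρ hC 0 v).mul_continuousOn
    (Real.continuous_exp.comp (continuous_integral_of_bound hρ hC).neg).continuousOn

/-- A lifetime with hazard rate `ρ` ends before age `v` or survives age `v`. -/
lemma lintegral_hazard_density_add (hρ : Measurable ρ) (hρ0 : ∀ u, 0 ≤ ρ u)
    (hC : ∀ u, |ρ u| ≤ C) {v : ℝ} (hv : 0 ≤ v) :
    (∫⁻ u in Set.Ioo 0 v, ENNReal.ofReal (ρ u * Real.exp (-∫ s in 0..u, ρ s))) +
      ENNReal.ofReal (Real.exp (-∫ s in 0..v, ρ s)) = 1 := by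
  have h1 := setLIntegral_ofReal_mul (F := fun _ => 1) hv
    (fun u _ => mul_nonneg (hρ0 u) (Real.exp_pos _).le) (measurable_hazard_density hρ hC)
    (intervalIntegrable_hazard_density hρ hC v) measurable_const fun _ => le_rfl
  simp only [mul_one, ENNReal.toReal_one] at h1
  have h2 := integral_mul_exp_integral (f := fun u => -ρ u) hρ.neg
    (fun u => by rw [abs_neg]; exact hC u) v
  simp only [intervalIntegral.integral_neg, neg_mul] at h2
  have h0 : 0 ≤ ∫ u in 0..v, ρ u * Real.exp (-∫ s in 0..u, ρ s) :=
    intervalIntegral.integral_nonneg hv fun u _ => mul_nonneg (hρ0 u) (Real.exp_pos _).le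
  rw [h1, ← ENNReal.ofReal_add h0 (Real.exp_pos _).le]
  have : ((∫ u in 0..v, ρ u * Real.exp (-∫ s in 0..u, ρ s)) +
      Real.exp (-∫ s in 0..v, ρ s)) = 1 := by linarith
  rw [this, ENNReal.ofReal_one]

end Hazard

/-! ### The one-step operators -/

section Operators

variable (k : ℕ) (g : ℝ≥0 → ℝ≥0) (φ : ℝ≥0∞ → ℝ≥0∞) (Ψ : Measure (ℝ≥0 × ℝ≥0∞))

/-- The expected value after an arrival that occurs when the system has evolved for `u` time units
from state `q`; here `V a q'` is the value of state `q'` if the cost incurred so far is `a`. -/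
def afterArrival (V : ℝ≥0∞ → List ℝ≥0 → ℝ≥0∞) (a : ℝ≥0∞) (q : List ℝ≥0) (u : ℝ≥0) : ℝ≥0∞ :=
  ∫⁻ m, V (a + segCost g q.sum u) (arrive k u m q) ∂Ψ

/-- The value of state `q` if the cost incurred so far is `a`, the next arrival has hazard rate
`ρ u` after `u` time units, `V u` is the value function immediately after an arrival after `u` time
units, and `φ` is applied to the total cost once the system is empty. -/
def hazardStep (ρ : ℝ → ℝ) (V : ℝ → ℝ≥0∞ → List ℝ≥0 → ℝ≥0∞) (a : ℝ≥0∞) (q : List ℝ≥0) : ℝ≥0∞ :=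
  (∫⁻ u in Set.Ioo (0 : ℝ) q.sum, ENNReal.ofReal (ρ u * Real.exp (-∫ s in 0..u, ρ s)) *
      afterArrival k g Ψ (V u) a q u.toNNReal) +
    ENNReal.ofReal (Real.exp (-∫ s in 0..(q.sum : ℝ), ρ s)) * φ (a + segCost g q.sum ⊤)

/-- The one-step operator for the constant hazard rate `β`. -/
def homStep (β : ℝ≥0) (V : ℝ≥0∞ → List ℝ≥0 → ℝ≥0∞) : ℝ≥0∞ → List ℝ≥0 → ℝ≥0∞ :=
  hazardStep k g φ Ψ (fun _ => β) fun _ => V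

/-- The value of the homogeneous system with arrival rate `β`, if an infinite cost is charged when
the system is not emptied before the `n`-th arrival. -/
def homValue (β : ℝ≥0) : ℕ → ℝ≥0∞ → List ℝ≥0 → ℝ≥0∞
  | 0 => fun _ _ => φ ⊤
  | n + 1 => homStep k g φ Ψ β (homValue β n)

/-- The limit of the decreasing sequence `homValue`: the value of the homogeneous system, if an
infinite cost is charged when the system is never emptied. -/
def homLimit (β : ℝ≥0) (a : ℝ≥0∞) (q : List ℝ≥0) : ℝ≥0∞ := ⨅ n, homValue k g φ Ψ β n a q

variable {k g φ Ψ}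

lemma afterArrival_mono [IsProbabilityMeasure Ψ] {V W : ℝ≥0∞ → List ℝ≥0 → ℝ≥0∞} {a b : ℝ≥0∞}
    (h : ∀ c d q, c ≤ d → V c q ≤ W d q) (hab : a ≤ b) (q : List ℝ≥0) (u : ℝ≥0) :
    afterArrival k g Ψ V a q u ≤ afterArrival k g Ψ W b q u :=
  lintegral_mono fun _ => h _ _ _ (by gcongr)

lemma afterArrival_le_of_le [IsProbabilityMeasure Ψ] {V : ℝ≥0∞ → List ℝ≥0 → ℝ≥0∞} {B : ℝ≥0∞}
    (h : ∀ a q, V a q ≤ B) (a : ℝ≥0∞) (q : List ℝ≥0) (u : ℝ≥0) :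
    afterArrival k g Ψ V a q u ≤ B :=
  (lintegral_mono fun _ => h _ _).trans (by simp)

lemma afterArrival_add (V : ℝ≥0∞ → List ℝ≥0 → ℝ≥0∞) (a : ℝ≥0∞) (q : List ℝ≥0) (v : ℝ≥0)
    {u : ℝ≥0} (hu : 0 < u) :
    afterArrival k g Ψ V a q (v + u) =
      afterArrival k g Ψ V (a + segCost g q.sum v) (serve v q) u := by
  unfold afterArrival
  simp_rw [arrive_add k v hu, sum_serve, ENNReal.coe_add, segCost_add, add_assoc]

lemma measurable_afterArrival [SFinite Ψ] (hg : Measurable g) {α : Type*} [MeasurableSpace α]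
    {V : α → ℝ≥0∞ → List ℝ≥0 → ℝ≥0∞}
    (hV : Measurable fun p : α × ℝ≥0∞ × List ℝ≥0 => V p.1 p.2.1 p.2.2)
    {a : α → ℝ≥0∞} {q : α → List ℝ≥0} {u : α → ℝ≥0}
    (ha : Measurable a) (hq : Measurable q) (hu : Measurable u) :
    Measurable fun x => afterArrival k g Ψ (V x) (a x) (q x) (u x) := by
  unfold afterArrival
  refine Measurable.lintegral_prod_right' (f := fun p : α × (ℝ≥0 × ℝ≥0∞) =>
    V p.1 (a p.1 + segCost g (q p.1).sum (u p.1)) (arrive k (u p.1) p.2 (q p.1))) ?_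
  refine hV.comp (measurable_fst.prodMk (Measurable.prodMk ?_ ?_))
  · exact (ha.comp measurable_fst).add (measurable_segCost hg
      (measurable_list_sum.comp (hq.comp measurable_fst))
      (hu.comp measurable_fst).coe_nnreal_ennreal)
  · exact measurable_arrive k (hu.comp measurable_fst) measurable_snd (hq.comp measurable_fst)

lemma hazardStep_mono [IsProbabilityMeasure Ψ] {ρ : ℝ → ℝ} {V W : ℝ → ℝ≥0∞ → List ℝ≥0 → ℝ≥0∞}
    (hφ : Monotone φ) {a b : ℝ≥0∞} (h : ∀ u c d q, c ≤ d → V u c q ≤ W u d q) (hab : a ≤ b)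
    (q : List ℝ≥0) : hazardStep k g φ Ψ ρ V a q ≤ hazardStep k g φ Ψ ρ W b q := by
  unfold hazardStep
  gcongr with u
  · exact afterArrival_mono (h u) hab _ _
  · exact hφ (by gcongr)

lemma hazardStep_le_of_le [IsProbabilityMeasure Ψ] {ρ : ℝ → ℝ} {C : ℝ} (hρ : Measurable ρ)
    (hρ0 : ∀ u, 0 ≤ ρ u) (hC : ∀ u, |ρ u| ≤ C) {V : ℝ → ℝ≥0∞ → List ℝ≥0 → ℝ≥0∞} {B : ℝ≥0∞}
    (hφ : ∀ a, φ a ≤ B) (h : ∀ u a q, V u a q ≤ B) (a : ℝ≥0∞) (q : List ℝ≥0) :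
    hazardStep k g φ Ψ ρ V a q ≤ B := by
  have hm := lintegral_hazard_density_add hρ hρ0 hC (v := q.sum) (NNReal.coe_nonneg _)
  calc hazardStep k g φ Ψ ρ V a q ≤
      (∫⁻ u in Set.Ioo (0 : ℝ) q.sum, ENNReal.ofReal (ρ u * Real.exp (-∫ s in 0..u, ρ s)) * B) +
        ENNReal.ofReal (Real.exp (-∫ s in 0..(q.sum : ℝ), ρ s)) * B := by
        unfold hazardStep
        gcongr with u
        · exact afterArrival_le_of_le (h u) _ _ _
        · exact hφ _
    _ = B := by
        rw [lintegral_mul_const _ (measurable_hazard_density hρ hC).ennreal_ofReal, ← add_mul, hm,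
          one_mul]

lemma homStep_eq (β : ℝ≥0) (V : ℝ≥0∞ → List ℝ≥0 → ℝ≥0∞) (a : ℝ≥0∞) (q : List ℝ≥0) :
    homStep k g φ Ψ β V a q =
      (∫⁻ u in Set.Ioo (0 : ℝ) q.sum, ENNReal.ofReal (β * Real.exp (-(β * u))) *
        afterArrival k g Ψ V a q u.toNNReal) +
      ENNReal.ofReal (Real.exp (-(β * q.sum))) * φ (a + segCost g q.sum ⊤) := by
  simp [homStep, hazardStep, mul_comm]

lemma homStep_of_sum_eq_zero (β : ℝ≥0) (V : ℝ≥0∞ → List ℝ≥0 → ℝ≥0∞) (a : ℝ≥0∞) {q : List ℝ≥0}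
    (hq : q.sum = 0) : homStep k g φ Ψ β V a q = φ a := by
  rw [homStep_eq]
  simp [hq, segCost_zero_left]

lemma lintegral_exp_density_add (β v : ℝ≥0) :
    (∫⁻ u in Set.Ioo (0 : ℝ) v, ENNReal.ofReal (β * Real.exp (-(β * u)))) +
      ENNReal.ofReal (Real.exp (-(β * v))) = 1 := by
  have := lintegral_hazard_density_add (ρ := fun _ => (β : ℝ)) (C := β) measurable_const
    (fun _ => β.2) (fun _ => by simp) (v := v) v.2
  simpa [mul_comm] using this

lemma measurable_homStep [SFinite Ψ] (hg : Measurable g) (hφ : Monotone φ) (β : ℝ≥0)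
    {V : ℝ≥0∞ → List ℝ≥0 → ℝ≥0∞} (hV : Measurable fun p : ℝ≥0∞ × List ℝ≥0 => V p.1 p.2) :
    Measurable fun p : ℝ≥0∞ × List ℝ≥0 => homStep k g φ Ψ β V p.1 p.2 := by
  simp_rw [homStep_eq]
  have hsum : Measurable fun p : ℝ≥0∞ × List ℝ≥0 => p.2.sum :=
    measurable_list_sum.comp measurable_snd
  refine Measurable.add ?_ (Measurable.mul (by fun_prop) ?_)
  · simp_rw [← lintegral_indicator measurableSet_Ioo]
    refine Measurable.lintegral_prod_right' (f := fun x : (ℝ≥0∞ × List ℝ≥0) × ℝ =>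
      {x : (ℝ≥0∞ × List ℝ≥0) × ℝ | x.2 ∈ Set.Ioo (0 : ℝ) x.1.2.sum}.indicator (fun x =>
        ENNReal.ofReal (β * Real.exp (-(β * x.2))) *
        afterArrival k g Ψ V x.1.1 x.1.2 x.2.toNNReal) x) ?_
    refine Measurable.indicator (Measurable.mul (by fun_prop) ?_) ?_
    · exact measurable_afterArrival hg (hV.comp measurable_snd) (by fun_prop) (by fun_prop)
        (by fun_prop)
    · exact (measurableSet_lt measurable_const measurable_snd).inter (measurableSet_lt
        measurable_snd (hsum.comp measurable_fst).coe_nnreal_real)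
  · exact hφ.measurable.comp (measurable_fst.add (measurable_segCost hg hsum measurable_const))

/-- Lack of memory: the next arrival occurs within `v` time units, or the system evolves for `v`
time units and then starts afresh. -/
lemma homStep_flow (β : ℝ≥0) (V : ℝ≥0∞ → List ℝ≥0 → ℝ≥0∞) (a : ℝ≥0∞) {q : List ℝ≥0} {v : ℝ≥0}
    (hv : v ≤ q.sum) :
    homStep k g φ Ψ β V a q =
      (∫⁻ u in Set.Ioo (0 : ℝ) v, ENNReal.ofReal (β * Real.exp (-(β * u))) *
        afterArrival k g Ψ V a q u.toNNReal) +
      ENNReal.ofReal (Real.exp (-(β * v))) *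
        homStep k g φ Ψ β V (a + segCost g q.sum v) (serve v q) := by
  rw [homStep_eq, homStep_eq, sum_serve]
  set F : ℝ → ℝ≥0∞ := fun u => ENNReal.ofReal (β * Real.exp (-(β * u))) *
    afterArrival k g Ψ V a q u.toNNReal with hF
  have hsplit : ∫⁻ u in Set.Ioo (0 : ℝ) q.sum, F u =
      (∫⁻ u in Set.Ioo (0 : ℝ) v, F u) + ∫⁻ u in Set.Ioc (v : ℝ) q.sum, F u := by
    rw [setLIntegral_congr Ioo_ae_eq_Ioc, setLIntegral_congr (Ioo_ae_eq_Ioc (a := (0 : ℝ)) (b := v)),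
      ← Set.Ioc_union_Ioc_eq_Ioc (NNReal.coe_nonneg v) (NNReal.coe_le_coe.2 hv),
      lintegral_union measurableSet_Ioc]
    rw [Set.disjoint_left]
    exact fun u hu hu' => absurd hu.2 (not_le.2 hu'.1)
  have hexp : ∀ x : ℝ, Real.exp (-(β * (v + x))) = Real.exp (-(β * v)) * Real.exp (-(β * x)) := by
    intro x
    rw [← Real.exp_add]
    ring_nf
  have hshift : ∫⁻ u in Set.Ioc (v : ℝ) q.sum, F u = ENNReal.ofReal (Real.exp (-(β * v))) *
      ∫⁻ u in Set.Ioo (0 : ℝ) (q.sum - v : ℝ≥0), ENNReal.ofReal (β * Real.exp (-(β * u))) *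
        afterArrival k g Ψ V (a + segCost g q.sum v) (serve v q) u.toNNReal := by
    rw [setLIntegral_congr (Ioo_ae_eq_Ioc (a := (0 : ℝ)) (b := (q.sum - v : ℝ≥0))),
      ← lintegral_const_mul' _ _ ENNReal.ofReal_ne_top, ← lintegral_indicator measurableSet_Ioc,
      ← lintegral_indicator measurableSet_Ioc,
      ← lintegral_add_left_eq_self ((Set.Ioc (v : ℝ) q.sum).indicator F) (v : ℝ)]
    congr 1
    ext u
    have hiff : ((v : ℝ) + u ∈ Set.Ioc (v : ℝ) q.sum) ↔ u ∈ Set.Ioc (0 : ℝ) (q.sum - v : ℝ≥0) := by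
      rw [Set.mem_Ioc, Set.mem_Ioc, NNReal.coe_sub hv]
      constructor <;> rintro ⟨h1, h2⟩ <;> constructor <;> linarith
    by_cases hu : u ∈ Set.Ioc (0 : ℝ) (q.sum - v : ℝ≥0)
    · rw [Set.indicator_of_mem hu, Set.indicator_of_mem (hiff.2 hu), hF]
      beta_reduce
      rw [Real.toNNReal_add (NNReal.coe_nonneg v) hu.1.le, Real.toNNReal_coe,
        afterArrival_add V a q v (Real.toNNReal_pos.2 hu.1), hexp,
        ← mul_assoc (ENNReal.ofReal _), ← ENNReal.ofReal_mul (Real.exp_pos _).le]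
      congr 2
      ring
    · rw [Set.indicator_of_notMem hu, Set.indicator_of_notMem (fun h => hu (hiff.1 h))]
  have hfin : ENNReal.ofReal (Real.exp (-(β * q.sum))) * φ (a + segCost g q.sum ⊤) =
      ENNReal.ofReal (Real.exp (-(β * v))) * (ENNReal.ofReal (Real.exp (-(β * (q.sum - v : ℝ≥0)))) *
        φ (a + segCost g q.sum v + segCost g (q.sum - v) ⊤)) := by
    rw [← mul_assoc, ← ENNReal.ofReal_mul (Real.exp_pos _).le, ← hexp, NNReal.coe_sub hv,
      add_sub_cancel, add_assoc, ← segCost_add, add_top]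
  rw [hsplit, hshift, hfin, mul_add, add_assoc]

lemma homStep_serve_zero (β : ℝ≥0) (V : ℝ≥0∞ → List ℝ≥0 → ℝ≥0∞) (a : ℝ≥0∞) (q : List ℝ≥0) :
    homStep k g φ Ψ β V a (serve 0 q) = homStep k g φ Ψ β V a q := by
  have := homStep_flow (k := k) (g := g) (φ := φ) (Ψ := Ψ) β V a (q := q) zero_le
  rw [this]
  simp [segCost]

lemma homLimit_le (β : ℝ≥0) (a : ℝ≥0∞) (q : List ℝ≥0) :
    homLimit k g φ Ψ β a q ≤ φ ⊤ :=
  (iInf_le _ 0).trans le_rfl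

variable [IsProbabilityMeasure Ψ]

lemma homValue_le (hφ : Monotone φ) (β : ℝ≥0) (n : ℕ) (a : ℝ≥0∞) (q : List ℝ≥0) :
    homValue k g φ Ψ β n a q ≤ φ ⊤ := by
  induction n generalizing a q with
  | zero => exact le_rfl
  | succ n ih =>
    exact hazardStep_le_of_le (C := β) measurable_const (fun _ => β.2) (fun _ => by simp)
      (fun a => hφ le_top) (fun _ => ih) a q

lemma homValue_mono (hφ : Monotone φ) (β : ℝ≥0) (n : ℕ) {a b : ℝ≥0∞} (hab : a ≤ b)
    (q : List ℝ≥0) : homValue k g φ Ψ β n a q ≤ homValue k g φ Ψ β n b q := by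
  induction n generalizing a b q with
  | zero => exact le_rfl
  | succ n ih => exact hazardStep_mono hφ (fun _ _ _ q h => ih h q) hab q

lemma homValue_antitone (hφ : Monotone φ) (β : ℝ≥0) (a : ℝ≥0∞) (q : List ℝ≥0) :
    Antitone fun n => homValue k g φ Ψ β n a q := by
  refine antitone_nat_of_succ_le fun n => ?_
  induction n generalizing a q with
  | zero => exact homValue_le hφ β 1 a q
  | succ n ih =>
    exact hazardStep_mono hφ (fun _ _ _ q h => (ih _ q).trans (homValue_mono hφ β n h q)) le_rfl q

lemma measurable_homValue (hg : Measurable g) (hφ : Monotone φ) (β : ℝ≥0) (n : ℕ) :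
    Measurable fun p : ℝ≥0∞ × List ℝ≥0 => homValue k g φ Ψ β n p.1 p.2 := by
  induction n with
  | zero => exact measurable_const
  | succ n ih => exact measurable_homStep hg hφ β ih

/-- In the homogeneous system, additional customers `p` on top of the state `b` increase the
value: they have to leave before the service of `b` is resumed, they only add to the cost, and
after that the system starts afresh from `b`. -/
lemma homValue_le_append (hφ : Monotone φ) (β : ℝ≥0) (n : ℕ) (a : ℝ≥0∞) (p b : List ℝ≥0) :
    homValue k g φ Ψ β n a b ≤ homValue k g φ Ψ β n a (p ++ b) := by
  induction n generalizing a p with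
  | zero => exact le_rfl
  | succ n ih =>
    have hp : p.sum ≤ (p ++ b).sum := by simp
    rw [homValue, homStep_flow β _ a hp, serve_append_of_sum_le b le_rfl, tsub_self,
      homStep_serve_zero]
    have hanti : homStep k g φ Ψ β (homValue k g φ Ψ β n) a b ≤ homValue k g φ Ψ β n a b :=
      homValue_antitone hφ β a b n.le_succ
    have hmono : homStep k g φ Ψ β (homValue k g φ Ψ β n) a b ≤
        homStep k g φ Ψ β (homValue k g φ Ψ β n) (a + segCost g (p ++ b).sum p.sum) b :=
      homValue_mono hφ β (n + 1) le_self_add b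
    have hafter : ∀ u ∈ Set.Ioo (0 : ℝ) p.sum,
        homStep k g φ Ψ β (homValue k g φ Ψ β n) a b ≤
          afterArrival k g Ψ (homValue k g φ Ψ β n) a (p ++ b) u.toNNReal := by
      intro u hu
      have hup : u.toNNReal < p.sum := (Real.toNNReal_lt_iff_lt_coe hu.1.le).2 hu.2
      calc homStep k g φ Ψ β (homValue k g φ Ψ β n) a b
          = ∫⁻ _, homStep k g φ Ψ β (homValue k g φ Ψ β n) a b ∂Ψ := by simp
        _ ≤ _ := by
          refine lintegral_mono fun m => hanti.trans
            ((homValue_mono hφ β n (le_self_add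
              (b := segCost g (p ++ b).sum u.toNNReal)) b).trans ?_)
          rcases arrive_eq_or k u.toNNReal m (p ++ b) with h | ⟨h, -⟩
          · rw [h, serve_append b hup]
            exact ih _ _
          · rw [h, serve_append b hup, ← List.cons_append]
            exact ih _ _
    calc homStep k g φ Ψ β (homValue k g φ Ψ β n) a b
        = (∫⁻ u in Set.Ioo (0 : ℝ) p.sum, ENNReal.ofReal (β * Real.exp (-(β * u)))) *
            homStep k g φ Ψ β (homValue k g φ Ψ β n) a b +
          ENNReal.ofReal (Real.exp (-(β * p.sum))) *
            homStep k g φ Ψ β (homValue k g φ Ψ β n) a b := by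
          rw [← add_mul, lintegral_exp_density_add, one_mul]
      _ ≤ _ := by
          rw [← lintegral_mul_const _ (by fun_prop)]
          refine add_le_add (setLIntegral_mono' measurableSet_Ioo fun u hu => ?_) ?_
          · gcongr
            exact hafter u hu
          · gcongr

lemma homLimit_mono (hφ : Monotone φ) (β : ℝ≥0) {a b : ℝ≥0∞} (hab : a ≤ b) (q : List ℝ≥0) :
    homLimit k g φ Ψ β a q ≤ homLimit k g φ Ψ β b q :=
  iInf_mono fun n => homValue_mono hφ β n hab q

lemma homLimit_le_append (hφ : Monotone φ) (β : ℝ≥0) (a : ℝ≥0∞) (p b : List ℝ≥0) :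
    homLimit k g φ Ψ β a b ≤ homLimit k g φ Ψ β a (p ++ b) :=
  iInf_mono fun n => homValue_le_append hφ β n a p b

lemma measurable_homLimit (hg : Measurable g) (hφ : Monotone φ) (β : ℝ≥0) :
    Measurable fun p : ℝ≥0∞ × List ℝ≥0 => homLimit k g φ Ψ β p.1 p.2 :=
  Measurable.iInf fun n => measurable_homValue hg hφ β n

lemma homStep_homLimit (hg : Measurable g) (hφ : Monotone φ) (hφ1 : φ ⊤ ≤ 1) (β : ℝ≥0)
    (a : ℝ≥0∞) (q : List ℝ≥0) :
    homStep k g φ Ψ β (homLimit k g φ Ψ β) a q = homLimit k g φ Ψ β a q := by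
  have hlim : ∀ a q, Tendsto (fun n => homValue k g φ Ψ β n a q) atTop
      (𝓝 (homLimit k g φ Ψ β a q)) := fun a q => tendsto_atTop_iInf (homValue_antitone hφ β a q)
  have hafter : ∀ u, Tendsto (fun n => afterArrival k g Ψ (homValue k g φ Ψ β n) a q u) atTop
      (𝓝 (afterArrival k g Ψ (homLimit k g φ Ψ β) a q u)) := by
    intro u
    refine tendsto_lintegral_of_dominated_convergence (fun _ => 1) (fun n => ?_)
      (fun n => Eventually.of_forall fun m => (homValue_le hφ β n _ _).trans hφ1) (by simp)
      (Eventually.of_forall fun m => hlim _ _)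
    exact (measurable_homValue hg hφ β n).comp (measurable_const.prodMk
      (measurable_arrive k measurable_const measurable_id measurable_const))
  have hstep : Tendsto (fun n => homStep k g φ Ψ β (homValue k g φ Ψ β n) a q) atTop
      (𝓝 (homStep k g φ Ψ β (homLimit k g φ Ψ β) a q)) := by
    simp_rw [homStep_eq]
    refine Tendsto.add ?_ tendsto_const_nhds
    refine tendsto_lintegral_of_dominated_convergence
      (fun u => ENNReal.ofReal (β * Real.exp (-(β * u)))) (fun n => ?_) (fun n => ?_) ?_ ?_
    · refine Measurable.mul (by fun_prop) ?_
      exact measurable_afterArrival hg ((measurable_homValue hg hφ β n).comp measurable_snd)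
        measurable_const measurable_const (by fun_prop)
    · refine Eventually.of_forall fun u => mul_le_of_le_one_right' ?_
      exact (afterArrival_le_of_le (homValue_le hφ β n) _ _ _).trans hφ1
    · refine ne_top_of_le_ne_top ENNReal.one_ne_top ?_
      rw [← lintegral_exp_density_add β q.sum]
      exact le_self_add
    · exact Eventually.of_forall fun u =>
        ENNReal.Tendsto.const_mul (hafter _) (Or.inr ENNReal.ofReal_ne_top)
  exact tendsto_nhds_unique hstep ((hlim a q).comp (tendsto_add_atTop_nat 1))

/-- Lowering the arrival rate up to the next arrival decreases the value.  The reason is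
`homLimit_le_append`: the value never decreases at an arrival. -/
lemma hazardStep_homLimit_le (hg : Measurable g) (hφ : Monotone φ) (hφ1 : φ ⊤ ≤ 1) {β : ℝ≥0}
    {ρ : ℝ → ℝ} (hρ : Measurable ρ) (hρ0 : ∀ u, 0 ≤ ρ u) (hρβ : ∀ u, ρ u ≤ β) (a : ℝ≥0∞)
    (q : List ℝ≥0) :
    hazardStep k g φ Ψ ρ (fun _ => homLimit k g φ Ψ β) a q ≤ homLimit k g φ Ψ β a q := by
  set H := homLimit k g φ Ψ β with hH
  have hH1 : ∀ a q, H a q ≤ 1 := fun a q => (homLimit_le β a q).trans hφ1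
  have hHfin : ∀ a q, H a q ≠ ⊤ := fun a q => ne_top_of_le_ne_top ENNReal.one_ne_top (hH1 a q)
  have hρβ' : ∀ u, |ρ u| ≤ (β : ℝ) := fun u => by rw [abs_of_nonneg (hρ0 u)]; exact hρβ u
  set hp : ℝ → ℝ≥0∞ := fun u => afterArrival k g Ψ H a q u.toNNReal with hhp
  have hp1 : ∀ u, hp u ≤ 1 := fun u => afterArrival_le_of_le hH1 _ _ _
  have hpm : Measurable hp := measurable_afterArrival hg
    ((measurable_homLimit hg hφ β).comp measurable_snd) measurable_const measurable_const
    (by fun_prop)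
  set h : ℝ → ℝ≥0∞ := fun v => H (a + segCost g q.sum v.toNNReal) (serve v.toNNReal q) with hh
  have hmain := integral_hazard_le (β := β) (ρ := ρ) (hp := fun u => (hp u).toReal)
    (h := fun v => (h v).toReal) (c := (H a q).toReal) (L := q.sum) (NNReal.coe_nonneg _) hρ hρ0
    hρβ hpm.ennreal_toReal (fun _ => ENNReal.toReal_nonneg)
    (fun u => by simpa using ENNReal.toReal_mono ENNReal.one_ne_top (hp1 u)) ?_ ?_
  · -- the state after `q.sum` time units without arrivals is empty
    have hend : h q.sum = φ (a + segCost g q.sum ⊤) := by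
      simp only [hh, Real.toNNReal_coe]
      rw [hH, ← homStep_homLimit hg hφ hφ1,
        homStep_of_sum_eq_zero _ _ _ (by rw [sum_serve, tsub_self]), segCost_of_le g le_rfl]
    have hφfin : φ (a + segCost g q.sum ⊤) ≠ ⊤ :=
      ne_top_of_le_ne_top ENNReal.one_ne_top ((hφ le_top).trans hφ1)
    rw [hazardStep, setLIntegral_ofReal_mul (F := hp) (NNReal.coe_nonneg _)
      (fun u _ => mul_nonneg (hρ0 u) (Real.exp_pos _).le) (measurable_hazard_density hρ hρβ')
      (intervalIntegrable_hazard_density hρ hρβ' _) hpm hp1, ← ENNReal.ofReal_toReal hφfin,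
      ← ENNReal.ofReal_mul (Real.exp_pos _).le, ← ENNReal.ofReal_add, ← hend,
      ← ENNReal.ofReal_toReal (hHfin a q)]
    · exact ENNReal.ofReal_le_ofReal hmain
    · refine intervalIntegral.integral_nonneg (NNReal.coe_nonneg _) fun u _ => ?_
      exact mul_nonneg (mul_nonneg (hρ0 u) (Real.exp_pos _).le) ENNReal.toReal_nonneg
    · exact mul_nonneg (Real.exp_pos _).le ENNReal.toReal_nonneg
  · intro u hu
    refine ENNReal.toReal_mono (ne_top_of_le_ne_top ENNReal.one_ne_top (hp1 u)) ?_
    calc h u = ∫⁻ _, h u ∂Ψ := by simp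
      _ ≤ _ := by
        refine lintegral_mono fun m => ?_
        rcases arrive_eq_or k u.toNNReal m q with h | ⟨h, -⟩
        · rw [h]
        · rw [h]
          exact homLimit_le_append hφ β _ [m.1] _
  · intro v hv
    have hv' : v.toNNReal ≤ q.sum := Real.toNNReal_le_iff_le_coe.2 hv.2
    have hflow : H a q = (∫⁻ u in Set.Ioo (0 : ℝ) v, ENNReal.ofReal (β * Real.exp (-(β * u))) *
        hp u) + ENNReal.ofReal (Real.exp (-(β * v))) * h v := by
      have := homStep_flow (k := k) (g := g) (φ := φ) (Ψ := Ψ) β H a hv'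
      rw [homStep_homLimit hg hφ hφ1, homStep_homLimit hg hφ hφ1, Real.coe_toNNReal _ hv.1] at this
      exact this
    have hw0 : ∀ u : ℝ, 0 ≤ (β : ℝ) * Real.exp (-(β * u)) :=
      fun u => mul_nonneg β.2 (Real.exp_pos _).le
    rw [setLIntegral_ofReal_mul hv.1 (fun u _ => hw0 u) (by fun_prop)
      (Continuous.intervalIntegrable (by fun_prop) _ _) hpm hp1] at hflow
    rw [hflow, ENNReal.toReal_add ENNReal.ofReal_ne_top
      (ENNReal.mul_ne_top ENNReal.ofReal_ne_top (hHfin _ _)), ENNReal.toReal_mul,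
      ENNReal.toReal_ofReal (Real.exp_pos _).le, ENNReal.toReal_ofReal]
    exact intervalIntegral.integral_nonneg hv.1 fun u _ =>
      mul_nonneg (hw0 u) ENNReal.toReal_nonneg

end Operators

/-! ### The busy period is finite -/

section Termination

/-- The indicator function of the value `∞`. -/
def topIndicator (c : ℝ≥0∞) : ℝ≥0∞ := if c = ⊤ then 1 else 0

lemma topIndicator_mono : Monotone topIndicator := by
  intro a b hab
  unfold topIndicator
  split_ifs with h1 h2
  · exact le_rfl
  · exact absurd (top_le_iff.1 (h1 ▸ hab)) h2
  · exact zero_le_one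
  · exact le_rfl

lemma topIndicator_top : topIndicator ⊤ = 1 := if_pos rfl

variable (k : ℕ) (Ψ : Measure (ℝ≥0 × ℝ≥0∞)) (β : ℝ≥0)

/-- The probability that the homogeneous system with arrival rate `β` is never emptied when it
starts in state `q`: without holding costs, the only cost is the infinite one that is charged if the
busy period does not end. -/
def neverEmpty (q : List ℝ≥0) : ℝ≥0∞ := homLimit k (fun _ => 0) topIndicator Ψ β 0 q

lemma neverEmpty_le_one (q : List ℝ≥0) : neverEmpty k Ψ β q ≤ 1 :=
  (homLimit_le β _ _).trans topIndicator_top.le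

variable [IsProbabilityMeasure Ψ]

lemma neverEmpty_flow {q : List ℝ≥0} {v : ℝ≥0} (hv : v ≤ q.sum) :
    neverEmpty k Ψ β q = (∫⁻ u in Set.Ioo (0 : ℝ) v, ENNReal.ofReal (β * Real.exp (-(β * u))) *
        ∫⁻ m, neverEmpty k Ψ β (arrive k u.toNNReal m q) ∂Ψ) +
      ENNReal.ofReal (Real.exp (-(β * v))) * neverEmpty k Ψ β (serve v q) := by
  have h := homStep_flow (k := k) (g := fun _ => 0) (φ := topIndicator) (Ψ := Ψ) β
    (homLimit k (fun _ => 0) topIndicator Ψ β) 0 hv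
  rw [homStep_homLimit measurable_const topIndicator_mono topIndicator_top.le,
    homStep_homLimit measurable_const topIndicator_mono topIndicator_top.le] at h
  simpa only [neverEmpty, afterArrival, segCost_zero_fun, add_zero] using h

lemma neverEmpty_nil : neverEmpty k Ψ β [] = 0 := by
  rw [neverEmpty, ← homStep_homLimit measurable_const topIndicator_mono topIndicator_top.le,
    homStep_of_sum_eq_zero _ _ _ (by simp)]
  simp [topIndicator]

lemma neverEmpty_serve_zero (q : List ℝ≥0) : neverEmpty k Ψ β (serve 0 q) = neverEmpty k Ψ β q := by
  rw [neverEmpty_flow (q := q) k Ψ β zero_le]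
  simp

/-- If customers who preempt `r` leave with probability one, so does `r`.  Over the service times
up to `R`, the supremum of the probabilities that the base state `b` is not reached is at most
`1 - exp (-β R) < 1` times itself. -/
lemma neverEmpty_cons_le_of_preempt (b : List ℝ≥0)
    (h : b.length + 1 ≤ k → ∀ s r, neverEmpty k Ψ β (s :: r :: b) ≤ neverEmpty k Ψ β (r :: b))
    (R : ℝ≥0) : neverEmpty k Ψ β (R :: b) ≤ neverEmpty k Ψ β b := by
  set S : ℝ≥0∞ := ⨆ r : Set.Iic R, neverEmpty k Ψ β (r.1 :: b) with hS
  have hS1 : S ≤ 1 := iSup_le fun r => neverEmpty_le_one k Ψ β _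
  have hle : ∀ r ≤ R, neverEmpty k Ψ β (r :: b) ≤ S := fun r hr =>
    le_iSup (fun r : Set.Iic R => neverEmpty k Ψ β (r.1 :: b)) ⟨r, hr⟩
  have hafter : ∀ r ≤ R, ∀ u ∈ Set.Ioo (0 : ℝ) r,
      ∫⁻ m, neverEmpty k Ψ β (arrive k u.toNNReal m (r :: b)) ∂Ψ ≤ S := by
    intro r hr u hu
    have hur : u.toNNReal < r := (Real.toNNReal_lt_iff_lt_coe hu.1.le).2 hu.2
    have hserve : serve u.toNNReal (r :: b) = (r - u.toNNReal) :: b := by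
      rw [serve, if_neg (not_le.2 hur)]
    calc _ ≤ ∫⁻ _, S ∂Ψ := by
          refine lintegral_mono fun m => ?_
          rcases arrive_eq_or k u.toNNReal m (r :: b) with h' | ⟨h', hlen⟩
          · rw [h', hserve]
            exact hle _ (tsub_le_self.trans hr)
          · rw [h', hserve]
            rw [serveLeft, if_neg (not_lt.2 hur.le), List.length_cons] at hlen
            exact (h (by omega) _ _).trans (hle _ (tsub_le_self.trans hr))
      _ = S := by simp
  have hstep : ∀ r ≤ R, neverEmpty k Ψ β (r :: b) ≤
      (∫⁻ u in Set.Ioo (0 : ℝ) r, ENNReal.ofReal (β * Real.exp (-(β * u)))) * S +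
        ENNReal.ofReal (Real.exp (-(β * r))) * neverEmpty k Ψ β b := by
    intro r hr
    have hr' : r ≤ (r :: b).sum := by simp
    rw [neverEmpty_flow k Ψ β hr', serve, if_pos le_rfl, tsub_self, neverEmpty_serve_zero,
      ← lintegral_mul_const _ (by fun_prop)]
    gcongr ?_ + _
    exact setLIntegral_mono' measurableSet_Ioo fun u hu => by gcongr; exact hafter r hr u hu
  by_contra hcon
  have hb : neverEmpty k Ψ β b < S := (not_le.1 hcon).trans_le (hle R le_rfl)
  -- the same estimate in terms of real numbers
  have hSfin : S ≠ ⊤ := ne_top_of_le_ne_top ENNReal.one_ne_top hS1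
  have hbfin : neverEmpty k Ψ β b ≠ ⊤ := hb.ne_top
  have hb' : (neverEmpty k Ψ β b).toReal < S.toReal := (ENNReal.toReal_lt_toReal hbfin hSfin).2 hb
  have hreal : ∀ r ≤ R, (neverEmpty k Ψ β (r :: b)).toReal ≤
      (1 - Real.exp (-(β * R))) * S.toReal + Real.exp (-(β * R)) * (neverEmpty k Ψ β b).toReal := by
    intro r hr
    have hm := lintegral_exp_density_add β r
    set I := ∫⁻ u in Set.Ioo (0 : ℝ) r, ENNReal.ofReal (β * Real.exp (-(β * u))) with hI
    have hIfin : I ≠ ⊤ := ne_top_of_le_ne_top ENNReal.one_ne_top (le_self_add.trans hm.le)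
    have hIr : I.toReal = 1 - Real.exp (-(β * r)) := by
      have := congrArg ENNReal.toReal hm
      rw [ENNReal.toReal_add hIfin ENNReal.ofReal_ne_top,
        ENNReal.toReal_ofReal (Real.exp_pos _).le, ENNReal.toReal_one] at this
      linarith
    have h1 := ENNReal.toReal_mono (ENNReal.add_ne_top.2 ⟨ENNReal.mul_ne_top hIfin hSfin,
      ENNReal.mul_ne_top ENNReal.ofReal_ne_top hbfin⟩) (hstep r hr)
    rw [ENNReal.toReal_add (ENNReal.mul_ne_top hIfin hSfin)
      (ENNReal.mul_ne_top ENNReal.ofReal_ne_top hbfin), ENNReal.toReal_mul, ENNReal.toReal_mul,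
      ENNReal.toReal_ofReal (Real.exp_pos _).le, hIr] at h1
    have h2 : Real.exp (-(β * R)) ≤ Real.exp (-(β * r)) := by
      gcongr
    nlinarith
  have hsup : S ≤ ENNReal.ofReal ((1 - Real.exp (-(β * R))) * S.toReal +
      Real.exp (-(β * R)) * (neverEmpty k Ψ β b).toReal) := by
    refine iSup_le fun r => ?_
    rw [← ENNReal.ofReal_toReal (ne_top_of_le_ne_top hSfin (hle r.1 r.2))]
    exact ENNReal.ofReal_le_ofReal (hreal r.1 r.2)
  have hE : 0 < Real.exp (-((β : ℝ) * R)) := Real.exp_pos _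
  have hE1 : Real.exp (-((β : ℝ) * R)) ≤ 1 := by
    rw [Real.exp_le_one_iff, neg_nonpos]
    positivity
  have hfinal := (ENNReal.le_ofReal_iff_toReal_le hSfin (by
    have := sub_nonneg.2 hE1
    positivity)).1 hsup
  nlinarith

lemma neverEmpty_cons_le {b : List ℝ≥0} (hb : b.length ≤ k) (r : ℝ≥0) :
    neverEmpty k Ψ β (r :: b) ≤ neverEmpty k Ψ β b := by
  obtain ⟨d, hd⟩ := Nat.exists_eq_add_of_le hb
  induction d generalizing b r with
  | zero => exact neverEmpty_cons_le_of_preempt k Ψ β b (fun h => by omega) r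
  | succ d ih =>
    refine neverEmpty_cons_le_of_preempt k Ψ β b (fun h s r' => ?_) r
    exact ih (b := r' :: b) (by simpa using h) s (by rw [List.length_cons]; omega)

theorem neverEmpty_eq_zero {q : List ℝ≥0} (hq : q.length ≤ k + 1) : neverEmpty k Ψ β q = 0 := by
  induction q with
  | nil => exact neverEmpty_nil k Ψ β
  | cons r b ih =>
    rw [List.length_cons] at hq
    exact le_antisymm ((neverEmpty_cons_le k Ψ β (by omega) r).trans (ih (by omega)).le) zero_le

end Termination

/-! ### The law of a Poisson process is determined by its rate -/

section Law

variable {Ω : Type*} [MeasurableSpace Ω] {P : Measure Ω} {rate : ℝ≥0 → ℝ≥0} {T : ℕ → Ω → ℝ≥0∞}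

lemma measurable_arrivalCount (hT : ∀ i, Measurable (T i)) (hmono : ∀ ω, Monotone fun i => T i ω)
    (hfin : ∀ ω, Tendsto (fun i => T i ω) atTop (𝓝 ⊤)) (t : ℝ≥0) :
    Measurable fun ω => arrivalCount (fun i => T i ω) t := by
  refine measurable_of_Ioi fun i => ?_
  have : (fun ω => arrivalCount (fun i => T i ω) t) ⁻¹' Set.Ioi i = {ω | T i ω ≤ t} := by
    ext ω
    exact (epoch_le_iff (hmono ω) (hfin ω) t i).symm
  rw [this]
  exact measurableSet_le (hT i) measurable_const

/-- Finitely many times are visited by a monotone sequence that starts at `0`. -/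
lemma exists_monotone_seq_covering (I : Finset ℝ≥0) :
    ∃ t : ℕ → ℝ≥0, Monotone t ∧ t 0 = 0 ∧ ∀ s ∈ I, ∃ j, t j = s := by
  obtain ⟨n, hn⟩ : ∃ n, (insert 0 I).card = n + 1 :=
    Nat.exists_eq_add_one.2 (Finset.card_pos.2 ⟨0, Finset.mem_insert_self _ _⟩)
  set e := (insert 0 I).orderEmbOfFin hn with he
  have hrange : ∀ s ∈ insert 0 I, ∃ j, e j = s := by
    intro s hs
    have : s ∈ Set.range e := by
      rw [he, Finset.range_orderEmbOfFin]
      exact hs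
    exact this
  refine ⟨fun j => e ⟨min j n, by omega⟩, fun i j hij => ?_, ?_, fun s hs => ?_⟩
  · exact e.monotone (Fin.mk_le_mk.2 (min_le_min_right n hij))
  · obtain ⟨j, hj⟩ := hrange 0 (Finset.mem_insert_self _ _)
    refine le_antisymm ?_ zero_le
    rw [← hj]
    exact e.monotone (Fin.mk_le_of_le_val (by simp))
  · obtain ⟨j, hj⟩ := hrange s (Finset.mem_insert_of_mem hs)
    refine ⟨j.1, ?_⟩
    rw [← hj]
    exact congrArg e (Fin.ext (min_eq_left (Nat.lt_succ_iff.1 j.2)))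

lemma IsPoissonArrivals.map_increments [IsProbabilityMeasure P] (h : IsPoissonArrivals rate T P)
    {t : ℕ → ℝ≥0} (ht : Monotone t) :
    P.map (fun ω (j : ℕ) => arrivalCount (fun i => T i ω) (t (j + 1)) -
      arrivalCount (fun i => T i ω) (t j)) =
    Measure.infinitePi fun j => poissonMeasure (cumulativeRate rate (t j) (t (j + 1))) := by
  have hm := measurable_arrivalCount h.measurable_epoch h.mono h.locallyFinite
  have hind : iIndepFun (fun (j : ℕ) ω => arrivalCount (fun i => T i ω) (t (j + 1)) -
      arrivalCount (fun i => T i ω) (t j)) P := h.indep_increments.nat ht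
  have hXm : ∀ j, Measurable fun ω => arrivalCount (fun i => T i ω) (t (j + 1)) -
      arrivalCount (fun i => T i ω) (t j) := fun j => (hm (t (j + 1))).sub (hm (t j))
  rw [hind.map_fun_eq_infinitePi_map hXm]
  congr 1
  ext1 j
  exact (h.law_increments (t j) (t (j + 1)) (ht j.le_succ)).map_eq

/-- The counting process takes the value `∑ i < j, X i` at `t j`, where `X i` is the increment over
`(t i, t (i + 1)]`. -/
lemma IsPoissonArrivals.arrivalCount_eq_sum (h : IsPoissonArrivals rate T P) {t : ℕ → ℝ≥0}
    (ht : Monotone t) (ht0 : t 0 = 0) :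
    ∀ᵐ ω ∂P, ∀ j, arrivalCount (fun i => T i ω) (t j) = ∑ i ∈ Finset.range j,
      (arrivalCount (fun i => T i ω) (t (i + 1)) - arrivalCount (fun i => T i ω) (t i)) := by
  filter_upwards [h.zero] with ω hω j
  rw [Finset.sum_range_tsub (f := fun i => arrivalCount (fun i => T i ω) (t i))
    ((arrivalCount_mono (h.mono ω) (h.locallyFinite ω)).comp ht), ht0, hω, tsub_zero]

lemma IsPoissonArrivals.map_restrict [IsProbabilityMeasure P] (h : IsPoissonArrivals rate T P)
    {t : ℕ → ℝ≥0} (ht : Monotone t) (ht0 : t 0 = 0) {I : Finset ℝ≥0} {idx : I → ℕ}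
    (hidx : ∀ s : I, t (idx s) = s) :
    P.map (fun ω (s : I) => arrivalCount (fun i => T i ω) s) =
      (Measure.infinitePi fun j => poissonMeasure (cumulativeRate rate (t j) (t (j + 1)))).map
        (fun v (s : I) => ∑ i ∈ Finset.range (idx s), v i) := by
  have hm := measurable_arrivalCount h.measurable_epoch h.mono h.locallyFinite
  rw [← h.map_increments ht, Measure.map_map]
  · refine Measure.map_congr ?_
    filter_upwards [h.arrivalCount_eq_sum ht ht0] with ω hω
    ext s
    simp only [Function.comp_apply]
    rw [← hω, hidx]
  · exact measurable_pi_lambda _ fun s =>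
      Finset.measurable_fun_sum _ fun i _ => measurable_pi_apply i
  · exact measurable_pi_lambda _ fun j => (hm (t (j + 1))).sub (hm (t j))

/-- The `i`-th epoch is a measurable function of countably many values of the counting function. -/
lemma epoch_eq_iInf {τ : ℕ → ℝ≥0∞} (hmono : Monotone τ) (hfin : Tendsto τ atTop (𝓝 ⊤)) (i : ℕ) :
    τ i = ⨅ r : ℚ, if i < arrivalCount τ (r : ℝ).toNNReal then ((r : ℝ).toNNReal : ℝ≥0∞) else ⊤ := by
  refine le_antisymm (le_iInf fun r => ?_) (le_of_forall_gt fun y hy => ?_)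
  · split_ifs with h
    · exact (epoch_le_iff hmono hfin _ i).2 h
    · exact le_top
  · obtain ⟨r, -, hr1, hr2⟩ := ENNReal.lt_iff_exists_rat_btwn.1 hy
    refine (iInf_le _ r).trans_lt ?_
    rw [if_pos ((epoch_le_iff hmono hfin _ i).1 hr1.le)]
    exact hr2

/-- Two Poisson processes with the same rate function have the same law. -/
theorem IsPoissonArrivals.map_epoch_eq [IsProbabilityMeasure P] {Ω' : Type*} [MeasurableSpace Ω']
    {P' : Measure Ω'} [IsProbabilityMeasure P'] {T' : ℕ → Ω' → ℝ≥0∞}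
    (h : IsPoissonArrivals rate T P) (h' : IsPoissonArrivals rate T' P') :
    P.map (fun ω i => T i ω) = P'.map (fun ω i => T' i ω) := by
  have hm := measurable_arrivalCount h.measurable_epoch h.mono h.locallyFinite
  have hm' := measurable_arrivalCount h'.measurable_epoch h'.mono h'.locallyFinite
  have hmN : Measurable fun ω (t : ℝ≥0) => arrivalCount (fun i => T i ω) t :=
    measurable_pi_lambda _ hm
  have hmN' : Measurable fun ω (t : ℝ≥0) => arrivalCount (fun i => T' i ω) t :=
    measurable_pi_lambda _ hm'
  have hN : P.map (fun ω (t : ℝ≥0) => arrivalCount (fun i => T i ω) t) =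
      P'.map (fun ω (t : ℝ≥0) => arrivalCount (fun i => T' i ω) t) := by
    refine IsProjectiveLimit.unique (P := fun I =>
      P.map (fun ω (s : I) => arrivalCount (fun i => T i ω) s)) (fun I => ?_) (fun I => ?_)
    · rw [Measure.map_map (by fun_prop) hmN]
      rfl
    · obtain ⟨t, ht, ht0, hcov⟩ := exists_monotone_seq_covering I
      choose idx hidx using fun s : I => hcov s.1 s.2
      beta_reduce
      rw [h.map_restrict ht ht0 hidx, ← h'.map_restrict ht ht0 hidx,
        Measure.map_map (by fun_prop) hmN']
      rfl
  set F : (ℝ≥0 → ℕ) → ℕ → ℝ≥0∞ := fun c i =>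
    ⨅ r : ℚ, if i < c (r : ℝ).toNNReal then ((r : ℝ).toNNReal : ℝ≥0∞) else ⊤ with hF
  have hFm : Measurable F := by
    refine measurable_pi_lambda _ fun i => Measurable.iInf fun r => ?_
    exact Measurable.ite (measurableSet_lt measurable_const (measurable_pi_apply _))
      measurable_const measurable_const
  have e1 : (fun ω i => T i ω) = F ∘ fun ω (t : ℝ≥0) => arrivalCount (fun i => T i ω) t := by
    ext ω i
    exact epoch_eq_iInf (h.mono ω) (h.locallyFinite ω) i
  have e2 : (fun ω i => T' i ω) = F ∘ fun ω (t : ℝ≥0) => arrivalCount (fun i => T' i ω) t := by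
    ext ω i
    exact epoch_eq_iInf (h'.mono ω) (h'.locallyFinite ω) i
  rw [e1, e2, ← Measure.map_map hFm hmN, ← Measure.map_map hFm hmN', hN]

/-- The joint law of the epochs and the marks. -/
lemma IsQueueInput.map_eq [IsProbabilityMeasure P] {Ψ : Measure (ℝ≥0 × ℝ≥0∞)}
    [IsProbabilityMeasure Ψ]
    {mark : ℕ → Ω → ℝ≥0 × ℝ≥0∞} (h : IsQueueInput rate Ψ T mark P) :
    P.map (fun ω => ((fun i => T i ω), (fun i => mark i ω))) =
      (P.map fun ω i => T i ω).prod (Measure.infinitePi fun _ => Ψ) := by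
  have hT : Measurable fun ω i => T i ω := measurable_pi_lambda _ h.arrivals.measurable_epoch
  have hm : Measurable fun ω i => mark i ω := measurable_pi_lambda _ h.measurable_mark
  rw [(indepFun_iff_map_prod_eq_prod_map_map hT.aemeasurable hm.aemeasurable).1
    h.indep_arrivals_mark, h.indep_mark.map_fun_eq_infinitePi_map h.measurable_mark]
  congr 2
  ext1 i
  exact (h.law_mark i).map_eq

end Law

/-! ### Independent exponential variables -/

section ExpSeq

/-- The sequence with first term `x`, followed by the sequence `s`. -/
def consSeq {X : Type*} (x : X) (s : ℕ → X) : ℕ → X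
  | 0 => x
  | n + 1 => s n

lemma measurable_consSeq {X : Type*} [MeasurableSpace X] :
    Measurable fun p : X × (ℕ → X) => consSeq p.1 p.2 := by
  refine measurable_pi_lambda _ fun n => ?_
  cases n with
  | zero => exact measurable_fst
  | succ n => exact (measurable_pi_apply n).comp measurable_snd

lemma map_consSeq_infinitePi {X : Type*} [MeasurableSpace X] (μ : Measure X)
    [IsProbabilityMeasure μ] :
    (μ.prod (Measure.infinitePi fun _ : ℕ => μ)).map (fun p => consSeq p.1 p.2) =
      Measure.infinitePi fun _ : ℕ => μ := by
  classical
  refine Measure.eq_infinitePi _ fun s t ht => ?_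
  obtain ⟨N, hN⟩ := s.exists_nat_subset_range
  set t' : ℕ → Set X := fun i => if i ∈ s then t i else Set.univ with ht'
  have ht'm : ∀ i, MeasurableSet (t' i) := by
    intro i
    simp only [ht']
    split_ifs
    · exact ht i
    · exact MeasurableSet.univ
  have hpi : Set.pi s t = Set.pi (Finset.range (N + 1)) t' := by
    ext x
    simp only [Set.mem_pi, Finset.mem_coe, ht']
    constructor
    · intro h i _
      split_ifs with hi
      · exact h i hi
      · trivial
    · intro h i hi
      have := h i (Finset.mem_range.2 ((Finset.mem_range.1 (hN hi)).trans N.lt_succ_self))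
      rwa [if_pos hi] at this
  have hpre : (fun p : X × (ℕ → X) => consSeq p.1 p.2) ⁻¹' Set.pi (Finset.range (N + 1)) t' =
      t' 0 ×ˢ Set.pi (Finset.range N) fun i => t' (i + 1) := by
    ext ⟨x, y⟩
    simp only [Set.mem_preimage, Set.mem_pi, Finset.mem_coe, Finset.mem_range, Set.mem_prod]
    constructor
    · intro h
      exact ⟨h 0 N.succ_pos, fun i hi => h (i + 1) (by omega)⟩
    · rintro ⟨h0, h1⟩ i hi
      cases i with
      | zero => exact h0
      | succ i => exact h1 i (by omega)
  have hprod : ∏ i ∈ s, μ (t i) = ∏ i ∈ Finset.range (N + 1), μ (t' i) := by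
    rw [← Finset.prod_subset (hN.trans (Finset.range_subset_range.2 N.le_succ))]
    · exact Finset.prod_congr rfl fun i hi => by rw [ht']; simp only [if_pos hi]
    · intro i _ hi
      simp only [ht', if_neg hi, measure_univ]
  rw [Measure.map_apply measurable_consSeq, hpi, hpre, Measure.prod_prod,
    Measure.infinitePi_pi _ fun i _ => ht'm (i + 1), hprod, Finset.prod_range_succ', mul_comm]
  exact MeasurableSet.pi s.countable_toSet fun i _ => ht i

/-- The exponential law with mean one, as a law on `ℝ≥0`. -/
def expLaw : Measure ℝ≥0 :=
  ((volume.restrict (Set.Ioi (0 : ℝ))).withDensity fun u => ENNReal.ofReal (Real.exp (-u))).map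
    Real.toNNReal

lemma lintegral_expLaw {f : ℝ≥0 → ℝ≥0∞} (hf : Measurable f) :
    ∫⁻ e, f e ∂expLaw =
      ∫⁻ u in Set.Ioi (0 : ℝ), ENNReal.ofReal (Real.exp (-u)) * f u.toNNReal := by
  rw [expLaw, lintegral_map hf measurable_real_toNNReal,
    lintegral_withDensity_eq_lintegral_mul _ (by fun_prop) (by fun_prop)]
  rfl

lemma lintegral_exp_neg_Ioi (a : ℝ) :
    ∫⁻ u in Set.Ioi a, ENNReal.ofReal (Real.exp (-u)) = ENNReal.ofReal (Real.exp (-a)) := by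
  rw [← integral_exp_neg_Ioi a, ofReal_integral_eq_lintegral_ofReal]
  · exact integrableOn_exp_neg_Ioi a
  · exact Eventually.of_forall fun u => (Real.exp_pos _).le

instance isProbabilityMeasure_expLaw : IsProbabilityMeasure expLaw := by
  constructor
  rw [← lintegral_one, lintegral_expLaw measurable_const]
  simp [lintegral_exp_neg_Ioi]

lemma integral_expLaw {f : ℝ≥0 → ℂ} (hf : Measurable f) :
    ∫ e, f e ∂expLaw = ∫ u in Set.Ioi (0 : ℝ), Real.exp (-u) • f u.toNNReal := by
  rw [expLaw, integral_map measurable_real_toNNReal.aemeasurable hf.aestronglyMeasurable,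
    integral_withDensity_eq_integral_toReal_smul (by fun_prop)
      (Eventually.of_forall fun u => ENNReal.ofReal_lt_top)]
  simp_rw [ENNReal.toReal_ofReal (Real.exp_pos _).le]

/-- The law of a sequence of independent exponential variables with mean one. -/
def expSeq : Measure (ℕ → ℝ≥0) := Measure.infinitePi fun _ => expLaw

instance isProbabilityMeasure_expSeq : IsProbabilityMeasure expSeq := by
  unfold expSeq
  infer_instance

lemma map_consSeq_expSeq :
    (expLaw.prod expSeq).map (fun p => consSeq p.1 p.2) = expSeq :=
  map_consSeq_infinitePi expLaw

/-- The `n`-th partial sum. -/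
def partialSum (ω : ℕ → ℝ≥0) (n : ℕ) : ℝ≥0 := ∑ i ∈ Finset.range n, ω i

lemma partialSum_zero (ω : ℕ → ℝ≥0) : partialSum ω 0 = 0 := Finset.sum_range_zero _

lemma partialSum_consSeq (e : ℝ≥0) (ω : ℕ → ℝ≥0) (n : ℕ) :
    partialSum (consSeq e ω) (n + 1) = e + partialSum ω n := by
  rw [partialSum, Finset.sum_range_succ', add_comm]
  rfl

lemma partialSum_mono (ω : ℕ → ℝ≥0) : Monotone (partialSum ω) := by
  intro m n hmn
  exact Finset.sum_le_sum_of_subset (Finset.range_subset_range.2 hmn)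

lemma measurable_partialSum (n : ℕ) : Measurable fun ω : ℕ → ℝ≥0 => partialSum ω n :=
  Finset.measurable_fun_sum _ fun i _ => measurable_pi_apply i

lemma lintegral_exp_neg_expLaw :
    ∫⁻ e, ENNReal.ofReal (Real.exp (-(e : ℝ≥0))) ∂expLaw = 2⁻¹ := by
  rw [lintegral_expLaw (by fun_prop)]
  have h1 : ∀ u ∈ Set.Ioi (0 : ℝ), ENNReal.ofReal (Real.exp (-u)) *
      ENNReal.ofReal (Real.exp (-(u.toNNReal : ℝ))) = ENNReal.ofReal (Real.exp (-2 * u)) := by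
    intro u hu
    rw [Real.coe_toNNReal _ (le_of_lt hu), ← ENNReal.ofReal_mul (Real.exp_pos _).le, ← Real.exp_add]
    ring_nf
  rw [setLIntegral_congr_fun measurableSet_Ioi h1, ← ofReal_integral_eq_lintegral_ofReal
    (integrableOn_exp_mul_Ioi (by norm_num) 0) (Eventually.of_forall fun u => (Real.exp_pos _).le),
    integral_exp_mul_Ioi (by norm_num)]
  norm_num
  rw [ENNReal.ofReal_div_of_pos (by norm_num)]
  norm_num

lemma lintegral_exp_neg_partialSum (n : ℕ) :
    ∫⁻ ω, ENNReal.ofReal (Real.exp (-(partialSum ω n))) ∂expSeq = 2⁻¹ ^ n := by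
  have hm : ∀ n, Measurable fun ω => ENNReal.ofReal (Real.exp (-(partialSum ω n : ℝ))) := fun n => by
    have := measurable_partialSum n
    fun_prop
  induction n with
  | zero => simp [partialSum_zero]
  | succ n ih =>
    rw [← map_consSeq_expSeq, lintegral_map (hm _) measurable_consSeq]
    simp_rw [partialSum_consSeq, NNReal.coe_add, neg_add, Real.exp_add,
      ENNReal.ofReal_mul (Real.exp_pos _).le]
    rw [lintegral_prod_mul (f := fun e : ℝ≥0 => ENNReal.ofReal (Real.exp (-(e : ℝ))))
      (g := fun ω => ENNReal.ofReal (Real.exp (-(partialSum ω n : ℝ)))) (by fun_prop)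
      (hm n).aemeasurable, lintegral_exp_neg_expLaw, ih, pow_succ, mul_comm]

/-- The partial sums diverge, because `exp (-partialSum ω n)` has expectation `2⁻ⁿ`. -/
lemma ae_tendsto_partialSum : ∀ᵐ ω ∂expSeq, Tendsto (partialSum ω) atTop atTop := by
  have hm : ∀ n, Measurable fun ω => ENNReal.ofReal (Real.exp (-(partialSum ω n : ℝ))) := fun n => by
    have := measurable_partialSum n
    fun_prop
  have hsum : ∫⁻ ω, ∑' n, ENNReal.ofReal (Real.exp (-(partialSum ω n : ℝ))) ∂expSeq ≠ ⊤ := by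
    rw [lintegral_tsum fun n => (hm n).aemeasurable]
    simp_rw [lintegral_exp_neg_partialSum]
    rw [ENNReal.tsum_geometric]
    simp
  filter_upwards [ae_lt_top' (AEMeasurable.tsum fun n => (hm n).aemeasurable) hsum]
    with ω hω
  have h0 := ENNReal.tendsto_atTop_zero_of_tsum_ne_top hω.ne
  refine tendsto_atTop.2 fun K => ?_
  have := (tendsto_order.1 h0).2 (ENNReal.ofReal (Real.exp (-(K : ℝ))))
    (ENNReal.ofReal_pos.2 (Real.exp_pos _))
  filter_upwards [this] with n hn
  rw [ENNReal.ofReal_lt_ofReal_iff (Real.exp_pos _), Real.exp_lt_exp, neg_lt_neg_iff] at hn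
  exact_mod_cast hn.le

end ExpSeq

/-! ### The exponential functional of the partial sums -/

section Functional

variable {c : ℝ → ℂ} {M : ℝ} {S : Set ℝ}

/-- The value of `E ∏ (1 + c (t + Γ i))`, where `Γ i` are the successive partial sums of
independent exponential variables with mean one and `c` vanishes beyond `M`. -/
def expFunctional (c : ℝ → ℂ) (M t : ℝ) : ℂ := Complex.exp (∫ s in t..M, c s)

lemma norm_le_two_of_norm_one_add_le (hC : ∀ s, ‖1 + c s‖ ≤ 1) (s : ℝ) : ‖c s‖ ≤ 2 := by
  calc ‖c s‖ = ‖(1 + c s) - 1‖ := by rw [add_sub_cancel_left]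
    _ ≤ ‖1 + c s‖ + ‖(1 : ℂ)‖ := norm_sub_le _ _
    _ ≤ 2 := by rw [norm_one]; linarith [hC s]

lemma intervalIntegrable_of_norm_one_add_le (hc : Measurable c) (hC : ∀ s, ‖1 + c s‖ ≤ 1)
    (a b : ℝ) : IntervalIntegrable c volume a b := by
  refine (intervalIntegrable_const (c := (2 : ℝ))).mono_fun hc.aestronglyMeasurable ?_
  refine Eventually.of_forall fun u => ?_
  simpa using norm_le_two_of_norm_one_add_le hC u

lemma expFunctional_of_le (hzero : ∀ s, M < s → c s = 0) {t : ℝ} (ht : M ≤ t) :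
    expFunctional c M t = 1 := by
  rw [expFunctional, intervalIntegral.integral_symm, intervalIntegral.integral_of_le ht,
    setIntegral_eq_zero_of_forall_eq_zero fun s hs => hzero s hs.1, neg_zero, Complex.exp_zero]

lemma norm_expFunctional_le (hM : 0 ≤ M) (hC : ∀ s, ‖1 + c s‖ ≤ 1)
    (hzero : ∀ s, M < s → c s = 0) {t : ℝ} (ht : 0 ≤ t) :
    ‖expFunctional c M t‖ ≤ Real.exp (2 * M) := by
  rcases le_total M t with h | h
  · rw [expFunctional_of_le hzero h, norm_one]
    exact Real.one_le_exp (by positivity)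
  · rw [expFunctional]
    refine (Complex.norm_exp_le_exp_norm _).trans (Real.exp_le_exp.2 ?_)
    refine (intervalIntegral.norm_integral_le_of_norm_le_const
      fun s _ => norm_le_two_of_norm_one_add_le hC s).trans ?_
    rw [abs_of_nonneg (sub_nonneg.2 h)]
    linarith

lemma continuous_expFunctional (hc : Measurable c) (hC : ∀ s, ‖1 + c s‖ ≤ 1) :
    Continuous (expFunctional c M) := by
  have : expFunctional c M = fun t => Complex.exp (-∫ s in M..t, c s) := by
    ext t
    rw [expFunctional, intervalIntegral.integral_symm]
  rw [this]
  exact Complex.continuous_exp.comp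
    (intervalIntegral.continuous_primitive (intervalIntegrable_of_norm_one_add_le hc hC) M).neg

/-- The renewal equation of `expFunctional`, by conditioning on the first exponential variable. -/
lemma integral_renewal (hM : 0 ≤ M) (hc : Measurable c) (hC : ∀ s, ‖1 + c s‖ ≤ 1)
    (hzero : ∀ s, M < s → c s = 0) (hS : S.Countable) (hcont : ∀ s ∉ S, ContinuousAt c s)
    {t : ℝ} (ht : 0 ≤ t) :
    ∫ e : ℝ≥0, (1 + c (t + e)) * expFunctional c M (t + e) ∂expLaw = expFunctional c M t := by
  have hcf := continuous_expFunctional (M := M) hc hC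
  rw [integral_expLaw (by have := hcf.measurable; fun_prop)]
  set y' : ℝ → ℂ := fun u => Real.exp (-u) • ((1 + c (t + u)) * expFunctional c M (t + u)) with hy'
  have hcongr : ∫ u in Set.Ioi (0 : ℝ), Real.exp (-u) • ((1 + c (t + (u.toNNReal : ℝ))) *
      expFunctional c M (t + (u.toNNReal : ℝ))) = ∫ u in Set.Ioi (0 : ℝ), y' u := by
    refine setIntegral_congr_fun measurableSet_Ioi fun u hu => ?_
    simp only [hy', Real.coe_toNNReal u (le_of_lt hu)]
  rw [hcongr]
  set y : ℝ → ℂ := fun u => -(Real.exp (-u) • expFunctional c M (t + u)) with hy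
  have hy'm : Measurable y' := by
    have := hcf.measurable
    fun_prop
  have hbound : ∀ u ∈ Set.Ioi (0 : ℝ), ‖y' u‖ ≤ Real.exp (2 * M) * Real.exp (-u) := by
    intro u hu
    rw [hy', norm_smul, norm_mul, Real.norm_of_nonneg (Real.exp_pos _).le, mul_comm]
    gcongr
    calc _ ≤ 1 * Real.exp (2 * M) := by
          gcongr
          · exact hC _
          · exact norm_expFunctional_le hM hC hzero (add_nonneg ht (le_of_lt hu))
      _ = _ := one_mul _
  have hint : IntegrableOn y' (Set.Ioi 0) := by
    refine Integrable.mono' ((integrableOn_exp_neg_Ioi 0).const_mul (Real.exp (2 * M)))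
      hy'm.aestronglyMeasurable ?_
    filter_upwards [ae_restrict_mem measurableSet_Ioi] with u hu using hbound u hu
  have hderiv : ∀ u, u ∉ (fun u => t + u) ⁻¹' S → HasDerivAt y (y' u) u := by
    intro u hu
    have h1 : HasDerivAt (fun v => ∫ s in v..M, c s) (-c (t + u)) (t + u) :=
      intervalIntegral.integral_hasDerivAt_left (intervalIntegrable_of_norm_one_add_le hc hC _ _)
        hc.stronglyMeasurable.stronglyMeasurableAtFilter (hcont _ hu)
    have h2 : HasDerivAt (fun v => ∫ s in (t + v)..M, c s) (-c (t + u)) u := by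
      simpa using h1.comp_const_add t u
    have h3 : HasDerivAt (fun v : ℝ => Real.exp (-v)) (-Real.exp (-u)) u := by
      simpa using (hasDerivAt_neg u).exp
    have h4 := (h3.smul h2.cexp).neg
    convert! h4 using 1
    simp only [hy', expFunctional, Complex.real_smul]
    push_cast
    ring
  have hyc : Continuous y := by
    have : Continuous fun u => expFunctional c M (t + u) := hcf.comp (continuous_const.add continuous_id)
    fun_prop
  have hFTC : ∀ R, 0 ≤ R → ∫ u in 0..R, y' u = y R - y 0 := by
    intro R hR
    refine integral_eq_of_hasDerivAt_off_countable_of_le y y' hR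
      (hS.preimage (add_right_injective t)) hyc.continuousOn (fun u hu => hderiv u hu.2) ?_
    rw [intervalIntegrable_iff_integrableOn_Ioc_of_le hR]
    exact hint.mono_set Set.Ioc_subset_Ioi_self
  have hlim := intervalIntegral_tendsto_integral_Ioi (0 : ℝ) hint tendsto_id
  have hy0 : y 0 = -expFunctional c M t := by simp [hy]
  have hlim' : Tendsto (fun R => y R - y 0) atTop (𝓝 (0 - y 0)) := by
    refine Tendsto.sub_const ?_ _
    have h0 : Tendsto (fun u : ℝ => Real.exp (-u)) atTop (𝓝 0) :=
      Real.tendsto_exp_neg_atTop_nhds_zero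
    have h1 : Tendsto (fun u => expFunctional c M (t + u)) atTop (𝓝 1) := by
      refine tendsto_const_nhds.congr' ?_
      filter_upwards [eventually_ge_atTop M] with u hu
      rw [expFunctional_of_le hzero (by linarith)]
    have := (h0.smul h1).neg
    simpa [hy] using this
  have heq := tendsto_nhds_unique hlim (hlim'.congr' (by
    filter_upwards [eventually_ge_atTop 0] with R hR
    rw [id, hFTC R hR]))
  rw [heq, hy0]
  simp

/-- The `n`-fold iterate of the renewal equation. -/
lemma integral_prod_mul_expFunctional (hM : 0 ≤ M) (hc : Measurable c) (hC : ∀ s, ‖1 + c s‖ ≤ 1)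
    (hzero : ∀ s, M < s → c s = 0) (hS : S.Countable) (hcont : ∀ s ∉ S, ContinuousAt c s)
    (n : ℕ) {t : ℝ} (ht : 0 ≤ t) :
    ∫ ω, (∏ i ∈ Finset.range n, (1 + c (t + partialSum ω (i + 1)))) *
      expFunctional c M (t + partialSum ω n) ∂expSeq = expFunctional c M t := by
  have hfm := (continuous_expFunctional (M := M) hc hC).measurable
  have hm : ∀ (n : ℕ) (t : ℝ), Measurable fun ω =>
      (∏ i ∈ Finset.range n, (1 + c (t + partialSum ω (i + 1)))) *
        expFunctional c M (t + partialSum ω n) := by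
    intro n t
    have := measurable_partialSum
    refine Measurable.mul (Finset.measurable_fun_prod _ fun i _ => ?_) ?_
    · have := this (i + 1)
      fun_prop
    · have := this n
      fun_prop
  have hb : ∀ (n : ℕ) (t : ℝ), 0 ≤ t → ∀ ω, ‖(∏ i ∈ Finset.range n,
      (1 + c (t + partialSum ω (i + 1)))) * expFunctional c M (t + partialSum ω n)‖ ≤
        Real.exp (2 * M) := by
    intro n t ht ω
    rw [norm_mul, norm_prod]
    calc _ ≤ 1 * Real.exp (2 * M) := by
          gcongr
          · exact Finset.prod_le_one (fun _ _ => norm_nonneg _) fun i _ => hC _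
          · exact norm_expFunctional_le hM hC hzero (add_nonneg ht (NNReal.coe_nonneg _))
      _ = _ := one_mul _
  induction n generalizing t with
  | zero => simp [partialSum_zero]
  | succ n ih =>
    rw [← map_consSeq_expSeq, integral_map measurable_consSeq.aemeasurable
      (hm (n + 1) t).aestronglyMeasurable, integral_prod]
    · have hinner : ∀ e : ℝ≥0, ∫ ω, (∏ i ∈ Finset.range (n + 1),
          (1 + c (t + partialSum (consSeq e ω) (i + 1)))) *
            expFunctional c M (t + partialSum (consSeq e ω) (n + 1)) ∂expSeq =
          (1 + c (t + e)) * expFunctional c M (t + e) := by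
        intro e
        rw [← ih (t := t + e) (add_nonneg ht e.2), ← integral_const_mul]
        refine integral_congr_ae (Eventually.of_forall fun ω => ?_)
        simp only [partialSum_consSeq, Finset.prod_range_succ', partialSum_zero, add_zero,
          NNReal.coe_add, NNReal.coe_zero, add_assoc]
        ring
      simp only [hinner]
      exact integral_renewal hM hc hC hzero hS hcont ht
    · refine Integrable.of_bound ((hm (n + 1) t).comp measurable_consSeq).aestronglyMeasurable
        (Real.exp (2 * M)) (Eventually.of_forall fun p => hb (n + 1) t ht _)

/-- The exponential functional of the partial sums, by iteration of the renewal equation. -/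
lemma integral_eq_expFunctional (hM : 0 ≤ M) (hc : Measurable c) (hC : ∀ s, ‖1 + c s‖ ≤ 1)
    (hzero : ∀ s, M < s → c s = 0) (hS : S.Countable) (hcont : ∀ s ∉ S, ContinuousAt c s)
    {F : (ℕ → ℝ≥0) → ℂ} (hF : ∀ᵐ ω ∂expSeq, ∀ᶠ n in atTop,
      ∏ i ∈ Finset.range n, (1 + c (partialSum ω (i + 1))) = F ω) :
    ∫ ω, F ω ∂expSeq = expFunctional c M 0 := by
  have hfm := (continuous_expFunctional (M := M) hc hC).measurable
  have hlim : Tendsto (fun n => ∫ ω, (∏ i ∈ Finset.range n, (1 + c (0 + partialSum ω (i + 1)))) *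
      expFunctional c M (0 + partialSum ω n) ∂expSeq) atTop (𝓝 (∫ ω, F ω ∂expSeq)) := by
    refine tendsto_integral_of_dominated_convergence (fun _ => Real.exp (2 * M)) (fun n => ?_)
      (integrable_const _) (fun n => Eventually.of_forall fun ω => ?_) ?_
    · have := measurable_partialSum
      refine (Measurable.mul (Finset.measurable_fun_prod _ fun i _ => ?_) ?_).aestronglyMeasurable
      · have := this (i + 1)
        fun_prop
      · have := this n
        fun_prop
    · rw [norm_mul, norm_prod]
      calc _ ≤ 1 * Real.exp (2 * M) := by
            gcongr
            · exact Finset.prod_le_one (fun _ _ => norm_nonneg _) fun i _ => hC _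
            · exact norm_expFunctional_le hM hC hzero (add_nonneg le_rfl (NNReal.coe_nonneg _))
        _ = _ := one_mul _
    · filter_upwards [hF, ae_tendsto_partialSum] with ω hω hωlim
      refine tendsto_const_nhds.congr' ?_
      filter_upwards [hω, hωlim.eventually_ge_atTop M.toNNReal] with n hn hnM
      simp only [zero_add]
      rw [hn, expFunctional_of_le hzero ((Real.toNNReal_le_iff_le_coe).1 hnM), mul_one]
  simp_rw [fun n => integral_prod_mul_expFunctional hM hc hC hzero hS hcont n (le_refl (0 : ℝ))]
    at hlim
  exact tendsto_nhds_unique hlim tendsto_const_nhds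

end Functional

/-! ### The Poisson process with rate one -/

section Clock

open Complex (I)

/-- The epochs of a Poisson process with rate one: the partial sums `partialSum ω (n + 1)`.  On the
null set of those `ω` whose partial sums are bounded, the epochs `0, 1, 2, …` are taken instead, so
that the epochs are locally finite everywhere. -/
def clock (ω : ℕ → ℝ≥0) (n : ℕ) : ℝ≥0 :=
  open Classical in if Tendsto (partialSum ω) atTop atTop then partialSum ω (n + 1) else n

lemma ae_clock_eq : ∀ᵐ ω ∂expSeq, ∀ n, clock ω n = partialSum ω (n + 1) := by
  filter_upwards [ae_tendsto_partialSum] with ω hω n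
  rw [clock, if_pos hω]

lemma clock_mono (ω : ℕ → ℝ≥0) : Monotone (clock ω) := by
  intro m n hmn
  unfold clock
  split_ifs
  · exact partialSum_mono ω (Nat.succ_le_succ hmn)
  · exact_mod_cast hmn

lemma tendsto_clock (ω : ℕ → ℝ≥0) : Tendsto (clock ω) atTop atTop := by
  unfold clock
  split_ifs with h
  · exact h.comp (tendsto_add_atTop_nat 1)
  · exact tendsto_natCast_atTop_atTop

lemma measurable_clock (n : ℕ) : Measurable fun ω => clock ω n := by
  classical
  have hset : MeasurableSet {ω : ℕ → ℝ≥0 | Tendsto (partialSum ω) atTop atTop} := by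
    have : {ω : ℕ → ℝ≥0 | Tendsto (partialSum ω) atTop atTop} =
        ⋂ K : ℕ, ⋃ n : ℕ, {ω | (K : ℝ≥0) ≤ partialSum ω n} := by
      ext ω
      simp only [Set.mem_ofPred_eq, Set.mem_iInter, Set.mem_iUnion]
      constructor
      · exact fun h K => (h.eventually_ge_atTop (K : ℝ≥0)).exists
      · intro h
        refine tendsto_atTop_atTop_of_monotone (partialSum_mono ω) fun b => ?_
        obtain ⟨K, hK⟩ := exists_nat_ge b
        obtain ⟨n, hn⟩ := h K
        exact ⟨n, hK.trans hn⟩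
    rw [this]
    exact MeasurableSet.iInter fun K => MeasurableSet.iUnion fun n =>
      measurableSet_le measurable_const (measurable_partialSum n)
  unfold clock
  convert! Measurable.ite hset (measurable_partialSum (n + 1)) (measurable_const (a := (n : ℝ≥0)))

/-- The counting process of `clock`. -/
def clockCount (ω : ℕ → ℝ≥0) (a : ℝ≥0) : ℕ := arrivalCount (fun i => (clock ω i : ℝ≥0∞)) a

lemma clock_ennreal_mono (ω : ℕ → ℝ≥0) : Monotone fun i => (clock ω i : ℝ≥0∞) :=
  fun _ _ h => ENNReal.coe_le_coe.2 (clock_mono ω h)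

lemma clock_le_iff (ω : ℕ → ℝ≥0) (a : ℝ≥0) (i : ℕ) : clock ω i ≤ a ↔ i < clockCount ω a := by
  rw [clockCount, ← epoch_le_iff (clock_ennreal_mono ω)
    (ENNReal.tendsto_coe_nhds_top.2 (tendsto_clock ω)), ENNReal.coe_le_coe]

lemma clockCount_mono (ω : ℕ → ℝ≥0) : Monotone (clockCount ω) :=
  arrivalCount_mono (clock_ennreal_mono ω) (ENNReal.tendsto_coe_nhds_top.2 (tendsto_clock ω))

lemma measurable_clockCount (a : ℝ≥0) : Measurable fun ω => clockCount ω a :=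
  measurable_arrivalCount (fun i => (measurable_clock i).coe_nnreal_ennreal)
    clock_ennreal_mono (fun ω => ENNReal.tendsto_coe_nhds_top.2 (tendsto_clock ω)) a

variable {n : ℕ} {a : Fin (n + 1) → ℝ≥0}

/-- The function `exp (i θ j) - 1` on the `j`-th interval of a subdivision. -/
def stepFun (a : Fin (n + 1) → ℝ≥0) (θ : Fin n → ℝ) (s : ℝ) : ℂ :=
  ∑ j : Fin n, (Set.Ioc (a j.castSucc : ℝ) (a j.succ)).indicator
    (fun _ => Complex.exp (θ j * I) - 1) s

/-- The intervals are disjoint, so `1 + stepFun a θ` is a product of exponentials; the product over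
the epochs then becomes an exponential of counts. -/
lemma one_add_stepFun (ha : Monotone a) (θ : Fin n → ℝ) (s : ℝ) :
    1 + stepFun a θ s = ∏ j : Fin n,
      Complex.exp (((Set.Ioc (a j.castSucc : ℝ) (a j.succ)).indicator (fun _ => θ j) s : ℝ) * I) := by
  by_cases h : ∃ j : Fin n, s ∈ Set.Ioc (a j.castSucc : ℝ) (a j.succ)
  · obtain ⟨j, hj⟩ := h
    have hne : ∀ j' ≠ j, s ∉ Set.Ioc (a j'.castSucc : ℝ) (a j'.succ) := by
      intro j' hj' hs
      rcases lt_or_gt_of_ne hj' with hlt | hlt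
      · have h1 : a j'.succ ≤ a j.castSucc := ha (Fin.succ_le_castSucc_iff.2 hlt)
        exact absurd (hs.2.trans (NNReal.coe_le_coe.2 h1)) (not_le.2 hj.1)
      · have h1 : a j.succ ≤ a j'.castSucc := ha (Fin.succ_le_castSucc_iff.2 hlt)
        exact absurd (hj.2.trans (NNReal.coe_le_coe.2 h1)) (not_le.2 hs.1)
    rw [stepFun, Finset.sum_eq_single j, Finset.prod_eq_single j, Set.indicator_of_mem hj,
      Set.indicator_of_mem hj, add_sub_cancel]
    · intro j' _ hj'
      rw [Set.indicator_of_notMem (hne j' hj')]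
      simp
    · simp
    · intro j' _ hj'
      exact Set.indicator_of_notMem (hne j' hj') _
    · simp
  · push Not at h
    rw [stepFun, Finset.sum_eq_zero fun j _ => Set.indicator_of_notMem (h j) _,
      Finset.prod_eq_one fun j _ => ?_, add_zero]
    rw [Set.indicator_of_notMem (h j)]
    simp

lemma norm_one_add_stepFun (ha : Monotone a) (θ : Fin n → ℝ) (s : ℝ) :
    ‖1 + stepFun a θ s‖ ≤ 1 := by
  rw [one_add_stepFun ha, norm_prod]
  exact Finset.prod_le_one (fun _ _ => norm_nonneg _) fun j _ => (Complex.norm_exp_ofReal_mul_I _).le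

lemma measurable_stepFun (θ : Fin n → ℝ) : Measurable (stepFun a θ) :=
  Finset.measurable_fun_sum _ fun _ _ => measurable_const.indicator measurableSet_Ioc

lemma stepFun_eq_zero (ha : Monotone a) (θ : Fin n → ℝ) {s : ℝ} (hs : a (Fin.last n) < s) :
    stepFun a θ s = 0 :=
  Finset.sum_eq_zero fun j _ => Set.indicator_of_notMem
    (fun h => absurd (h.2.trans (NNReal.coe_le_coe.2 (ha (Fin.le_last j.succ)))) (not_le.2 hs)) _

lemma continuousAt_indicator_Ioc {E : Type*} [TopologicalSpace E] [Zero E] {x y s : ℝ} (e : E)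
    (hx : s ≠ x) (hy : s ≠ y) : ContinuousAt ((Set.Ioc x y).indicator fun _ => e) s := by
  rcases lt_or_gt_of_ne hx with h | h
  · refine (continuousAt_const (y := (0 : E))).congr ?_
    filter_upwards [eventually_lt_nhds h] with u hu
    rw [Set.indicator_of_notMem fun h' => absurd h'.1 (not_lt.2 hu.le)]
  · rcases lt_or_gt_of_ne hy with h' | h'
    · refine (continuousAt_const (y := e)).congr ?_
      filter_upwards [eventually_gt_nhds h, eventually_lt_nhds h'] with u hu hu'
      exact (Set.indicator_of_mem (s := Set.Ioc x y) ⟨hu, hu'.le⟩ fun _ => e).symm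
    · refine (continuousAt_const (y := (0 : E))).congr ?_
      filter_upwards [eventually_gt_nhds h'] with u hu
      rw [Set.indicator_of_notMem fun h' => absurd h'.2 (not_le.2 hu)]

lemma continuousAt_stepFun (θ : Fin n → ℝ) {s : ℝ} (hs : s ∉ Set.range fun j => (a j : ℝ)) :
    ContinuousAt (stepFun a θ) s := by
  refine tendsto_finsetSum _ fun j _ => ?_
  exact continuousAt_indicator_Ioc _ (fun h => hs ⟨_, h.symm⟩) (fun h => hs ⟨_, h.symm⟩)

lemma integral_stepFun (ha : Monotone a) (θ : Fin n → ℝ) :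
    ∫ s in (0 : ℝ)..a (Fin.last n), stepFun a θ s =
      ∑ j : Fin n, ((a j.succ - a j.castSucc : ℝ≥0) : ℂ) * (Complex.exp (θ j * I) - 1) := by
  rw [intervalIntegral.integral_of_le (NNReal.coe_nonneg _)]
  unfold stepFun
  rw [integral_finsetSum]
  · refine Finset.sum_congr rfl fun j _ => ?_
    have hle : a j.castSucc ≤ a j.succ := ha (Fin.castSucc_le_succ j)
    have hinter : Set.Ioc (0 : ℝ) (a (Fin.last n)) ∩ Set.Ioc (a j.castSucc : ℝ) (a j.succ) =
        Set.Ioc (a j.castSucc : ℝ) (a j.succ) := by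
      refine Set.inter_eq_right.2 (Set.Ioc_subset_Ioc (NNReal.coe_nonneg _) ?_)
      exact NNReal.coe_le_coe.2 (ha (Fin.le_last _))
    rw [setIntegral_indicator measurableSet_Ioc, hinter, setIntegral_const,
      Real.volume_real_Ioc_of_le (NNReal.coe_le_coe.2 hle), Complex.real_smul, ← NNReal.coe_sub hle]
  · intro j _
    exact (integrable_const _).indicator measurableSet_Ioc

lemma sum_indicator_clock (ω : ℕ → ℝ≥0) {x y : ℝ≥0} (θ : ℝ) {N : ℕ} (hN : clockCount ω y ≤ N) :
    ∑ i ∈ Finset.range N, (Set.Ioc (x : ℝ) y).indicator (fun _ => θ) (clock ω i) =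
      θ * ((clockCount ω y - clockCount ω x : ℕ) : ℝ) := by
  have hset : (Finset.range N).filter (fun i => ((clock ω i : ℝ≥0) : ℝ) ∈ Set.Ioc (x : ℝ) y) =
      Finset.Ico (clockCount ω x) (clockCount ω y) := by
    ext i
    simp only [Finset.mem_filter, Finset.mem_range, Set.mem_Ioc, NNReal.coe_lt_coe,
      NNReal.coe_le_coe, Finset.mem_Ico]
    have h1 := clock_le_iff ω x i
    have h2 := clock_le_iff ω y i
    rw [← not_le (a := clock ω i), h1, h2]
    omega
  simp_rw [Set.indicator_apply]
  rw [← Finset.sum_filter, hset, Finset.sum_const, Nat.card_Ico, nsmul_eq_mul, mul_comm]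

/-- The joint characteristic function of the increments of the counting process. -/
lemma integral_exp_increments (ha : Monotone a) (θ : Fin n → ℝ) :
    ∫ ω, Complex.exp (((∑ j : Fin n,
      θ j * ((clockCount ω (a j.succ) - clockCount ω (a j.castSucc) : ℕ) : ℝ) : ℝ) : ℂ) * I) ∂expSeq =
      ∏ j : Fin n, Complex.exp (((a j.succ - a j.castSucc : ℝ≥0) : ℂ) *
        (Complex.exp (θ j * I) - 1)) := by
  rw [integral_eq_expFunctional (NNReal.coe_nonneg (a (Fin.last n))) (measurable_stepFun (a := a) θ)
    (norm_one_add_stepFun ha θ) (fun s hs => stepFun_eq_zero ha θ hs)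
    (Set.countable_range _) (fun s hs => continuousAt_stepFun θ hs), expFunctional,
    integral_stepFun ha, Complex.exp_sum]
  filter_upwards [ae_clock_eq] with ω hω
  filter_upwards [eventually_ge_atTop (clockCount ω (a (Fin.last n)))] with N hN
  simp_rw [one_add_stepFun ha, ← hω, ← Complex.exp_sum]
  rw [Finset.sum_comm]
  congr 1
  rw [Complex.ofReal_sum, Finset.sum_mul]
  refine Finset.sum_congr rfl fun j _ => ?_
  rw [← Finset.sum_mul, ← Complex.ofReal_sum, sum_indicator_clock]
  exact (clockCount_mono ω (ha (Fin.le_last _))).trans hN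

/-- The increments have Poisson laws, by comparison of the characteristic functions. -/
lemma map_clockCount_sub {x y : ℝ≥0} (hxy : x ≤ y) :
    expSeq.map (fun ω => clockCount ω y - clockCount ω x) = poissonMeasure (y - x) := by
  have hm : Measurable fun ω => clockCount ω y - clockCount ω x :=
    (measurable_clockCount y).sub (measurable_clockCount x)
  refine (MeasurableEmbedding.natCast (α := ℝ)).map_injective ?_
  rw [Measure.map_map measurable_from_nat hm]
  refine Measure.ext_of_charFun ?_
  ext θ
  rw [charFun_map_cast_poissonMeasure (y - x) θ, charFun_apply,
    integral_map (measurable_from_nat.comp hm).aemeasurable (by fun_prop)]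
  have ha : Monotone ![x, y] := by
    intro i j hij
    fin_cases i <;> fin_cases j <;> simp_all
  have := integral_exp_increments ha fun _ => θ
  simpa [Real.inner_apply, mul_comm] using this

lemma iIndepFun_clockCount_sub (ha : Monotone a) :
    iIndepFun (fun (j : Fin n) ω => clockCount ω (a j.succ) - clockCount ω (a j.castSucc))
      expSeq := by
  have hm : ∀ j : Fin n, Measurable fun ω => clockCount ω (a j.succ) - clockCount ω (a j.castSucc) :=
    fun j => (measurable_clockCount _).sub (measurable_clockCount _)
  have key : iIndepFun (fun (j : Fin n) ω =>
      ((clockCount ω (a j.succ) - clockCount ω (a j.castSucc) : ℕ) : ℝ)) expSeq := by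
    have hmr : ∀ j : Fin n, Measurable fun ω =>
        ((clockCount ω (a j.succ) - clockCount ω (a j.castSucc) : ℕ) : ℝ) :=
      fun j => measurable_from_nat.comp (hm j)
    rw [iIndepFun_iff_charFun_pi fun j => (hmr j).aemeasurable]
    intro θ
    have h1 : ∀ j : Fin n, charFun (expSeq.map fun ω =>
        ((clockCount ω (a j.succ) - clockCount ω (a j.castSucc) : ℕ) : ℝ)) (θ j) =
        Complex.exp (((a j.succ - a j.castSucc : ℝ≥0) : ℂ) * (Complex.exp (θ j * I) - 1)) := by
      intro j
      have := charFun_map_cast_poissonMeasure (a j.succ - a j.castSucc) (θ j)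
      rw [← map_clockCount_sub (ha (Fin.castSucc_le_succ j)),
        Measure.map_map measurable_from_nat (hm j)] at this
      exact this
    simp_rw [h1]
    rw [← integral_exp_increments ha θ, charFun_apply, integral_map]
    · refine integral_congr_ae (Eventually.of_forall fun ω => ?_)
      simp only [PiLp.inner_apply, Real.inner_apply]
      simp_rw [mul_comm]
    · have hX := measurable_pi_lambda _ hmr
      exact (WithLp.measurable_toLp 2 (Fin n → ℝ)).comp_aemeasurable hX.aemeasurable
    · fun_prop
  -- The natural number is recovered from its image in `ℝ` by taking the integer part.
  have h2 := key.comp (fun _ => fun r : ℝ => ⌊r⌋₊) fun _ => Nat.measurable_floor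
  simpa [Function.comp_def] using h2

end Clock

/-! ### Time change of the Poisson process with rate one -/

section TimeChange

variable {rate : ℝ≥0 → ℝ≥0} {β : ℝ≥0}

lemma measurable_rate_toNNReal (hrate : Measurable rate) :
    Measurable fun u : ℝ => (rate u.toNNReal : ℝ) :=
  (hrate.comp measurable_real_toNNReal).coe_nnreal_real

lemma abs_rate_le (hβ : ∀ t, rate t ≤ β) (t : ℝ≥0) : |(rate t : ℝ)| ≤ β := by
  rw [abs_of_nonneg (NNReal.coe_nonneg _)]
  exact_mod_cast hβ t

lemma intervalIntegrable_rate (hrate : Measurable rate) (hβ : ∀ t, rate t ≤ β) (s t : ℝ) :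
    IntervalIntegrable (fun u : ℝ => (rate u.toNNReal : ℝ)) volume s t :=
  intervalIntegrable_of_bound (measurable_rate_toNNReal hrate) (fun u => abs_rate_le hβ u.toNNReal)
    s t

lemma coe_cumulativeRate (hrate : Measurable rate) {s t : ℝ≥0}
    (hst : s ≤ t) : (cumulativeRate rate s t : ℝ) = ∫ u in (s : ℝ)..t, (rate u.toNNReal : ℝ) := by
  rw [intervalIntegral.integral_of_le (NNReal.coe_le_coe.2 hst), integral_eq_lintegral_of_nonneg_ae
    (Eventually.of_forall fun u => NNReal.coe_nonneg _)
    (measurable_rate_toNNReal hrate).aestronglyMeasurable, cumulativeRate]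
  simp_rw [ENNReal.ofReal_coe_nnreal]
  rfl

lemma cumulativeRate_self (t : ℝ≥0) : cumulativeRate rate t t = 0 := by
  simp [cumulativeRate]

lemma cumulativeRate_add (hrate : Measurable rate) (hβ : ∀ t, rate t ≤ β) {s t : ℝ≥0}
    (hst : s ≤ t) : cumulativeRate rate 0 s + cumulativeRate rate s t = cumulativeRate rate 0 t := by
  rw [← NNReal.coe_inj, NNReal.coe_add, coe_cumulativeRate hrate zero_le,
    coe_cumulativeRate hrate hst, coe_cumulativeRate hrate zero_le]
  exact intervalIntegral.integral_add_adjacent_intervals (intervalIntegrable_rate hrate hβ _ _)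
    (intervalIntegrable_rate hrate hβ _ _)

lemma cumulativeRate_mono (hrate : Measurable rate) (hβ : ∀ t, rate t ≤ β) :
    Monotone (cumulativeRate rate 0) := by
  intro s t hst
  rw [← cumulativeRate_add hrate hβ hst]
  exact le_self_add

lemma continuous_cumulativeRate (hrate : Measurable rate) (hβ : ∀ t, rate t ≤ β) :
    Continuous (cumulativeRate rate 0) := by
  have h : Continuous fun t : ℝ => ∫ u in (0 : ℝ)..t, (rate u.toNNReal : ℝ) :=
    intervalIntegral.continuous_primitive (intervalIntegrable_rate hrate hβ) 0
  rw [NNReal.isEmbedding_coe.continuous_iff]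
  refine (h.comp NNReal.continuous_coe).congr fun t => ?_
  simp [coe_cumulativeRate hrate (zero_le (a := t))]

/-- The cumulative hazard of the first arrival after time `t`. -/
lemma integral_rate_add (hrate : Measurable rate) (hβ : ∀ t, rate t ≤ β) (t v : ℝ≥0) :
    ∫ u in (0 : ℝ)..v, (rate (t + u.toNNReal) : ℝ) =
      cumulativeRate rate 0 (t + v) - cumulativeRate rate 0 t := by
  have h1 : ∫ u in (0 : ℝ)..v, (rate (t + u.toNNReal) : ℝ) =
      ∫ u in (0 : ℝ)..v, (rate (t + u : ℝ).toNNReal : ℝ) := by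
    refine intervalIntegral.integral_congr fun u hu => ?_
    rw [Set.uIcc_of_le (NNReal.coe_nonneg v)] at hu
    rw [Real.toNNReal_add (NNReal.coe_nonneg _) hu.1, Real.toNNReal_coe]
  rw [h1, intervalIntegral.integral_comp_add_left (fun u : ℝ => (rate u.toNNReal : ℝ)) (t : ℝ),
    add_zero, ← NNReal.coe_add, ← coe_cumulativeRate hrate le_self_add,
    ← cumulativeRate_add hrate hβ (le_self_add : t ≤ t + v), NNReal.coe_add, add_sub_cancel_left]

/-- The first time at which the cumulative rate reaches `y`. -/
def epochOf (rate : ℝ≥0 → ℝ≥0) (y : ℝ≥0) : ℝ≥0∞ :=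
  ⨅ (t : ℝ≥0) (_ : y ≤ cumulativeRate rate 0 t), (t : ℝ≥0∞)

lemma epochOf_le_iff (hrate : Measurable rate) (hβ : ∀ t, rate t ≤ β) {y t : ℝ≥0} :
    epochOf rate y ≤ t ↔ y ≤ cumulativeRate rate 0 t := by
  refine ⟨fun h => ?_, fun h => iInf₂_le t h⟩
  by_contra! hlt
  have hev := (continuous_cumulativeRate hrate hβ).continuousAt (x := t) |>.eventually
    (eventually_lt_nhds hlt)
  obtain ⟨s, hs, hts⟩ := ((hev.filter_mono nhdsWithin_le_nhds).and
    (eventually_mem_nhdsWithin (s := Set.Ioi t))).exists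
  have : (s : ℝ≥0∞) ≤ epochOf rate y := by
    refine le_iInf₂ fun r hr => ENNReal.coe_le_coe.2 ?_
    by_contra! hrs
    exact absurd (hr.trans (cumulativeRate_mono hrate hβ hrs.le)) (not_le.2 hs)
  exact absurd (ENNReal.coe_le_coe.1 (this.trans h)) (not_le.2 hts)

/-- The cumulative rate is continuous, so it takes the value `y` at the first time it reaches `y`. -/
lemma cumulativeRate_epochOf (hrate : Measurable rate) (hβ : ∀ t, rate t ≤ β) {y t : ℝ≥0}
    (h : epochOf rate y = t) : cumulativeRate rate 0 t = y := by
  have h1 : y ≤ cumulativeRate rate 0 t := (epochOf_le_iff hrate hβ).1 h.le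
  obtain ⟨s, hs, hsy⟩ := intermediate_value_Icc (zero_le (a := t))
    (continuous_cumulativeRate hrate hβ).continuousOn
    (⟨by rw [cumulativeRate_self]; exact zero_le, h1⟩ :
      y ∈ Set.Icc (cumulativeRate rate 0 0) (cumulativeRate rate 0 t))
  have h2 : t ≤ s := ENNReal.coe_le_coe.1 (h ▸ (epochOf_le_iff hrate hβ).2 hsy.ge)
  rw [le_antisymm h2 hs.2, hsy]

lemma epochOf_mono : Monotone (epochOf rate) :=
  fun _ _ h => le_iInf₂ fun t ht => iInf₂_le_of_le t (h.trans ht) le_rfl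

lemma tendsto_epochOf (hrate : Measurable rate) (hβ : ∀ t, rate t ≤ β) :
    Tendsto (epochOf rate) atTop (𝓝 ⊤) := by
  refine ENNReal.tendsto_nhds_top_iff_nnreal.2 fun K => ?_
  filter_upwards [eventually_gt_atTop (cumulativeRate rate 0 K)] with y hy
  rw [← not_le, epochOf_le_iff hrate hβ]
  exact not_le.2 hy

lemma arrivalCount_epochOf_clock (hrate : Measurable rate) (hβ : ∀ t, rate t ≤ β)
    (ω : ℕ → ℝ≥0) (t : ℝ≥0) :
    arrivalCount (fun i => epochOf rate (clock ω i)) t = clockCount ω (cumulativeRate rate 0 t) := by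
  unfold clockCount arrivalCount
  simp_rw [epochOf_le_iff hrate hβ, ENNReal.coe_le_coe]

lemma expLaw_singleton (x : ℝ≥0) : expLaw {x} = 0 := by
  rw [← lintegral_indicator_one (measurableSet_singleton x),
    lintegral_expLaw (measurable_one.indicator (measurableSet_singleton x)), lintegral_eq_zero_iff']
  · have h0 : ∀ᵐ u : ℝ ∂volume.restrict (Set.Ioi 0), u ≠ x :=
      ae_restrict_of_ae (by simp [ae_iff])
    filter_upwards [h0, ae_restrict_mem measurableSet_Ioi] with u hu hu0
    have : u.toNNReal ∉ ({x} : Set ℝ≥0) := by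
      rintro rfl
      exact hu (Real.coe_toNNReal u (le_of_lt hu0)).symm
    simp [Set.indicator_of_notMem this]
  · have : Measurable (Set.indicator ({x} : Set ℝ≥0) (1 : ℝ≥0 → ℝ≥0∞)) :=
      measurable_one.indicator (measurableSet_singleton x)
    fun_prop

lemma ae_ne_expLaw (x : ℝ≥0) : ∀ᵐ e ∂expLaw, e ≠ x := by
  rw [ae_iff]
  simpa using expLaw_singleton x

lemma ae_eval_ne_zero_expSeq : ∀ᵐ ω ∂expSeq, ω 0 ≠ 0 :=
  (measurePreserving_eval_infinitePi (fun _ : ℕ => expLaw) 0).quasiMeasurePreserving.ae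
    (ae_ne_expLaw 0)

lemma measurable_epochOf : Measurable (epochOf rate) := epochOf_mono.measurable

/-- The epochs of the Poisson process with rate one, mapped by the inverse of the cumulative rate,
are those of a Poisson process with rate function `rate`. -/
theorem isPoissonArrivals_epochOf_clock (hrate : Measurable rate) (hβ : ∀ t, rate t ≤ β) :
    IsPoissonArrivals rate (fun i ω => epochOf rate (clock ω i)) expSeq := by
  have hcount := arrivalCount_epochOf_clock hrate hβ
  constructor
  · exact fun i => measurable_epochOf.comp (measurable_clock i)
  · exact fun ω => epochOf_mono.comp (clock_mono ω)
  · exact fun ω => (tendsto_epochOf hrate hβ).comp (tendsto_clock ω)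
  · filter_upwards [ae_clock_eq, ae_eval_ne_zero_expSeq] with ω hω h
    rw [hcount, cumulativeRate_self]
    by_contra hne
    have h1 := (clock_le_iff ω 0 0).2 (Nat.pos_of_ne_zero hne)
    rw [hω, partialSum, zero_add, Finset.sum_range_one] at h1
    exact h (le_antisymm h1 zero_le)
  · simp_rw [hcount]
    intro n t ht
    exact iIndepFun_clockCount_sub (a := fun j => cumulativeRate rate 0 (t j))
      ((cumulativeRate_mono hrate hβ).comp ht)
  · intro s t hst
    simp_rw [hcount]
    have h := map_clockCount_sub (cumulativeRate_mono hrate hβ hst)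
    have hr : cumulativeRate rate 0 t - cumulativeRate rate 0 s = cumulativeRate rate s t := by
      rw [← cumulativeRate_add hrate hβ hst, add_tsub_cancel_left]
    rw [hr] at h
    have hm : Measurable fun ω => clockCount ω (cumulativeRate rate 0 t) -
        clockCount ω (cumulativeRate rate 0 s) :=
      (measurable_clockCount (cumulativeRate rate 0 t)).sub
        (measurable_clockCount (cumulativeRate rate 0 s))
    exact ⟨hm.aemeasurable, h⟩

end TimeChange

/-! ### Conditioning on the first arrival -/

section FirstArrival

variable {rate : ℝ≥0 → ℝ≥0} {β : ℝ≥0}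

lemma expLaw_Iic_add (r : ℝ≥0) :
    expLaw (Set.Iic r) + ENNReal.ofReal (Real.exp (-(r : ℝ))) = 1 := by
  have h : expLaw (Set.Ioi r) = ENNReal.ofReal (Real.exp (-(r : ℝ))) := by
    rw [← lintegral_indicator_one measurableSet_Ioi,
      lintegral_expLaw (measurable_one.indicator measurableSet_Ioi), ← lintegral_exp_neg_Ioi,
      ← lintegral_indicator measurableSet_Ioi, ← lintegral_indicator measurableSet_Ioi]
    congr 1
    ext u
    by_cases hu : (r : ℝ) < u
    · have h0 : 0 < u := (NNReal.coe_nonneg r).trans_lt hu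
      rw [Set.indicator_of_mem (Set.mem_Ioi.2 h0), Set.indicator_of_mem (Set.mem_Ioi.2 hu),
        Set.indicator_of_mem (Set.mem_Ioi.2 (Real.lt_toNNReal_iff_coe_lt.2 hu)), Pi.one_apply,
        mul_one]
    · rw [Set.indicator_of_notMem (s := Set.Ioi (r : ℝ)) hu]
      refine Set.indicator_apply_eq_zero.2 fun _ => ?_
      rw [Set.indicator_of_notMem, mul_zero]
      rwa [Set.mem_Ioi, Real.lt_toNNReal_iff_coe_lt]
  rw [← h, ← Set.compl_Iic, measure_add_measure_compl measurableSet_Iic, measure_univ]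

/-- The waiting time for the first arrival after time `t`, cut off at `L`, if the cumulative rate
between `t` and this arrival is `e`. -/
def waitingTime (rate : ℝ≥0 → ℝ≥0) (t L e : ℝ≥0) : ℝ :=
  (min (epochOf rate (cumulativeRate rate 0 t + e)) ((t + L : ℝ≥0) : ℝ≥0∞) - t).toReal

lemma measurable_waitingTime (t L : ℝ≥0) : Measurable (waitingTime rate t L) := by
  have := measurable_epochOf (rate := rate)
  unfold waitingTime
  fun_prop

lemma waitingTime_le_iff (hrate : Measurable rate) (hβ : ∀ t, rate t ≤ β) {t L v e : ℝ≥0}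
    (hv : v < L) : waitingTime rate t L e ≤ v ↔
      e ≤ cumulativeRate rate 0 (t + v) - cumulativeRate rate 0 t := by
  have hne : min (epochOf rate (cumulativeRate rate 0 t + e)) ((t + L : ℝ≥0) : ℝ≥0∞) - t ≠ ⊤ :=
    ENNReal.sub_ne_top (ne_top_of_le_ne_top ENNReal.coe_ne_top (min_le_right _ _))
  have hlt : ¬ ((t + L : ℝ≥0) : ℝ≥0∞) ≤ ((t + v : ℝ≥0) : ℝ≥0∞) := by
    rw [ENNReal.coe_le_coe, not_le]
    gcongr
  rw [waitingTime, ← ENNReal.le_ofReal_iff_toReal_le hne (NNReal.coe_nonneg v),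
    ENNReal.ofReal_coe_nnreal, tsub_le_iff_left, ← ENNReal.coe_add, min_le_iff, or_iff_left hlt,
    epochOf_le_iff hrate hβ, le_tsub_iff_left (cumulativeRate_mono hrate hβ le_self_add)]

lemma waitingTime_le (t L e : ℝ≥0) : waitingTime rate t L e ≤ L := by
  refine ENNReal.toReal_le_of_le_ofReal (NNReal.coe_nonneg _) ?_
  rw [ENNReal.ofReal_coe_nnreal, tsub_le_iff_left, ← ENNReal.coe_add]
  exact min_le_right _ _

/-- The law of the waiting time for the next arrival has hazard rate `u ↦ rate (t + u)`. -/
lemma map_waitingTime (hrate : Measurable rate) (hβ : ∀ t, rate t ≤ β) (t L : ℝ≥0) :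
    expLaw.map (waitingTime rate t L) =
      (volume.restrict (Set.Ioo (0 : ℝ) L)).withDensity (fun u => ENNReal.ofReal
        (rate (t + u.toNNReal) * Real.exp (-∫ s in 0..u, (rate (t + s.toNNReal) : ℝ)))) +
      ENNReal.ofReal (Real.exp (-∫ s in 0..(L : ℝ), (rate (t + s.toNNReal) : ℝ))) •
        Measure.dirac (L : ℝ) := by
  have hW := measurable_waitingTime (rate := rate) t L
  have hρ : Measurable fun u : ℝ => (rate (t + u.toNNReal) : ℝ) :=
    (hrate.comp (measurable_const.add measurable_real_toNNReal)).coe_nnreal_real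
  have hadd := fun {v : ℝ} (hv : 0 ≤ v) => lintegral_hazard_density_add hρ
    (fun u => NNReal.coe_nonneg _) (fun u => abs_rate_le hβ _) hv
  have := Measure.isProbabilityMeasure_map (μ := expLaw) hW.aemeasurable
  refine Measure.ext_of_Iic _ _ fun v => ?_
  rw [Measure.map_apply hW measurableSet_Iic, Measure.add_apply, Measure.smul_apply,
    withDensity_apply _ measurableSet_Iic, Measure.restrict_restrict measurableSet_Iic,
    Measure.dirac_apply' _ measurableSet_Iic, smul_eq_mul]
  rcases lt_or_ge v 0 with hv | hv
  · have h1 : waitingTime rate t L ⁻¹' Set.Iic v = ∅ := by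
      ext e
      simpa [waitingTime] using hv.trans_le ENNReal.toReal_nonneg
    have h2 : Set.Iic v ∩ Set.Ioo (0 : ℝ) L = ∅ := by
      ext u
      simp only [Set.mem_inter_iff, Set.mem_Iic, Set.mem_Ioo, Set.mem_empty_iff_false, iff_false]
      intro h
      linarith [h.1, h.2.1]
    have h3 : (L : ℝ) ∉ Set.Iic v := fun h => absurd (hv.trans_le (NNReal.coe_nonneg L)) (not_lt.2 h)
    rw [h1, h2, Set.indicator_of_notMem h3]
    simp
  rcases lt_or_ge v L with hvL | hvL
  · -- The next arrival occurs before `t + v` if and only if the exponential variable `e` is at most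
    -- the cumulative rate between `t` and `t + v`.
    lift v to ℝ≥0 using hv
    have h1 : waitingTime rate t L ⁻¹' Set.Iic (v : ℝ) =
        Set.Iic (cumulativeRate rate 0 (t + v) - cumulativeRate rate 0 t) := by
      ext e
      exact waitingTime_le_iff hrate hβ (NNReal.coe_lt_coe.1 hvL)
    have h2 : Set.Iic (v : ℝ) ∩ Set.Ioo (0 : ℝ) L = Set.Ioc 0 (v : ℝ) := by
      ext u
      simp only [Set.mem_inter_iff, Set.mem_Iic, Set.mem_Ioo, Set.mem_Ioc]
      constructor
      · exact fun h => ⟨h.2.1, h.1⟩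
      · exact fun h => ⟨h.2, h.1, h.2.trans_lt hvL⟩
    have h3 : (L : ℝ) ∉ Set.Iic (v : ℝ) := not_le.2 hvL
    rw [h1, h2, Set.indicator_of_notMem h3, mul_zero, add_zero, ← setLIntegral_congr Ioo_ae_eq_Ioc]
    have h4 := hadd (NNReal.coe_nonneg v)
    rw [← expLaw_Iic_add (cumulativeRate rate 0 (t + v) - cumulativeRate rate 0 t),
      integral_rate_add hrate hβ,
      ← NNReal.coe_sub (cumulativeRate_mono hrate hβ le_self_add)] at h4
    exact ((ENNReal.add_left_inj ENNReal.ofReal_ne_top).1 h4).symm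
  · have h1 : waitingTime rate t L ⁻¹' Set.Iic v = Set.univ := by
      ext e
      simpa using (waitingTime_le t L e).trans hvL
    have h2 : Set.Iic v ∩ Set.Ioo (0 : ℝ) L = Set.Ioo (0 : ℝ) L := by
      refine Set.inter_eq_right.2 fun u hu => hu.2.le.trans hvL
    rw [h1, h2, Set.indicator_of_mem (Set.mem_Iic.2 hvL), Pi.one_apply, mul_one,
      hadd (NNReal.coe_nonneg L), measure_univ]

lemma lintegral_waitingTime (hrate : Measurable rate) (hβ : ∀ t, rate t ≤ β) (t L : ℝ≥0)
    {F : ℝ → ℝ≥0∞} (hF : Measurable F) :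
    ∫⁻ e, F (waitingTime rate t L e) ∂expLaw =
      (∫⁻ u in Set.Ioo (0 : ℝ) L, ENNReal.ofReal (rate (t + u.toNNReal) *
        Real.exp (-∫ s in 0..u, (rate (t + s.toNNReal) : ℝ))) * F u) +
      ENNReal.ofReal (Real.exp (-∫ s in 0..(L : ℝ), (rate (t + s.toNNReal) : ℝ))) * F L := by
  have hρ : Measurable fun u : ℝ => (rate (t + u.toNNReal) : ℝ) :=
    (hrate.comp (measurable_const.add measurable_real_toNNReal)).coe_nnreal_real
  rw [← lintegral_map hF (measurable_waitingTime t L), map_waitingTime hrate hβ,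
    lintegral_add_measure, lintegral_smul_measure, lintegral_dirac' _ hF,
    lintegral_withDensity_eq_lintegral_mul _ _ hF, smul_eq_mul]
  · rfl
  · exact (measurable_hazard_density hρ fun u => abs_rate_le hβ _).ennreal_ofReal

lemma waitingTime_of_epochOf_le {t L s e : ℝ≥0}
    (h : epochOf rate (cumulativeRate rate 0 t + e) = s) (hs : s ≤ t + L) :
    waitingTime rate t L e = (s - t : ℝ≥0) := by
  rw [waitingTime, h, min_eq_left (ENNReal.coe_le_coe.2 hs), ← ENNReal.coe_sub]
  rfl

lemma waitingTime_of_le_epochOf {t L e : ℝ≥0}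
    (h : ((t + L : ℝ≥0) : ℝ≥0∞) ≤ epochOf rate (cumulativeRate rate 0 t + e)) :
    waitingTime rate t L e = L := by
  rw [waitingTime, min_eq_right h, ← ENNReal.coe_sub, add_tsub_cancel_left]
  rfl

end FirstArrival

/-! ### The value of the queue -/

section Value

variable {rate : ℝ≥0 → ℝ≥0} {β : ℝ≥0} {k : ℕ} {g : ℝ≥0 → ℝ≥0} {φ : ℝ≥0∞ → ℝ≥0∞}
  {Ψ : Measure (ℝ≥0 × ℝ≥0∞)}

/-- The arrival epochs after time `t`, if the cumulative rates between successive arrivals are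
given by `ω`. -/
def epochsFrom (rate : ℝ≥0 → ℝ≥0) (t : ℝ≥0) (ω : ℕ → ℝ≥0) (i : ℕ) : ℝ≥0∞ :=
  epochOf rate (cumulativeRate rate 0 t + partialSum ω (i + 1))

lemma measurable_epochsFrom (hrate : Measurable rate) (hβ : ∀ t, rate t ≤ β)
    {α : Type*} [MeasurableSpace α] {t : α → ℝ≥0} {ω : α → ℕ → ℝ≥0} (ht : Measurable t)
    (hω : Measurable ω) : Measurable fun x => epochsFrom rate (t x) (ω x) := by
  refine measurable_pi_lambda _ fun i => measurable_epochOf.comp ?_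
  exact ((continuous_cumulativeRate hrate hβ).measurable.comp ht).add
    ((measurable_partialSum (i + 1)).comp hω)

lemma epochsFrom_consSeq_zero (t e : ℝ≥0) (ω : ℕ → ℝ≥0) :
    epochsFrom rate t (consSeq e ω) 0 = epochOf rate (cumulativeRate rate 0 t + e) := by
  rw [epochsFrom, partialSum_consSeq, partialSum_zero, add_zero]

/-- After the first arrival, at time `s`, the later epochs start afresh from `s`. -/
lemma epochsFrom_consSeq_succ (hrate : Measurable rate) (hβ : ∀ t, rate t ≤ β) {t s e : ℝ≥0}
    (h : epochOf rate (cumulativeRate rate 0 t + e) = s) (ω : ℕ → ℝ≥0) :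
    (fun i => epochsFrom rate t (consSeq e ω) (i + 1)) = epochsFrom rate s ω := by
  ext1 i
  rw [epochsFrom, epochsFrom, partialSum_consSeq, ← add_assoc, cumulativeRate_epochOf hrate hβ h]

variable (k g φ Ψ) in
/-- The expectation of `φ` applied to the sum of `a` and the cost incurred from time `t` on, if the
state at time `t` is `q` and the cost after the `n`-th arrival after time `t` is taken to be `c`. -/
def value (rate : ℝ≥0 → ℝ≥0) (c : ℝ≥0∞) (n : ℕ) (t : ℝ≥0) (a : ℝ≥0∞) (q : List ℝ≥0) : ℝ≥0∞ :=
  ∫⁻ p, φ (a + costUpTo k g c n t q (epochsFrom rate t p.1) p.2)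
    ∂(expSeq.prod (Measure.infinitePi fun _ : ℕ => Ψ))

variable [IsProbabilityMeasure Ψ]

lemma measurable_value (hrate : Measurable rate) (hβ : ∀ t, rate t ≤ β) (hg : Measurable g)
    (hφ : Measurable φ) (c : ℝ≥0∞) (n : ℕ) {α : Type*} [MeasurableSpace α] {t : α → ℝ≥0}
    {a : α → ℝ≥0∞} {q : α → List ℝ≥0} (ht : Measurable t) (ha : Measurable a) (hq : Measurable q) :
    Measurable fun x => value k g φ Ψ rate c n (t x) (a x) (q x) := by
  refine Measurable.lintegral_prod_right' (f := fun p : α × (ℕ → ℝ≥0) × (ℕ → ℝ≥0 × ℝ≥0∞) =>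
    φ (a p.1 + costUpTo k g c n (t p.1) (q p.1) (epochsFrom rate (t p.1) p.2.1) p.2.2)) ?_
  refine hφ.comp ((ha.comp measurable_fst).add ?_)
  exact measurable_costUpTo k hg c n (ht.comp measurable_fst) (hq.comp measurable_fst)
    (measurable_epochsFrom hrate hβ (ht.comp measurable_fst) measurable_snd.fst) measurable_snd.snd

lemma value_zero (c : ℝ≥0∞) (t : ℝ≥0) (a : ℝ≥0∞) (q : List ℝ≥0) :
    value k g φ Ψ rate c 0 t a q = φ (a + c) := by
  simp [value, costUpTo]

/-- Splitting off the first term of two independent i.i.d. sequences. -/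
lemma lintegral_prod_consSeq {f : (ℕ → ℝ≥0) × (ℕ → ℝ≥0 × ℝ≥0∞) → ℝ≥0∞} (hf : Measurable f) :
    ∫⁻ p, f p ∂(expSeq.prod (Measure.infinitePi fun _ : ℕ => Ψ)) =
      ∫⁻ e, ∫⁻ m, ∫⁻ p, f (consSeq e p.1, consSeq m p.2)
        ∂(expSeq.prod (Measure.infinitePi fun _ : ℕ => Ψ)) ∂Ψ ∂expLaw := by
  have hc : Measurable fun x : (ℝ≥0 × (ℕ → ℝ≥0)) × (ℝ≥0 × ℝ≥0∞) × (ℕ → ℝ≥0 × ℝ≥0∞) =>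
      (consSeq x.1.1 x.1.2, consSeq x.2.1 x.2.2) :=
    (measurable_consSeq.comp measurable_fst).prodMk (measurable_consSeq.comp measurable_snd)
  have h1 : expSeq.prod (Measure.infinitePi fun _ : ℕ => Ψ) =
      ((expLaw.prod expSeq).prod (Ψ.prod (Measure.infinitePi fun _ : ℕ => Ψ))).map
        fun x => (consSeq x.1.1 x.1.2, consSeq x.2.1 x.2.2) := by
    conv_lhs => rw [← map_consSeq_expSeq, ← map_consSeq_infinitePi Ψ]
    exact Measure.map_prod_map _ _ measurable_consSeq measurable_consSeq
  have hfc : Measurable fun x : (ℝ≥0 × (ℕ → ℝ≥0)) × (ℝ≥0 × ℝ≥0∞) × (ℕ → ℝ≥0 × ℝ≥0∞) =>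
      f (consSeq x.1.1 x.1.2, consSeq x.2.1 x.2.2) := hf.comp hc
  conv_lhs => rw [h1, lintegral_map hf hc, lintegral_prod _ hfc.aemeasurable]
  rw [lintegral_prod]
  · refine lintegral_congr fun e => ?_
    have : ∀ ω, ∫⁻ y : (ℝ≥0 × ℝ≥0∞) × (ℕ → ℝ≥0 × ℝ≥0∞), f (consSeq e ω, consSeq y.1 y.2)
        ∂(Ψ.prod (Measure.infinitePi fun _ : ℕ => Ψ)) =
        ∫⁻ m, ∫⁻ m', f (consSeq e ω, consSeq m m') ∂(Measure.infinitePi fun _ : ℕ => Ψ) ∂Ψ := by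
      intro ω
      rw [lintegral_prod]
      exact (hfc.comp (measurable_const (a := (e, ω)) |>.prodMk measurable_id)).aemeasurable
    simp_rw [this]
    rw [lintegral_lintegral_swap]
    · refine lintegral_congr fun m => ?_
      rw [lintegral_prod]
      exact (hfc.comp (f := fun p : (ℕ → ℝ≥0) × (ℕ → ℝ≥0 × ℝ≥0∞) => ((e, p.1), (m, p.2)))
        (by fun_prop)).aemeasurable
    · refine (Measurable.lintegral_prod_right' (f := fun p : ((ℕ → ℝ≥0) × (ℝ≥0 × ℝ≥0∞)) ×
        (ℕ → ℝ≥0 × ℝ≥0∞) => f (consSeq e p.1.1, consSeq p.1.2 p.2)) ?_).aemeasurable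
      exact hfc.comp (f := fun p : ((ℕ → ℝ≥0) × (ℝ≥0 × ℝ≥0∞)) × (ℕ → ℝ≥0 × ℝ≥0∞) =>
        ((e, p.1.1), (p.1.2, p.2))) (by fun_prop)
  · exact hfc.lintegral_prod_right'.aemeasurable

/-- The value satisfies the recursion given by `hazardStep`: condition on the first arrival. -/
theorem value_succ (hrate : Measurable rate) (hβ : ∀ t, rate t ≤ β) (hg : Measurable g)
    (hφ : Measurable φ) (c : ℝ≥0∞) (n : ℕ) (t : ℝ≥0) (a : ℝ≥0∞) (q : List ℝ≥0) :
    value k g φ Ψ rate c (n + 1) t a q =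
      hazardStep k g φ Ψ (fun u => rate (t + u.toNNReal))
        (fun u => value k g φ Ψ rate c n (t + u.toNNReal)) a q := by
  have hf : Measurable fun p : (ℕ → ℝ≥0) × (ℕ → ℝ≥0 × ℝ≥0∞) =>
      φ (a + costUpTo k g c (n + 1) t q (epochsFrom rate t p.1) p.2) :=
    hφ.comp (measurable_const.add (measurable_costUpTo k hg c (n + 1) measurable_const
      measurable_const (measurable_epochsFrom hrate hβ measurable_const measurable_fst)
      measurable_snd))
  set F : ℝ → ℝ≥0∞ := fun u => if u < q.sum then
    afterArrival k g Ψ (value k g φ Ψ rate c n (t + u.toNNReal)) a q u.toNNReal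
    else φ (a + segCost g q.sum ⊤) with hF
  have hFm : Measurable F := by
    refine Measurable.ite measurableSet_Iio ?_ measurable_const
    refine Measurable.lintegral_prod_right' (f := fun p : ℝ × (ℝ≥0 × ℝ≥0∞) =>
      value k g φ Ψ rate c n (t + p.1.toNNReal) (a + segCost g q.sum p.1.toNNReal)
        (arrive k p.1.toNNReal p.2 q)) ?_
    have h1 : Measurable fun p : ℝ × (ℝ≥0 × ℝ≥0∞) => p.1.toNNReal :=
      measurable_real_toNNReal.comp measurable_fst
    exact measurable_value hrate hβ hg hφ c n (measurable_const.add h1)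
      (measurable_const.add (measurable_segCost hg measurable_const h1.coe_nnreal_ennreal))
      (measurable_arrive k h1 measurable_snd measurable_const)
  rw [value, lintegral_prod_consSeq hf]
  have hmain : ∀ᵐ e ∂expLaw, ∫⁻ m, ∫⁻ p, φ (a + costUpTo k g c (n + 1) t q
      (epochsFrom rate t (consSeq e p.1)) (consSeq m p.2))
        ∂(expSeq.prod (Measure.infinitePi fun _ : ℕ => Ψ)) ∂Ψ =
      F (waitingTime rate t q.sum e) := by
    -- Exclude an arrival at time `t`, and an arrival at the very moment when the system is empty.
    filter_upwards [ae_ne_expLaw 0,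
      ae_ne_expLaw (cumulativeRate rate 0 (t + q.sum) - cumulativeRate rate 0 t)] with e he0 heL
    simp only [costUpTo, epochsFrom_consSeq_zero]
    rcases lt_or_ge ((t + q.sum : ℝ≥0) : ℝ≥0∞) (epochOf rate (cumulativeRate rate 0 t + e))
      with hlt | hle
    · have hcond : (q.sum : ℝ≥0∞) < epochOf rate (cumulativeRate rate 0 t + e) - t := by
        rwa [lt_tsub_iff_left, ← ENNReal.coe_add]
      simp only [if_pos hcond, lintegral_const, measure_univ, mul_one]
      rw [waitingTime_of_le_epochOf hlt.le, hF]
      simp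
    · obtain ⟨s, hs⟩ : ∃ s : ℝ≥0, (s : ℝ≥0∞) = epochOf rate (cumulativeRate rate 0 t + e) :=
        ⟨_, ENNReal.coe_toNNReal (ne_top_of_le_ne_top ENNReal.coe_ne_top hle)⟩
      rw [← hs, ENNReal.coe_le_coe] at hle
      have hcum := cumulativeRate_epochOf hrate hβ hs.symm
      have hts : t ≤ s := by
        by_contra! hst
        have := cumulativeRate_mono hrate hβ hst.le
        rw [hcum] at this
        exact he0 (le_antisymm (by simpa using this) zero_le)
      have hsL : s < t + q.sum := by
        refine lt_of_le_of_ne hle ?_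
        rintro rfl
        exact heL (by rw [hcum, add_tsub_cancel_left])
      have hcond : ¬ (q.sum : ℝ≥0∞) < epochOf rate (cumulativeRate rate 0 t + e) - t := by
        rw [not_lt, ← hs, tsub_le_iff_left, ← ENNReal.coe_add]
        exact ENNReal.coe_le_coe.2 hle
      simp only [if_neg hcond, epochsFrom_consSeq_succ hrate hβ hs.symm]
      rw [waitingTime_of_epochOf_le hs.symm hle, hF]
      have hlt' : ((s - t : ℝ≥0) : ℝ) < q.sum := by
        rw [NNReal.coe_lt_coe, tsub_lt_iff_left hts]
        exact hsL
      simp only [if_pos hlt', Real.toNNReal_coe, add_tsub_cancel_of_le hts, ← hs,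
        ENNReal.toNNReal_coe, ← ENNReal.coe_sub]
      simp only [afterArrival, value, add_assoc]
      rfl
  rw [lintegral_congr_ae hmain, lintegral_waitingTime hrate hβ t q.sum hFm, hazardStep]
  congr 1
  · refine setLIntegral_congr_fun measurableSet_Ioo fun u hu => ?_
    simp only [hF, if_pos hu.2]
  · simp [hF]

/-- For a constant rate, the value does not depend on the time. -/
lemma value_const (hg : Measurable g) (hφ : Measurable φ) (β : ℝ≥0) (n : ℕ) (t : ℝ≥0) (a : ℝ≥0∞)
    (q : List ℝ≥0) :
    value k g φ Ψ (fun _ => β) ⊤ n t a q = homValue k g φ Ψ β n a q := by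
  induction n generalizing t a q with
  | zero => rw [value_zero, add_top]; rfl
  | succ n ih =>
    rw [value_succ (β := β) measurable_const (fun _ => le_rfl) hg hφ, homValue, homStep]
    congr 1
    ext u a q
    exact ih _ a q

/-- The iterates dominate the value of the cost incurred so far. -/
lemma le_homValue (hφ : Monotone φ) (β : ℝ≥0) (n : ℕ) (a : ℝ≥0∞) (q : List ℝ≥0) :
    φ a ≤ homValue k g φ Ψ β n a q := by
  induction n generalizing a q with
  | zero => exact hφ le_top
  | succ n ih =>
    have hm := lintegral_hazard_density_add (ρ := fun _ => (β : ℝ)) (C := β) measurable_const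
      (fun _ => β.2) (fun _ => by simp) (v := q.sum) (NNReal.coe_nonneg _)
    calc φ a = ((∫⁻ u in Set.Ioo (0 : ℝ) q.sum,
          ENNReal.ofReal (β * Real.exp (-∫ s in 0..u, (β : ℝ)))) +
          ENNReal.ofReal (Real.exp (-∫ s in 0..(q.sum : ℝ), (β : ℝ)))) * φ a := by rw [hm, one_mul]
      _ = (∫⁻ u in Set.Ioo (0 : ℝ) q.sum,
          ENNReal.ofReal (β * Real.exp (-∫ s in 0..u, (β : ℝ))) * φ a) +
          ENNReal.ofReal (Real.exp (-∫ s in 0..(q.sum : ℝ), (β : ℝ))) * φ a := by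
        rw [add_mul, lintegral_mul_const]
        exact (measurable_hazard_density (C := β) measurable_const fun _ => by simp).ennreal_ofReal
      _ ≤ _ := by
        rw [homValue, homStep, hazardStep]
        gcongr with u
        · calc φ a = ∫⁻ _, φ a ∂Ψ := by simp
            _ ≤ _ := lintegral_mono fun m => (hφ le_self_add).trans (ih _ _)
        · exact hφ le_self_add

/-- The comparison of the inhomogeneous with the homogeneous system. -/
theorem value_zero_le_homLimit (hrate : Measurable rate) (hβ : ∀ t, rate t ≤ β)
    (hg : Measurable g) (hφ : Monotone φ) (hφ1 : φ ⊤ ≤ 1) (n : ℕ) (t : ℝ≥0) (a : ℝ≥0∞)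
    (q : List ℝ≥0) : value k g φ Ψ rate 0 n t a q ≤ homLimit k g φ Ψ β a q := by
  induction n generalizing t a q with
  | zero =>
    rw [value_zero, add_zero]
    exact le_iInf fun n => le_homValue hφ β n a q
  | succ n ih =>
    rw [value_succ hrate hβ hg hφ.measurable]
    refine (hazardStep_mono hφ (fun u c d q h => (ih _ c q).trans (homLimit_mono hφ β h q))
      le_rfl q).trans (hazardStep_homLimit_le hg hφ hφ1 ?_ ?_ ?_ a q)
    · exact (hrate.comp (measurable_const.add measurable_real_toNNReal)).coe_nnreal_real
    · exact fun u => NNReal.coe_nonneg _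
    · exact fun u => NNReal.coe_le_coe.2 (hβ _)

end Value

/-! ### Comparison of the holding costs -/

section Comparison

variable {Ω : Type*} [MeasurableSpace Ω] {P : Measure Ω}
  {rate : ℝ≥0 → ℝ≥0} {β : ℝ≥0} {Ψ : Measure (ℝ≥0 × ℝ≥0∞)}
  {T : ℕ → Ω → ℝ≥0∞} {mark : ℕ → Ω → ℝ≥0 × ℝ≥0∞} {g : ℝ≥0 → ℝ≥0}

lemma IsQueueInput.measurable_path (h : IsQueueInput rate Ψ T mark P) :
    Measurable fun ω => ((fun i => T i ω), (fun i => mark i ω)) :=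
  (measurable_pi_lambda _ h.arrivals.measurable_epoch).prodMk
    (measurable_pi_lambda _ h.measurable_mark)

lemma IsQueueInput.measurable_costUpTo (h : IsQueueInput rate Ψ T mark P) (hg : Measurable g)
    (k : ℕ) (c : ℝ≥0∞) (n : ℕ) (q : List ℝ≥0) :
    Measurable fun ω => costUpTo k g c n 0 q (fun i => T i ω) (fun i => mark i ω) :=
  LCFSQueue.measurable_costUpTo k hg c n measurable_const measurable_const
    (measurable_pi_lambda _ h.arrivals.measurable_epoch) (measurable_pi_lambda _ h.measurable_mark)

lemma IsQueueInput.holdingCost_eq (h : IsQueueInput rate Ψ T mark P) (k : ℕ) (x : ℝ≥0) (ω : Ω) :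
    holdingCost k g x (fun i => T i ω) (fun i => mark i ω) =
      ⨆ n, costUpTo k g 0 n 0 [x] (fun i => T i ω) (fun i => mark i ω) :=
  holdingCost_eq_iSup k g x _ (h.arrivals.mono ω) (h.arrivals.locallyFinite ω)

lemma IsQueueInput.measurable_holdingCost (h : IsQueueInput rate Ψ T mark P) (hg : Measurable g)
    (k : ℕ) (x : ℝ≥0) :
    Measurable fun ω => holdingCost k g x (fun i => T i ω) (fun i => mark i ω) := by
  simp_rw [h.holdingCost_eq]
  exact Measurable.iSup fun n => h.measurable_costUpTo hg k 0 n [x]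

variable [IsProbabilityMeasure P] [IsProbabilityMeasure Ψ]

/-- Every input of the queue has the law of the time-changed Poisson process with rate one and an
independent i.i.d. sequence of marks. -/
lemma IsQueueInput.map_eq_epochsFrom (h : IsQueueInput rate Ψ T mark P) (hrate : Measurable rate)
    (hβ : ∀ t, rate t ≤ β) :
    P.map (fun ω => ((fun i => T i ω), (fun i => mark i ω))) =
      (expSeq.prod (Measure.infinitePi fun _ : ℕ => Ψ)).map
        fun p => (epochsFrom rate 0 p.1, p.2) := by
  have hm : Measurable (epochsFrom rate 0) :=
    measurable_epochsFrom hrate hβ measurable_const measurable_id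
  have hclock : P.map (fun ω i => T i ω) = expSeq.map (epochsFrom rate 0) := by
    rw [h.arrivals.map_epoch_eq (isPoissonArrivals_epochOf_clock hrate hβ)]
    refine Measure.map_congr ?_
    filter_upwards [ae_clock_eq] with ω hω
    ext1 i
    rw [hω, epochsFrom, cumulativeRate_self, zero_add]
  have hprod := Measure.map_prod_map expSeq (Measure.infinitePi fun _ : ℕ => Ψ) hm measurable_id
  rw [Measure.map_id] at hprod
  rw [h.map_eq, hclock, hprod]
  rfl

lemma IsQueueInput.lintegral_costUpTo (h : IsQueueInput rate Ψ T mark P) (hrate : Measurable rate)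
    (hβ : ∀ t, rate t ≤ β) (hg : Measurable g) {φ : ℝ≥0∞ → ℝ≥0∞} (hφ : Measurable φ) (k : ℕ)
    (c : ℝ≥0∞) (n : ℕ) (q : List ℝ≥0) :
    ∫⁻ ω, φ (costUpTo k g c n 0 q (fun i => T i ω) (fun i => mark i ω)) ∂P =
      value k g φ Ψ rate c n 0 0 q := by
  have hf : Measurable fun p : (ℕ → ℝ≥0∞) × (ℕ → ℝ≥0 × ℝ≥0∞) =>
      φ (costUpTo k g c n 0 q p.1 p.2) :=
    hφ.comp (LCFSQueue.measurable_costUpTo k hg c n measurable_const measurable_const measurable_fst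
      measurable_snd)
  have hm : Measurable fun p : (ℕ → ℝ≥0) × (ℕ → ℝ≥0 × ℝ≥0∞) => (epochsFrom rate 0 p.1, p.2) :=
    (measurable_epochsFrom hrate hβ measurable_const measurable_fst).prodMk measurable_snd
  rw [← lintegral_map (f := fun p : (ℕ → ℝ≥0∞) × (ℕ → ℝ≥0 × ℝ≥0∞) =>
      φ (costUpTo k g c n 0 q p.1 p.2)) (g := fun ω => ((fun i => T i ω), (fun i => mark i ω))) hf
      h.measurable_path, h.map_eq_epochsFrom hrate hβ, lintegral_map hf hm, value]
  simp_rw [zero_add]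

/-- The system with constant arrival rate `β` survives `n` arrivals with a probability that tends to
zero. -/
lemma IsQueueInput.iInf_measure_eq_zero (h : IsQueueInput (fun _ => β) Ψ T mark P) (k : ℕ)
    (x : ℝ≥0) :
    ⨅ n, P {ω | costUpTo k (fun _ => 0) ⊤ n 0 [x] (fun i => T i ω) (fun i => mark i ω) = ⊤} = 0 := by
  rw [← neverEmpty_eq_zero k Ψ β (q := [x]) (by simp), neverEmpty, homLimit]
  congr 1
  ext1 n
  rw [← value_const measurable_const topIndicator_mono.measurable β n 0, ← h.lintegral_costUpTo
    (β := β) measurable_const (fun _ => le_rfl) measurable_const topIndicator_mono.measurable,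
    ← lintegral_indicator_one]
  · refine lintegral_congr fun ω => ?_
    simp only [topIndicator, Set.indicator_apply, Pi.one_apply, Set.mem_ofPred_eq]
  · exact h.measurable_costUpTo measurable_const k ⊤ n [x] (measurableSet_singleton ⊤)

lemma monotone_indicator_Ioi (s : ℝ≥0∞) :
    Monotone ((Set.Ioi s).indicator (1 : ℝ≥0∞ → ℝ≥0∞)) := by
  intro a b hab
  by_cases ha : a ∈ Set.Ioi s
  · rw [Set.indicator_of_mem ha, Set.indicator_of_mem (Set.mem_Ioi.2 (ha.trans_le hab))]
    exact le_rfl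
  · rw [Set.indicator_of_notMem ha]
    exact zero_le

lemma IsQueueInput.measure_lt_costUpTo (h : IsQueueInput rate Ψ T mark P) (hrate : Measurable rate)
    (hβ : ∀ t, rate t ≤ β) (hg : Measurable g) (k : ℕ) (c : ℝ≥0∞) (n : ℕ) (q : List ℝ≥0)
    (s : ℝ≥0∞) :
    P {ω | s < costUpTo k g c n 0 q (fun i => T i ω) (fun i => mark i ω)} =
      value k g ((Set.Ioi s).indicator 1) Ψ rate c n 0 0 q := by
  rw [← h.lintegral_costUpTo hrate hβ hg (monotone_indicator_Ioi s).measurable,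
    ← lintegral_indicator_one]
  · rfl
  · exact h.measurable_costUpTo hg k c n q measurableSet_Ioi

variable {Ω' : Type*} [MeasurableSpace Ω'] {P' : Measure Ω'} [IsProbabilityMeasure P']
  {T' : ℕ → Ω' → ℝ≥0∞} {mark' : ℕ → Ω' → ℝ≥0 × ℝ≥0∞}

/-- The stochastic comparison of the holding costs. -/
theorem IsQueueInput.measure_lt_holdingCost_le (h : IsQueueInput rate Ψ T mark P)
    (h' : IsQueueInput (fun _ => β) Ψ T' mark' P') (hrate : Measurable rate)
    (hβ : ∀ t, rate t ≤ β) (hg : Measurable g) (k : ℕ) (x : ℝ≥0) (s : ℝ≥0∞) :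
    P {ω | s < holdingCost k g x (fun i => T i ω) (fun i => mark i ω)} ≤
      P' {ω | s < holdingCost k g x (fun i => T' i ω) (fun i => mark' i ω)} := by
  have hφ := monotone_indicator_Ioi s
  have hφ1 : (Set.Ioi s).indicator (1 : ℝ≥0∞ → ℝ≥0∞) ⊤ ≤ 1 :=
    Set.indicator_apply_le' (fun _ => le_rfl) fun _ => zero_le_one
  have hunion : {ω | s < holdingCost k g x (fun i => T i ω) (fun i => mark i ω)} =
      ⋃ n, {ω | s < costUpTo k g 0 n 0 [x] (fun i => T i ω) (fun i => mark i ω)} := by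
    ext ω
    simp only [Set.mem_ofPred_eq, Set.mem_iUnion, h.holdingCost_eq, lt_iSup_iff]
  have hmono : Monotone fun n =>
      {ω | s < costUpTo k g 0 n 0 [x] (fun i => T i ω) (fun i => mark i ω)} :=
    monotone_nat_of_le_succ fun n ω hω => lt_of_lt_of_le hω (costUpTo_zero_le_succ k g n _ _ _ _)
  rw [hunion, hmono.measure_iUnion]
  refine iSup_le fun i => ?_
  refine (le_iInf fun n => ?_).trans_eq (ENNReal.add_iInf.symm.trans
    ((congrArg _ (h'.iInf_measure_eq_zero k x)).trans (add_zero _)))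
  calc P {ω | s < costUpTo k g 0 i 0 [x] (fun i => T i ω) (fun i => mark i ω)}
      = value k g ((Set.Ioi s).indicator 1) Ψ rate 0 i 0 0 [x] :=
        h.measure_lt_costUpTo hrate hβ hg k 0 i [x] s
    _ ≤ homLimit k g ((Set.Ioi s).indicator 1) Ψ β 0 [x] :=
        value_zero_le_homLimit hrate hβ hg hφ hφ1 i 0 0 [x]
    _ ≤ homValue k g ((Set.Ioi s).indicator 1) Ψ β n 0 [x] := iInf_le _ n
    _ = P' {ω | s < costUpTo k g ⊤ n 0 [x] (fun i => T' i ω) (fun i => mark' i ω)} := by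
        rw [h'.measure_lt_costUpTo (β := β) measurable_const (fun _ => le_rfl) hg,
          value_const hg hφ.measurable]
    _ ≤ P' ({ω | s < holdingCost k g x (fun i => T' i ω) (fun i => mark' i ω)} ∪
        {ω | costUpTo k (fun _ => 0) ⊤ n 0 [x] (fun i => T' i ω) (fun i => mark' i ω) = ⊤}) := by
        -- Unless the system survives `n` arrivals, the overestimate is the exact cost.
        refine measure_mono fun ω hω => ?_
        by_cases htop : costUpTo k (fun _ => 0) ⊤ n 0 [x] (fun i => T' i ω) (fun i => mark' i ω) = ⊤
        · exact Or.inr htop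
        · refine Or.inl ?_
          rw [Set.mem_ofPred_eq, costUpTo_top_eq_zero k g n _ _ _ _ htop] at hω
          rw [Set.mem_ofPred_eq, h'.holdingCost_eq]
          exact hω.trans_le (le_iSup (fun n => costUpTo k g 0 n 0 [x] (fun i => T' i ω)
            (fun i => mark' i ω)) n)
    _ ≤ _ := measure_union_le _ _

/-- The holding cost is finite whenever the busy period ends after finitely many arrivals. -/
theorem IsQueueInput.ae_holdingCost_lt_top (h : IsQueueInput (fun _ => β) Ψ T mark P)
    (hg : ∀ M : ℝ≥0, ∫⁻ w in Set.Ioc (0 : ℝ) M, (g w.toNNReal : ℝ≥0∞) < ⊤) (k : ℕ) (x : ℝ≥0) :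
    ∀ᵐ ω ∂P, holdingCost k g x (fun i => T i ω) (fun i => mark i ω) < ⊤ := by
  rw [ae_iff]
  refine le_antisymm ?_ zero_le
  rw [← h.iInf_measure_eq_zero k x]
  refine le_iInf fun n => measure_mono fun ω hω => ?_
  by_contra hne
  refine hω ?_
  rw [h.holdingCost_eq]
  exact (iSup_le fun i => costUpTo_zero_le_top k g i n _ _ _ _).trans_lt
    (costUpTo_top_lt_top hg k n _ _ _ _ hne)

end Comparison

end LCFSQueue

end

theorem mainTheorem3
    {Ω : Type*} [MeasurableSpace Ω] (P : Measure Ω) [IsProbabilityMeasure P]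
    {Ω' : Type*} [MeasurableSpace Ω'] (P' : Measure Ω') [IsProbabilityMeasure P']
    (rate : ℝ≥0 → ℝ≥0) (hrate : Measurable rate)
    (rateH : ℝ≥0) (hle : ∀ t, rate t ≤ rateH)
    (g : ℝ≥0 → ℝ≥0) (hg : Measurable g)
    (x : ℝ≥0) (hx : 0 < x)
    (Ψ : Measure (ℝ≥0 × ℝ≥0∞)) (hΨ : LCFSQueue.IsServicePatienceLaw Ψ)
    (k : ℕ)
    (T : ℕ → Ω → ℝ≥0∞) (mark : ℕ → Ω → ℝ≥0 × ℝ≥0∞)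
    (hinput : LCFSQueue.IsQueueInput rate Ψ T mark P)
    (T' : ℕ → Ω' → ℝ≥0∞) (mark' : ℕ → Ω' → ℝ≥0 × ℝ≥0∞)
    (hinput' : LCFSQueue.IsQueueInput (fun _ => rateH) Ψ T' mark' P') :
    LCFSQueue.StochLE P P'
        (fun ω => LCFSQueue.holdingCost k g x (fun i => T i ω) (fun i => mark i ω))
        (fun ω => LCFSQueue.holdingCost k g x (fun i => T' i ω) (fun i => mark' i ω)) ∧
      ((∀ M : ℝ≥0, ∫⁻ w in Set.Ioc (0 : ℝ) M, (g w.toNNReal : ℝ≥0∞) < ⊤) →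
        ∀ᵐ ω ∂P',
          LCFSQueue.holdingCost k g x (fun i => T' i ω) (fun i => mark' i ω) < ⊤) := by
  have := hΨ.isProbabilityMeasure
  refine ⟨⟨?_, ?_, fun s => ?_⟩, fun hfin => ?_⟩
  · exact (hinput.measurable_holdingCost hg k x).aemeasurable
  · exact (hinput'.measurable_holdingCost hg k x).aemeasurable
  · exact hinput.measure_lt_holdingCost_le hinput' hrate hle hg k x s
  · exact hinput'.ae_holdingCost_lt_top hfin k x
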